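/- Let $n\ge 2$ and $k\ge 1$ be integers. Let $$W_k^{2n-1}=\{z\in\mathbb C^{n+1} : z_0^k+z_1^2+\dots+z_n^2=0,\ |z|^2=2\}$$ be the Brieskorn manifold, with the $1$-form $\alpha_k=k(x_0\,dy_0-y_0\,dx_0)+2\sum_{j=1}^n(x_j\,dy_j-y_j\,dx_j)$, where $z_j=x_j+iy_j$. Put $B=\{z\in W_k^{2n-1}: z_0=0\}$ and $\theta(z)=z_0/|z_0|$ on $W_k^{2n-1}\setminus B$. Then: 1. $W_k^{2n-1}$ is a closed manifold of dimension $2n-1$, $\alpha_k$ is a contact form on it, and $(B,\theta)$ is an open book: $B$ is a closed codimension-$2$ submanifold, $\theta$ is a smooth locally trivial fibre bundle over $S^1$, and $B$ has a neighbourhood diffeomorphic to $B\times D^2$ (with $B=B\times\{0\}$) in which $\theta$ is the angular coordinate of $D^2$. 2. The contact structure $\ker\alpha_k$ is supported by $(B,\theta)$ (with adapted form $\alpha_k$): $\alpha_k|_{TB}$ is a contact form on $B$; $d\alpha_k$ is symplectic on every page $P=\theta^{-1}(s)$, $s\in S^1$; and the orientation of $B$ given by its contact form agrees with its orientation as the boundary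 of $\bar P=P\cup B$, where $P$ is oriented by $d\alpha_k$. 3. $(B,\ker\alpha_k|_{TB})$ is contactomorphic to $W_2^{2n-3}$ with the contact form $\alpha_2$. 4. The monodromy is a $k$-fold right-handed Dehn twist. Precisely, let $f_k:\mathbb R\to\mathbb R$ be any smooth non-decreasing function that vanishes on $(-\infty,a]$ for some $a>0$, equals $\pi k$ on some $[b,\infty)$, and for which $h_k(r)=1-\int_0^r s f_k'(s)\,ds$ is positive for all $r\ge 0$; such functions exist. On $T^*S^{n-1}=\{(q,p)\in\mathbb R^n\times\mathbb R^n: |q|=1,\ q\perp p\}$ let, with $g_k=\pi k+f_k(|p|)$, $$\tau_k(q,p)=\big(\cos g_k\,q+|p|^{-1}\sin g_k\,p,\ -|p|\sin g_k\,q+\cos g_k\,p\big)$$ (with $\tau_k=(-1)^k\,\mathrm{id}$ at $p=0$). Then $\tau_k$ is a diffeomorphism of $T^*S^{n-1}$; the form $$\beta_k=h_k(|p|)\,dt-t|p|\,d\big(f_k(|p|)\big)+p\cdot dq$$ on $\mathbb R\times T^*S^{n-1}$ descends to the mapping torus $\mathbb R\times T^*S^{n-1}/\sim_k$, $(t;q,p)\sim_k(t+1;\tau_k(q,p))$;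 and there is a diffeomorphism $C$ from this mapping torus onto $W_k^{2n-1}\setminus B$ with $C^*\alpha_k=u\,\beta_k$ for a positive function $u$ (a contactomorphism) and $\theta(C([t;q,p]))=e^{2\pi i t}$. In particular all of this holds for every Ustilovsky sphere, i.e. for every $W_k^{2n-1}$ with $n\ge 2$, $2n-1\equiv 1 \bmod 4$ and $k\equiv\pm1 \bmod 8$. -/

import Mathlib

open Set Filter Topology
open scoped ContDiff

noncomputable section

namespace BrieskornBook

/-! ### Embedded submanifolds of finite-dimensional real vector spaces -/

section Submanifolds

variable {E F : Type*} [NormedAddCommGroup E] [NormedSpace ℝ E]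
  [NormedAddCommGroup F] [NormedSpace ℝ F]

/-- `M` is a smooth embedded submanifold of dimension `d` (without boundary) of the
finite-dimensional space `E`: near each of its points it is the zero set of a smooth submersion
onto a Euclidean space of dimension `dim E - d`. -/
def IsSmoothSubmanifold (d : ℕ) (M : Set E) : Prop :=
  ∃ c : ℕ, Module.finrank ℝ E = d + c ∧
    ∀ x ∈ M, ∃ U : Set E, IsOpen U ∧ x ∈ U ∧ ∃ G : E → EuclideanSpace ℝ (Fin c),
      ContDiffOn ℝ ∞ G U ∧ (∀ y ∈ U, Function.Surjective (fderiv ℝ G y)) ∧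
      M ∩ U = {y ∈ U | G y = 0}

/-- The tangent space `T_x M` of a submanifold `M ⊆ E`, as a linear subspace of `E`. -/
def tangentAt (M : Set E) (x : E) : Submodule ℝ E :=
  Submodule.span ℝ (tangentConeAt ℝ M x)

/-- `f` restricts to a diffeomorphism from `M` to `N` (subsets of vector spaces). -/
def IsDiffeo (f : E → F) (M : Set E) (N : Set F) : Prop :=
  ContDiffOn ℝ ∞ f M ∧ MapsTo f M N ∧
    ∃ g : F → E, ContDiffOn ℝ ∞ g N ∧ MapsTo g N M ∧ InvOn g f M N

end Submanifolds

/-! ### Differential forms, contact forms, symplectic forms, orientations -/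

section Forms

variable {E F : Type*} [NormedAddCommGroup E] [NormedSpace ℝ E]
  [NormedAddCommGroup F] [NormedSpace ℝ F]

/-- The exterior derivative `dα` of a `1`-form `α` on `E`, evaluated at `x` on two vectors. -/
def extDer (α : E → E →L[ℝ] ℝ) (x v w : E) : ℝ :=
  extDeriv (fun y => ContinuousAlternatingMap.ofSubsingleton ℝ E ℝ (0 : Fin 1) (α y)) x ![v, w]

theorem extDer_eq (α : E → E →L[ℝ] ℝ) (x v w : E) (h : DifferentiableAt ℝ α x) :
    extDer α x v w = fderiv ℝ α x v w - fderiv ℝ α x w v := by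
  unfold extDer
  have hd : DifferentiableAt ℝ
      (fun y => ContinuousAlternatingMap.ofSubsingleton ℝ E ℝ (0 : Fin 1) (α y)) x := by
    exact (ContinuousAlternatingMap.ofSubsingletonLIE (𝕜 := ℝ) (E := E) (F := ℝ)
      (0 : Fin 1)).toContinuousLinearEquiv.differentiableAt.comp x h
  rw [extDeriv_apply hd]
  have key : ∀ a b : E, fderiv ℝ (fun y => α y a) x b = fderiv ℝ α x b a := by
    intro a b
    rw [fderiv_clm_apply h (differentiableAt_const a)]
    simp
  simp [Fin.sum_univ_two, key, Fin.removeNth, sub_eq_add_neg]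

/-- The value of the `(2 j)`-form `η ∧ ⋯ ∧ η` (`j` factors) on `2 j` vectors, up to a positive
constant depending only on `j`. -/
def symplecticVolume (η : E → E → ℝ) {j : ℕ} (v : Fin (2 * j) → E) : ℝ :=
  ∑ σ : Equiv.Perm (Fin (2 * j)), ((Equiv.Perm.sign σ : ℤ) : ℝ) *
    ∏ i : Fin j, η (v (σ ⟨2 * i, by omega⟩)) (v (σ ⟨2 * i + 1, by omega⟩))

/-- The value at `x` of the `(2 j + 1)`-form `α ∧ (dα) ∧ ⋯ ∧ (dα)` (`j` factors `dα`) on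
`2 j + 1` vectors, up to a positive constant depending only on `j`. -/
def contactVolume (α : E → E →L[ℝ] ℝ) (x : E) {j : ℕ} (v : Fin (2 * j + 1) → E) : ℝ :=
  ∑ σ : Equiv.Perm (Fin (2 * j + 1)), ((Equiv.Perm.sign σ : ℤ) : ℝ) *
    (α x (v (σ 0)) *
      ∏ i : Fin j, extDer α x (v (σ ⟨2 * i + 1, by omega⟩)) (v (σ ⟨2 * i + 2, by omega⟩)))

/-- The `1`-form `α` restricts to a contact form on the submanifold `M`: at every point of `M`
it does not vanish on `T M`, and `dα` is non-degenerate on `ker α ∩ T M`. -/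
structure IsContactForm (M : Set E) (α : E → E →L[ℝ] ℝ) : Prop where
  smooth : ∀ x ∈ M, ContDiffAt ℝ ∞ α x
  ne_zero : ∀ x ∈ M, ∃ v ∈ tangentAt M x, α x v ≠ 0
  nondegenerate : ∀ x ∈ M, ∀ v ∈ tangentAt M x, α x v = 0 →
    (∀ w ∈ tangentAt M x, α x w = 0 → extDer α x v w = 0) → v = 0

/-- The exact (hence closed) `2`-form `dα` restricts to a symplectic form on the
submanifold `P`. -/
structure IsSymplecticDifferential (P : Set E) (α : E → E →L[ℝ] ℝ) : Prop where
  smooth : ∀ x ∈ P, ContDiffAt ℝ ∞ α x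
  nondegenerate : ∀ x ∈ P, ∀ v ∈ tangentAt P x,
    (∀ w ∈ tangentAt P x, extDer α x v w = 0) → v = 0

/-- `f` is a (coorientation preserving) contactomorphism from `(M, ker α)` to `(N, ker β)`:
a diffeomorphism with `f^* β = u α` for a positive function `u` on `M`. -/
def IsContactomorphism (f : E → F) (M : Set E) (α : E → E →L[ℝ] ℝ) (N : Set F)
    (β : F → F →L[ℝ] ℝ) : Prop :=
  IsDiffeo f M N ∧ ∃ u : E → ℝ, ∀ x ∈ M, 0 < u x ∧
    ∀ v ∈ tangentAt M x, β (f x) (fderivWithin ℝ f M x v) = u x * α x v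

end Forms

/-! ### Open books -/

section OpenBooks

variable {E : Type*} [NormedAddCommGroup E] [NormedSpace ℝ E]

/-- The page `θ⁻¹(s)` of an open book on `M` with binding `B`. -/
def page (M B : Set E) (θ : E → ℂ) (s : ℂ) : Set E := {x ∈ M \ B | θ x = s}

/-- `(B, θ)` is an open book on the closed manifold `M` of dimension `d + 2`. The circle is the
unit circle in `ℂ`. -/
structure IsOpenBook (d : ℕ) (M B : Set E) (θ : E → ℂ) : Prop where
  compact : IsCompact M
  submanifold : IsSmoothSubmanifold (d + 2) M
  binding_subset : B ⊆ M
  binding_compact : IsCompact B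
  binding_submanifold : IsSmoothSubmanifold d B
  smooth : ContDiffOn ℝ ∞ θ (M \ B)
  mapsTo : MapsTo θ (M \ B) (Metric.sphere 0 1)
  page_submanifold : ∀ s ∈ Metric.sphere (0 : ℂ) 1, IsSmoothSubmanifold (d + 1) (page M B θ s)
  /-- `θ : M \ B → S¹` is a smooth locally trivial fibre bundle. -/
  locally_trivial : ∀ s ∈ Metric.sphere (0 : ℂ) 1, ∃ V : Set ℂ, IsOpen V ∧ s ∈ V ∧
    ∃ T : ℂ × E → E,
      IsDiffeo T ((Metric.sphere 0 1 ∩ V) ×ˢ page M B θ s) ((M \ B) ∩ θ ⁻¹' V) ∧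
      ∀ w ∈ Metric.sphere (0 : ℂ) 1 ∩ V, ∀ x ∈ page M B θ s, θ (T (w, x)) = w
  /-- `B` has a neighbourhood `M ∩ U ≅ B × D²` in `M` (in particular its normal bundle is
  trivial) in which `θ` is the angular coordinate of the disk `D²`. -/
  tube : ∃ U : Set E, IsOpen U ∧ ∃ T : E × ℂ → E,
      IsDiffeo T (B ×ˢ Metric.ball 0 1) (M ∩ U) ∧ (∀ b ∈ B, T (b, 0) = b) ∧
      ∀ b ∈ B, ∀ w ∈ Metric.ball (0 : ℂ) 1, w ≠ 0 → θ (T (b, w)) = w / (‖w‖ : ℂ)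

/-- The orientation of `B` given by the contact form `α` is its orientation as the boundary of
the closure `P ∪ B` of the page `P`, oriented by `dα` on its interior `P`, with the convention
"outward normal first". Namely: let `ν, v 0, …, v (2 j)` be vector fields along `P ∪ B`,
tangent to `P`, continuous at a point `b ∈ B`, such that `ν b` points outward and
`v 0 b, …, v (2 j) b` is a basis of `T_b B` which is positive for `α ∧ (dα) ^ j`. Then
`ν, v 0, …, v (2 j)` is positive for `(dα) ^ (j + 1)` at all points of `P` near `b`. -/
def InducesBoundaryOrientation (P B : Set E) (α : E → E →L[ℝ] ℝ) : Prop :=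
  ∀ b ∈ B, ∀ (j : ℕ) (ν : E → E) (v : Fin (2 * j + 1) → E → E),
    (∀ x ∈ P, ν x ∈ tangentAt P x ∧ ∀ i, v i x ∈ tangentAt P x) →
    ContinuousWithinAt ν (closure P) b → (∀ i, ContinuousWithinAt (v i) (closure P) b) →
    -ν b ∈ posTangentConeAt (closure P) b → ν b ∉ tangentAt B b →
    LinearIndependent ℝ (fun i => v i b) →
    Submodule.span ℝ (range fun i => v i b) = tangentAt B b →
    0 < contactVolume α b (fun i => v i b) →
    ∀ᶠ x in 𝓝[P] b, 0 < symplecticVolume (extDer α x) (j := j + 1)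
      (Fin.cons (ν x) (fun i => v i x) : Fin (2 * j + 1 + 1) → E)

/-- The contact structure `ker α` on `M` is supported by the open book `(B, θ)`, and `α` is an
adapted contact form. -/
structure IsSupportedBy (M : Set E) (α : E → E →L[ℝ] ℝ) (B : Set E) (θ : E → ℂ) : Prop where
  contact : IsContactForm M α
  binding_contact : IsContactForm B α
  page_symplectic : ∀ s ∈ Metric.sphere (0 : ℂ) 1, IsSymplecticDifferential (page M B θ s) α
  orientation : ∀ s ∈ Metric.sphere (0 : ℂ) 1, InducesBoundaryOrientation (page M B θ s) B α

end OpenBooks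

/-! ### Mapping tori -/

section MappingTori

variable {E F : Type*} [NormedAddCommGroup E] [NormedSpace ℝ E]
  [NormedAddCommGroup F] [NormedSpace ℝ F]

/-- The mapping torus `ℝ × X / ∼` of `τ : X → X`: the quotient by the equivalence relation
generated by `(t, x) ∼ (t + 1, τ x)`. -/
def MappingTorus (X : Set F) (τ : F → F) : Type _ :=
  Quot fun a b : ℝ × X => b.1 = a.1 + 1 ∧ (b.2 : F) = τ a.2

/-- The class of `(t, x)` in the mapping torus. -/
def MappingTorus.mk {X : Set F} {τ : F → F} (t : ℝ) (x : X) : MappingTorus X τ :=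
  Quot.mk _ (t, x)

/-- The projection of the mapping torus to the circle `ℝ / ℤ`, identified with the unit circle
in `ℂ` by `t ↦ exp (2 π i t)`. -/
def MappingTorus.proj {X : Set F} {τ : F → F} : MappingTorus X τ → ℂ :=
  Quot.lift (fun a => Complex.exp (2 * Real.pi * Complex.I * (a.1 : ℂ))) (by
    rintro a b ⟨h, -⟩
    simp only [h]
    push_cast
    rw [mul_add, mul_one, Complex.exp_add, Complex.exp_two_pi_mul_I, mul_one])

/-- The `1`-form `β` on `ℝ × X` is invariant under `(t, x) ↦ (t + 1, τ x)`, i.e. it descends to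
the mapping torus. -/
def DescendsToMappingTorus (X : Set F) (τ : F → F) (β : ℝ × F → ℝ × F →L[ℝ] ℝ) : Prop :=
  ∀ y ∈ (univ : Set ℝ) ×ˢ X, ∀ v ∈ tangentAt ((univ : Set ℝ) ×ˢ X) y,
    β (y.1 + 1, τ y.2)
      (fderivWithin ℝ (fun a : ℝ × F => (a.1 + 1, τ a.2)) ((univ : Set ℝ) ×ˢ X) y v) = β y v

/-- The bijection `C` from the mapping torus of `τ : X → X` to `N` is a contactomorphism for the
contact forms `β` (given by its lift to `ℝ × X`) and `α`. The smooth structure on the mapping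
torus is the one for which `ℝ × X → ℝ × X / ∼` is a local diffeomorphism: `C` is smooth if its
lift `L` to `ℝ × X` is, and `C⁻¹` is smooth if it lifts locally to smooth maps to `ℝ × X`. -/
structure IsMappingTorusContactomorphism {X : Set F} {τ : F → F} {N : Set E}
    (C : MappingTorus X τ ≃ N) (β : ℝ × F → ℝ × F →L[ℝ] ℝ) (α : E → E →L[ℝ] ℝ) : Prop where
  smooth_pullback : ∃ (L : ℝ × F → E) (u : ℝ × F → ℝ),
    ContDiffOn ℝ ∞ L ((univ : Set ℝ) ×ˢ X) ∧
    (∀ (t : ℝ) (x : X), L (t, x) = C (MappingTorus.mk t x)) ∧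
    ∀ y ∈ (univ : Set ℝ) ×ˢ X, 0 < u y ∧ ∀ v ∈ tangentAt ((univ : Set ℝ) ×ˢ X) y,
      α (L y) (fderivWithin ℝ L ((univ : Set ℝ) ×ˢ X) y v) = u y * β y v
  smooth_symm : ∀ z ∈ N, ∃ U : Set E, IsOpen U ∧ z ∈ U ∧ ∃ s : E → ℝ × F,
    ContDiffOn ℝ ∞ s (N ∩ U) ∧ ∀ w : N, (w : E) ∈ U →
      ∃ x : X, (s w).2 = x ∧ C.symm w = MappingTorus.mk (s w).1 x

end MappingTori

/-! ### Dehn twists on `T^*S^{n-1}` -/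

section DehnTwists

/-- `T^*S^{n-1} = {(q, p) ∈ ℝⁿ × ℝⁿ : |q| = 1, q ⟂ p}`. -/
def cotangentSphere (n : ℕ) : Set (EuclideanSpace ℝ (Fin n) × EuclideanSpace ℝ (Fin n)) :=
  {x | ‖x.1‖ = 1 ∧ inner ℝ x.1 x.2 = 0}

/-- The `k`-fold Dehn twist `τ_k` with profile `f = f_k`. -/
def dehnTwist (n k : ℕ) (f : ℝ → ℝ)
    (x : EuclideanSpace ℝ (Fin n) × EuclideanSpace ℝ (Fin n)) :
    EuclideanSpace ℝ (Fin n) × EuclideanSpace ℝ (Fin n) :=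
  let g : ℝ := Real.pi * k + f ‖x.2‖
  (Real.cos g • x.1 + (‖x.2‖⁻¹ * Real.sin g) • x.2,
    -(‖x.2‖ * Real.sin g) • x.1 + Real.cos g • x.2)

/-- `h_k(r) = 1 - ∫₀ʳ s f_k'(s) ds`. -/
def twistPrimitive (f : ℝ → ℝ) (r : ℝ) : ℝ := 1 - ∫ s in (0 : ℝ)..r, s * deriv f s

/-- Admissible profiles of a right-handed `k`-fold Dehn twist: `f` is smooth, increases
monotonically from `0` (near `r = 0`) to `π k` (for large `r`), and `h_k` is positive. -/
structure IsTwistProfile (k : ℕ) (f : ℝ → ℝ) : Prop where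
  smooth : ContDiff ℝ ∞ f
  mono : Monotone f
  near_zero : ∃ a > 0, ∀ r ≤ a, f r = 0
  near_infinity : ∃ b, ∀ r ≥ b, f r = Real.pi * k
  primitive_pos : ∀ r ≥ 0, 0 < twistPrimitive f r

/-- The form `β_k = h_k(|p|) dt - t |p| d(f_k(|p|)) + p · dq` on `ℝ × T^*S^{n-1}`. -/
def torusForm (n : ℕ) (f : ℝ → ℝ)
    (y : ℝ × EuclideanSpace ℝ (Fin n) × EuclideanSpace ℝ (Fin n)) :
    ℝ × EuclideanSpace ℝ (Fin n) × EuclideanSpace ℝ (Fin n) →L[ℝ] ℝ :=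
  let V := EuclideanSpace ℝ (Fin n)
  let t : ℝ := y.1
  let p : V := y.2.2
  let dt : ℝ × V × V →L[ℝ] ℝ := ContinuousLinearMap.fst ℝ ℝ (V × V)
  let dq : ℝ × V × V →L[ℝ] V :=
    (ContinuousLinearMap.fst ℝ V V).comp (ContinuousLinearMap.snd ℝ ℝ (V × V))
  let dp : ℝ × V × V →L[ℝ] V :=
    (ContinuousLinearMap.snd ℝ V V).comp (ContinuousLinearMap.snd ℝ ℝ (V × V))
  twistPrimitive f ‖p‖ • dt - (t * ‖p‖) • (fderiv ℝ (fun a : V => f ‖a‖) p).comp dp +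
    (innerSL ℝ p).comp dq

end DehnTwists

/-! ### Brieskorn manifolds -/

section Brieskorn

/-- The Brieskorn manifold `W_k^{2n-1} ⊆ ℂⁿ⁺¹`. -/
def brieskorn (n k : ℕ) : Set (EuclideanSpace ℂ (Fin (n + 1))) :=
  {z | z 0 ^ k + ∑ j : Fin n, z j.succ ^ 2 = 0} ∩ Metric.sphere 0 (√2)

/-- The `1`-form `x_j dy_j - y_j dx_j` on `ℂⁿ⁺¹`. -/
def rotationForm (n : ℕ) (j : Fin (n + 1)) (z : EuclideanSpace ℂ (Fin (n + 1))) :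
    EuclideanSpace ℂ (Fin (n + 1)) →L[ℝ] ℝ :=
  let dz : EuclideanSpace ℂ (Fin (n + 1)) →L[ℝ] ℂ :=
    (EuclideanSpace.proj j : EuclideanSpace ℂ (Fin (n + 1)) →L[ℂ] ℂ).restrictScalars ℝ
  (z j).re • Complex.imCLM.comp dz - (z j).im • Complex.reCLM.comp dz

/-- The form `α_k = k (x₀ dy₀ - y₀ dx₀) + 2 ∑_{j = 1}^n (x_j dy_j - y_j dx_j)`. -/
def brieskornForm (n k : ℕ) (z : EuclideanSpace ℂ (Fin (n + 1))) :
    EuclideanSpace ℂ (Fin (n + 1)) →L[ℝ] ℝ :=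
  (k : ℝ) • rotationForm n 0 z + (2 : ℝ) • ∑ j : Fin n, rotationForm n j.succ z

/-- The binding `B = {z₀ = 0}`. -/
def binding (n k : ℕ) : Set (EuclideanSpace ℂ (Fin (n + 1))) := {z ∈ brieskorn n k | z 0 = 0}

/-- The fibration `θ = z₀ / |z₀|`. -/
def fibration (n : ℕ) (z : EuclideanSpace ℂ (Fin (n + 1))) : ℂ := z 0 / (‖z 0‖ : ℂ)

/-- The contact structure `ker α_k` on `W_k^{2n-1}` is supported by the open book `(B, θ)`, whose
binding is `W_2^{2n-3}` and whose monodromy is a `k`-fold right-handed Dehn twist. -/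
structure HasDehnTwistOpenBook (n k : ℕ) : Prop where
  open_book : IsOpenBook (2 * n - 3) (brieskorn n k) (binding n k) (fibration n)
  supported : IsSupportedBy (brieskorn n k) (brieskornForm n k) (binding n k) (fibration n)
  binding_contactomorphic : ∃ b : EuclideanSpace ℂ (Fin (n + 1)) →
      EuclideanSpace ℂ (Fin (n - 1 + 1)),
    IsContactomorphism b (binding n k) (brieskornForm n k)
      (brieskorn (n - 1) 2) (brieskornForm (n - 1) 2)
  exists_profile : ∃ f : ℝ → ℝ, IsTwistProfile k f
  /-- For every admissible profile `f`, the Dehn twist `τ` is a diffeomorphism of `T^*S^{n-1}`,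
  the form `β` descends to its mapping torus, and the latter is contactomorphic to `W \ B`
  over the circle. -/
  monodromy : ∀ f : ℝ → ℝ, IsTwistProfile k f →
    IsDiffeo (dehnTwist n k f) (cotangentSphere n) (cotangentSphere n) ∧
    DescendsToMappingTorus (cotangentSphere n) (dehnTwist n k f) (torusForm n f) ∧
    ∃ C : MappingTorus (cotangentSphere n) (dehnTwist n k f) ≃
        ↥(brieskorn n k \ binding n k),
      IsMappingTorusContactomorphism C (torusForm n f) (brieskornForm n k) ∧
      ∀ m, fibration n (C m) = MappingTorus.proj m

/-- `W_k^{2n-1}` is an Ustilovsky sphere: `2n - 1 ≡ 1 mod 4` and `k ≡ ±1 mod 8`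
(with `2n - 1 > 1`). -/
def IsUstilovskySphere (n k : ℕ) : Prop :=
  2 ≤ n ∧ 2 * n - 1 ≡ 1 [MOD 4] ∧ (k ≡ 1 [MOD 8] ∨ k ≡ 7 [MOD 8])

end Brieskorn

end BrieskornBook

end

open Set Filter Topology
open scoped ContDiff

noncomputable section

namespace BrieskornBook

/-! ### Tangent spaces of level sets and derivatives along submanifolds. -/

section Tangents

variable {E F H : Type*} [NormedAddCommGroup E] [NormedSpace ℝ E]
  [NormedAddCommGroup F] [NormedSpace ℝ F] [NormedAddCommGroup H] [NormedSpace ℝ H]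

/-! Write z = (z₀, u) and α = α_k. The contact geometry rests on the Euler field X = (2z₀/k, u) of
the weighted scaling. Along W the defining polynomial has derivative zero on X, |z|² increases along
X, and R = iX is tangent to W with α(R) = 4 and dα(R, ·) a multiple of d|z|². Moreover dα(v, iv) > 0
for v ≠ 0. Hence, in a complex subspace containing X, only the multiples of R are dα-orthogonal to
all directions tangent to the sphere (`eq_smul_reeb_of_null`). This gives the contact condition on W
and on B. Since R is transverse to the pages, it also gives the symplectic condition there. A
weighted rotation, the flow of R up to time scale, turns θ rigidly and so trivializes it locally.
The tube around B is explicit: (b, w) goes to (w, λu + μū) with λ, μ depending on w only.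

At B the form dα degenerates on the tangent directions of the closed page, so the boundary
orientation cannot be tested there. On a page there is a field Y with dα(Y, ·) a negative multiple
of d|z₀|, and α(Y) < 0 near B. Contracting α ∧ (dα)^(j+1) with Y (`apply_mul_symplecticVolume`)
shows that (dα)^(j+1) and d|z₀| ∧ α ∧ (dα)^j have opposite signs on the page near B. The second form
extends continuously to B and is visibly negative there on an outward frame.

For the monodromy put Φ(r) = 1 + ∫₀ʳ f = h(r) + r f(r) and σ(r) = r/Φ(r). The normalized geodesic
flow with variable time c sends p·dq to p·dq + |p| dc (`inner_fderiv_geodesicRotation`), and this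
shows at once that β descends. On W \ B write z₀ = r exp(2πit) and u = exp(πikt)(ξ + iη). The
equations say that ξ ⟂ η and that |ξ|, |η| are functions of r. Let (t; q, p) correspond to ξ = aP, η
= bQ, where (Q, P) is (q, p) moved by the flow for time -t f(|p|). Then α pulls back to 4πk dt + 4ab
P·dQ (`brieskornForm_polarPoint`), with P·dQ = p·dq - |p| d(t f). If ab = πk/Φ, this is (4πk/Φ) β.

That choice means |ξ||η| = πkσ(|p|). As σ' = h/Φ² > 0 and f is eventually πk, πkσ increases from 0
towards 1 on [0, ∞). As r decreases from 1 to 0, |ξ||η| increases from 0 to 1. So r is determined by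
|p| and everything can be inverted (`torusInv`). After one turn the flow time changes by -f, and
exp(πik) = (-1)^k is the flow for time πk; this is the twist τ_k. -/

/-- Derivatives within M agree on the tangent cone, hence by linearity on its span. Off the tangent
space `fderivWithin` is not determined, so all later computations with it go through tangent
vectors. -/
theorem HasFDerivWithinAt.eq_of_mem_tangentAt {f : E → F} {f' g' : E →L[ℝ] F} {M : Set E} {x v : E}
    (hf : HasFDerivWithinAt f f' M x) (hg : HasFDerivWithinAt f g' M x) (hv : v ∈ tangentAt M x) :
    f' v = g' v := by
  have h : EqOn f' g' (tangentConeAt ℝ M x) := hf.unique_on hg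
  have := LinearMap.eqOn_span (f := (f' : E →ₗ[ℝ] F)) (g := (g' : E →ₗ[ℝ] F)) h
  exact this hv

theorem fderivWithin_apply_of_mem_tangentAt {f : E → F} {f' : E →L[ℝ] F} {M : Set E} {x v : E}
    (hf : HasFDerivWithinAt f f' M x) (hv : v ∈ tangentAt M x) :
    fderivWithin ℝ f M x v = f' v :=
  HasFDerivWithinAt.eq_of_mem_tangentAt hf.differentiableWithinAt.hasFDerivWithinAt hf hv

/-- Functions which agree on `M` have the same derivative on tangent vectors of `M`. -/
theorem fderiv_eq_of_eqOn {f g : E → F} {f' g' : E →L[ℝ] F} {M : Set E} {x v : E}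
    (hf : HasFDerivAt f f' x) (hg : HasFDerivAt g g' x) (hfg : EqOn f g M) (hx : x ∈ M)
    (hv : v ∈ tangentAt M x) : f' v = g' v :=
  HasFDerivWithinAt.eq_of_mem_tangentAt hf.hasFDerivWithinAt
    (hg.hasFDerivWithinAt.congr hfg (hfg hx)) hv

theorem fderiv_eq_zero_of_const {f : E → F} {f' : E →L[ℝ] F} {M : Set E} {x v : E} {c : F}
    (hf : HasFDerivAt f f' x) (hc : ∀ y ∈ M, f y = c) (hx : x ∈ M)
    (hv : v ∈ tangentAt M x) : f' v = 0 := by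
  simpa using fderiv_eq_of_eqOn hf (hasFDerivAt_const c x) hc hx hv

theorem mem_tangentAt_of_curve {M : Set E} {γ : ℝ → E} {x v : E} (hγ : HasDerivAt γ v 0)
    (h0 : γ 0 = x) (hM : ∀ᶠ t in 𝓝 0, γ t ∈ M) : v ∈ tangentAt M x := by
  apply Submodule.subset_span
  have hlim := hasDerivAt_iff_tendsto_slope_zero.1 hγ
  simp only [zero_add, h0] at hlim
  refine mem_tangentConeAt_of_frequently (𝓝[≠] (0 : ℝ)) (fun t => t⁻¹) (fun t => γ t - x) ?_ ?_ hlim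
  · have := (hγ.continuousAt.tendsto.sub_const x)
    rw [h0, sub_self] at this
    exact this.mono_left nhdsWithin_le_nhds
  · exact ((hM.filter_mono nhdsWithin_le_nhds).mono fun t ht => by simpa using ht).frequently

/-- The tangent space of a regular level set is the kernel of the derivative. -/
theorem tangentAt_eq_ker [CompleteSpace E] [FiniteDimensional ℝ H] {M : Set E} {x : E} {G : E → H}
    {G' : E →L[ℝ] H} (hG : HasStrictFDerivAt G G' x) (hs : Function.Surjective G')
    (hGx : G x = 0) (hM : ∀ᶠ y in 𝓝 x, y ∈ M ↔ G y = 0) :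
    tangentAt M x = LinearMap.ker (G' : E →ₗ[ℝ] H) := by
  have hr : LinearMap.range (G' : E →ₗ[ℝ] H) = ⊤ := LinearMap.range_eq_top.2 hs
  apply le_antisymm
  · intro v hv
    have hev : G =ᶠ[𝓝[M] x] fun _ => (0 : H) := by
      filter_upwards [self_mem_nhdsWithin, hM.filter_mono nhdsWithin_le_nhds] with y hy hy'
      exact hy'.1 hy
    have h0 : HasFDerivWithinAt G (0 : E →L[ℝ] H) M x :=
      (hasFDerivWithinAt_const (0 : H) x M).congr_of_eventuallyEq hev hGx
    exact HasFDerivWithinAt.eq_of_mem_tangentAt hG.hasFDerivAt.hasFDerivWithinAt h0 hv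
  · intro v hv
    -- The implicit function parametrizes the level set by the kernel. It carries the line ℝv to a
    -- curve in M with velocity v.
    set φ := HasStrictFDerivAt.implicitFunction G G' hG hr (G x) with hφ
    have hφ' := (hG.to_implicitFunction hr).hasFDerivAt
    have hφ0 : φ 0 = x := hG.implicitFunction_apply_image hr
    let w : LinearMap.ker (G' : E →ₗ[ℝ] H) := ⟨v, hv⟩
    have hline : HasDerivAt (fun t : ℝ => t • w) w 0 := by
      simpa using (hasDerivAt_id (0 : ℝ)).smul_const w
    have hcurve : HasDerivAt (fun t : ℝ => φ (t • w)) v 0 := by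
      have h1 : HasFDerivAt φ (LinearMap.ker (G' : E →ₗ[ℝ] H)).subtypeL ((0 : ℝ) • w) := by
        rw [zero_smul]; exact hφ'
      exact h1.comp_hasDerivAt (0 : ℝ) hline
    refine mem_tangentAt_of_curve hcurve (by simp [hφ0]) ?_
    have hc : Tendsto (fun t : ℝ => φ (t • w)) (𝓝 0) (𝓝 x) := by
      have := hcurve.continuousAt.tendsto
      simpa [hφ0] using this
    have hz : Tendsto (fun t : ℝ => (G x, t • w)) (𝓝 0) (𝓝 (G x, 0)) := by
      apply tendsto_const_nhds.prodMk_nhds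
      have := hline.continuousAt.tendsto
      simpa using this
    filter_upwards [hc.eventually hM, hz.eventually (hG.map_implicitFunction_eq hr)] with t h1 h2
    exact h1.2 (h2.trans hGx)

theorem finrank_tangentAt [FiniteDimensional ℝ E] [FiniteDimensional ℝ H] {M : Set E} {x : E}
    {G : E → H} {G' : E →L[ℝ] H} (hG : HasStrictFDerivAt G G' x) (hs : Function.Surjective G')
    (hGx : G x = 0) (hM : ∀ᶠ y in 𝓝 x, y ∈ M ↔ G y = 0) :
    Module.finrank ℝ (tangentAt M x) + Module.finrank ℝ H = Module.finrank ℝ E := by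
  have : CompleteSpace E := FiniteDimensional.complete ℝ E
  rw [tangentAt_eq_ker hG hs hGx hM, ← LinearMap.finrank_range_add_finrank_ker
    (G' : E →ₗ[ℝ] H), LinearMap.range_eq_top.2 hs, finrank_top, add_comm]

/-- If R is a right inverse of A, then BR is close to the identity for B near A, hence invertible,
and B is surjective. -/
theorem isOpen_surjective [FiniteDimensional ℝ H] :
    IsOpen {A : E →L[ℝ] H | Function.Surjective A} := by
  have : CompleteSpace H := FiniteDimensional.complete ℝ H
  rw [isOpen_iff_mem_nhds]
  intro A hA
  obtain ⟨R, hR⟩ := A.exists_rightInverse_of_surjective (LinearMap.range_eq_top.2 hA)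
  have hc : Continuous fun B : E →L[ℝ] H => B.comp R := by fun_prop
  have : {B : E →L[ℝ] H | IsUnit (B.comp R : H →L[ℝ] H)} ∈ 𝓝 A := by
    refine (Units.isOpen.preimage hc).mem_nhds ?_
    change IsUnit (A.comp R)
    rw [hR]
    exact isUnit_one
  filter_upwards [this] with B hB
  obtain ⟨u, hu⟩ := hB
  intro h
  refine ⟨R ((↑u⁻¹ : H →L[ℝ] H) h), ?_⟩
  have h1 : (u : H →L[ℝ] H) * ↑u⁻¹ = 1 := u.mul_inv
  rw [hu] at h1
  exact congrArg (fun T : H →L[ℝ] H => T h) h1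

/-- Regularity is only needed on M itself: surjectivity of the derivative is an open condition, so
the neighbourhood can be shrunk. -/
theorem isSmoothSubmanifold_of_regular [FiniteDimensional ℝ H] {d : ℕ}
    {M : Set E} (hd : Module.finrank ℝ E = d + Module.finrank ℝ H) (G : E → H)
    (hG : ContDiff ℝ ∞ G) (hs : ∀ x ∈ M, Function.Surjective (fderiv ℝ G x))
    (hM : ∀ x ∈ M, ∃ U : Set E, IsOpen U ∧ x ∈ U ∧ M ∩ U = {y ∈ U | G y = 0}) :
    IsSmoothSubmanifold d M := by
  refine ⟨_, hd, fun x hx => ?_⟩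
  obtain ⟨U, hU, hxU, hMU⟩ := hM x hx
  let e : H ≃L[ℝ] EuclideanSpace ℝ (Fin (Module.finrank ℝ H)) :=
    ContinuousLinearEquiv.ofFinrankEq (by simp)
  have hc : Continuous (fderiv ℝ G) := hG.continuous_fderiv (by simp)
  refine ⟨U ∩ {y | Function.Surjective (fderiv ℝ G y)}, hU.inter (isOpen_surjective.preimage hc),
    ⟨hxU, hs x hx⟩, fun y => e (G y), (e.contDiff.comp hG).contDiffOn, ?_, ?_⟩
  · rintro y ⟨-, hy⟩
    have : fderiv ℝ (fun y => e (G y)) y = (e : H →L[ℝ] _).comp (fderiv ℝ G y) :=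
      (e.hasFDerivAt.comp y (hG.differentiable (by simp) y).hasFDerivAt).fderiv
    rw [this]
    exact e.surjective.comp hy
  · ext y
    have := Set.ext_iff.1 hMU y
    simp only [mem_inter_iff, mem_ofPred_eq, EmbeddingLike.map_eq_zero_iff] at this ⊢
    tauto

theorem eventually_mem_iff {E : Type*} [TopologicalSpace E] {M U : Set E} {x : E} {p : E → Prop} (hU : IsOpen U) (hx : x ∈ U)
    (h : M ∩ U = {y ∈ U | p y}) : ∀ᶠ y in 𝓝 x, y ∈ M ↔ p y := by
  filter_upwards [hU.mem_nhds hx] with y hy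
  have := Set.ext_iff.1 h y
  simp only [mem_inter_iff, mem_ofPred_eq] at this
  tauto

theorem posTangentConeAt_subset_tangentAt {M : Set E} {x v : E} (hv : v ∈ posTangentConeAt M x) :
    v ∈ tangentAt M x :=
  Submodule.subset_span (tangentConeAt_mono_field hv)

theorem fderiv_nonneg_of_posTangentConeAt {M : Set E} {x v : E} {f : E → ℝ} {f' : E →L[ℝ] ℝ}
    (hf : HasFDerivAt f f' x) (hM : ∀ y ∈ M, f x ≤ f y) (hv : v ∈ posTangentConeAt M x) :
    0 ≤ f' v := by
  have : IsLocalMinOn f M x := eventually_of_mem self_mem_nhdsWithin hM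
  exact this.hasFDerivWithinAt_nonneg hf.hasFDerivWithinAt hv

end Tangents

/-! ### Coordinates on ℂⁿ⁺¹, the defining equations and their differentials. -/

section Coordinates

variable {n k : ℕ}

/-- The coordinates `(z₁, …, zₙ)` of `z = (z₀, z₁, …, zₙ)`. -/
def tail (z : EuclideanSpace ℂ (Fin (n + 1))) : Fin n → ℂ := fun j => z j.succ

/-- The vector `(a, u)` of `ℂⁿ⁺¹`. -/
def cvec (a : ℂ) (u : Fin n → ℂ) : EuclideanSpace ℂ (Fin (n + 1)) :=
  WithLp.toLp 2 (Fin.cons a u : Fin (n + 1) → ℂ)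

@[simp] theorem cvec_zero (a : ℂ) (u : Fin n → ℂ) : cvec a u 0 = a := rfl

@[simp] theorem tail_cvec (a : ℂ) (u : Fin n → ℂ) : tail (cvec a u) = u := rfl

@[simp] theorem tail_add (z w : EuclideanSpace ℂ (Fin (n + 1))) :
    tail (z + w) = tail z + tail w := rfl

@[simp] theorem tail_smul (c : ℂ) (z : EuclideanSpace ℂ (Fin (n + 1))) :
    tail (c • z) = c • tail z := rfl

@[simp] theorem tail_real_smul (c : ℝ) (z : EuclideanSpace ℂ (Fin (n + 1))) :
    tail (c • z) = (c : ℂ) • tail z := by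
  ext j; simp [tail]

@[simp] theorem tail_zero : tail (0 : EuclideanSpace ℂ (Fin (n + 1))) = 0 := rfl

theorem ext_tail {z w : EuclideanSpace ℂ (Fin (n + 1))} (h0 : z 0 = w 0) (h : tail z = tail w) :
    z = w := by
  ext i
  refine Fin.cases h0 (fun j => congrFun h j) i

theorem star_dotProduct_self_im (u : Fin n → ℂ) : (star u ⬝ᵥ u).im = 0 := by
  simp only [dotProduct, Pi.star_apply, RCLike.star_def, Complex.im_sum]
  exact Finset.sum_eq_zero fun j _ => by simp; ring

theorem star_dotProduct_self_eq (u : Fin n → ℂ) :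
    star u ⬝ᵥ u = ((star u ⬝ᵥ u).re : ℂ) :=
  Complex.ext (by simp) (by simp [star_dotProduct_self_im])

theorem star_dotProduct_self_re (u : Fin n → ℂ) :
    (star u ⬝ᵥ u).re = ∑ j, Complex.normSq (u j) := by
  simp only [dotProduct, Pi.star_apply, RCLike.star_def, Complex.re_sum]
  exact Finset.sum_congr rfl fun j _ => by simp [Complex.normSq_apply]

theorem star_dotProduct_self_nonneg (u : Fin n → ℂ) : 0 ≤ (star u ⬝ᵥ u).re := by
  rw [star_dotProduct_self_re]
  exact Finset.sum_nonneg fun j _ => Complex.normSq_nonneg _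

theorem eq_zero_of_star_dotProduct_self {u : Fin n → ℂ} (h : (star u ⬝ᵥ u).re = 0) : u = 0 := by
  rw [star_dotProduct_self_re,
    Finset.sum_eq_zero_iff_of_nonneg fun j _ => Complex.normSq_nonneg _] at h
  ext j
  simpa using h j

theorem star_dotProduct_comm (u v : Fin n → ℂ) : star u ⬝ᵥ v = star (star v ⬝ᵥ u) := by
  rw [Matrix.star_dotProduct]

theorem norm_sq_eq_tail (z : EuclideanSpace ℂ (Fin (n + 1))) :
    ‖z‖ ^ 2 = Complex.normSq (z 0) + (star (tail z) ⬝ᵥ tail z).re := by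
  rw [EuclideanSpace.norm_sq_eq, Fin.sum_univ_succ, star_dotProduct_self_re]
  simp [Complex.normSq_eq_norm_sq, tail]

theorem mem_brieskorn {z : EuclideanSpace ℂ (Fin (n + 1))} :
    z ∈ brieskorn n k ↔ z 0 ^ k + tail z ⬝ᵥ tail z = 0 ∧
      Complex.normSq (z 0) + (star (tail z) ⬝ᵥ tail z).re = 2 := by
  have h2 : ‖z‖ = √2 ↔ ‖z‖ ^ 2 = 2 := by
    rw [eq_comm, Real.sqrt_eq_iff_eq_sq (by norm_num) (norm_nonneg _), eq_comm]
  have h1 : ∑ j : Fin n, z j.succ ^ 2 = tail z ⬝ᵥ tail z :=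
    Finset.sum_congr rfl fun j _ => sq _
  rw [brieskorn, mem_inter_iff, mem_sphere_zero_iff_norm, h2, norm_sq_eq_tail]
  simp only [mem_ofPred_eq, h1]

theorem mem_binding {z : EuclideanSpace ℂ (Fin (n + 1))} :
    z ∈ binding n k ↔ z ∈ brieskorn n k ∧ z 0 = 0 := Iff.rfl

theorem mem_brieskorn_diff_binding {z : EuclideanSpace ℂ (Fin (n + 1))} :
    z ∈ brieskorn n k \ binding n k ↔ z ∈ brieskorn n k ∧ z 0 ≠ 0 := by
  rw [Set.mem_sdiff, mem_binding]; tauto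

/-- If (z₁, …, zₙ) vanished, the polynomial equation would give z₀ = 0, contradicting |z|² = 2. This
is where k ≠ 0 matters. -/
theorem brieskorn_tail_pos (hk : 1 ≤ k) {z : EuclideanSpace ℂ (Fin (n + 1))}
    (hz : z ∈ brieskorn n k) : 0 < (star (tail z) ⬝ᵥ tail z).re := by
  rw [mem_brieskorn] at hz
  refine lt_of_le_of_ne (star_dotProduct_self_nonneg _) fun h => ?_
  have h0 := eq_zero_of_star_dotProduct_self h.symm
  rw [h0] at hz
  have : z 0 = 0 := by simpa [show k ≠ 0 by omega] using hz.1
  simp [this] at hz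

/-- The pairing `∑ⱼ uⱼ wⱼ` of `(w₁, …, wₙ)` with a fixed vector. -/
def dotTail (u : Fin n → ℂ) : EuclideanSpace ℂ (Fin (n + 1)) →L[ℂ] ℂ :=
  ∑ j : Fin n, u j • (EuclideanSpace.proj j.succ : EuclideanSpace ℂ (Fin (n + 1)) →L[ℂ] ℂ)

@[simp] theorem dotTail_apply (u : Fin n → ℂ) (w : EuclideanSpace ℂ (Fin (n + 1))) :
    dotTail u w = u ⬝ᵥ tail w := by
  simp [dotTail, dotProduct, tail]

/-- The coordinate `z₀`. -/
def proj0 : EuclideanSpace ℂ (Fin (n + 1)) →L[ℂ] ℂ := EuclideanSpace.proj 0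

@[simp] theorem proj0_apply (w : EuclideanSpace ℂ (Fin (n + 1))) : proj0 w = w 0 := rfl

/-- The polynomial `z₀ᵏ + z₁² + ⋯ + zₙ²`. -/
def brieskornPoly (n k : ℕ) (z : EuclideanSpace ℂ (Fin (n + 1))) : ℂ :=
  z 0 ^ k + tail z ⬝ᵥ tail z

/-- The differential of `z₀ᵏ + z₁² + ⋯ + zₙ²`. -/
def brieskornPolyDeriv (n k : ℕ) (z : EuclideanSpace ℂ (Fin (n + 1))) :
    EuclideanSpace ℂ (Fin (n + 1)) →L[ℂ] ℂ :=
  ((k : ℂ) * z 0 ^ (k - 1)) • proj0 + (2 : ℂ) • dotTail (tail z)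

theorem brieskornPolyDeriv_apply (z w : EuclideanSpace ℂ (Fin (n + 1))) :
    brieskornPolyDeriv n k z w = k * z 0 ^ (k - 1) * w 0 + 2 * (tail z ⬝ᵥ tail w) := by
  simp [brieskornPolyDeriv]

theorem hasFDerivAt_brieskornPoly (z : EuclideanSpace ℂ (Fin (n + 1))) :
    HasFDerivAt (brieskornPoly n k) ((brieskornPolyDeriv n k z).restrictScalars ℝ) z := by
  have hp (i : Fin (n + 1)) : HasFDerivAt (fun z : EuclideanSpace ℂ (Fin (n + 1)) => z i)
      (EuclideanSpace.proj i : EuclideanSpace ℂ (Fin (n + 1)) →L[ℂ] ℂ) z :=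
    (EuclideanSpace.proj i : EuclideanSpace ℂ (Fin (n + 1)) →L[ℂ] ℂ).hasFDerivAt
  have h1 := HasFDerivAt.pow (hp 0) k
  have h2 := HasFDerivAt.fun_sum (u := Finset.univ) fun (j : Fin n) _ => (hp j.succ).fun_mul (hp j.succ)
  refine ((h1.fun_add h2).congr_fderiv ?_).restrictScalars ℝ
  ext w
  simp [brieskornPolyDeriv_apply, dotProduct, tail, Finset.mul_sum, two_mul]

theorem contDiff_apply (i : Fin (n + 1)) :
    ContDiff ℝ ∞ fun z : EuclideanSpace ℂ (Fin (n + 1)) => z i :=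
  ((EuclideanSpace.proj i : EuclideanSpace ℂ (Fin (n + 1)) →L[ℂ] ℂ).restrictScalars ℝ).contDiff

theorem contDiff_brieskornPoly : ContDiff ℝ ∞ (brieskornPoly n k) := by
  unfold brieskornPoly dotProduct tail
  have := contDiff_apply (n := n)
  fun_prop

/-- The function `|z|² - 2`. -/
def radial (n : ℕ) (z : EuclideanSpace ℂ (Fin (n + 1))) : ℝ :=
  Complex.normSq (z 0) + (star (tail z) ⬝ᵥ tail z).re - 2

/-- Half of the differential of `|z|²`. -/
def radialDeriv (n : ℕ) (z : EuclideanSpace ℂ (Fin (n + 1))) :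
    EuclideanSpace ℂ (Fin (n + 1)) →L[ℝ] ℝ :=
  Complex.reCLM.comp ((star (z 0) • proj0 + dotTail (star (tail z))).restrictScalars ℝ)

theorem radialDeriv_apply (z w : EuclideanSpace ℂ (Fin (n + 1))) :
    radialDeriv n z w = (star (z 0) * w 0).re + (star (tail z) ⬝ᵥ tail w).re := by
  simp [radialDeriv]

theorem hasFDerivAt_radial (z : EuclideanSpace ℂ (Fin (n + 1))) :
    HasFDerivAt (radial n) ((2 : ℝ) • radialDeriv n z) z := by
  have hp (i : Fin (n + 1)) : HasFDerivAt (fun z : EuclideanSpace ℂ (Fin (n + 1)) => z i)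
      ((EuclideanSpace.proj i : EuclideanSpace ℂ (Fin (n + 1)) →L[ℂ] ℂ).restrictScalars ℝ) z :=
    ((EuclideanSpace.proj i : EuclideanSpace ℂ (Fin (n + 1)) →L[ℂ] ℂ).restrictScalars ℝ).hasFDerivAt
  have hn (i : Fin (n + 1)) := (HasFDerivAt.pow (Complex.reCLM.hasFDerivAt.comp z (hp i)) 2).fun_add
    (HasFDerivAt.pow (Complex.imCLM.hasFDerivAt.comp z (hp i)) 2)
  have h2 := ((hn 0).fun_add (HasFDerivAt.fun_sum (u := Finset.univ)
    fun (j : Fin n) _ => hn j.succ)).sub_const 2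
  have he : radial n = fun z : EuclideanSpace ℂ (Fin (n + 1)) =>
      ((z 0).re ^ 2 + (z 0).im ^ 2) + ∑ j : Fin n, ((z j.succ).re ^ 2 + (z j.succ).im ^ 2) - 2 := by
    ext z
    simp [radial, star_dotProduct_self_re, Complex.normSq_apply, sq, tail]
  rw [he]
  refine h2.congr_fderiv ?_
  ext w
  simp [radialDeriv_apply, dotProduct, tail, Finset.mul_sum, mul_add, Complex.re_sum, mul_assoc]

theorem contDiff_radial : ContDiff ℝ ∞ (radial n) := by
  have he : radial n = fun z : EuclideanSpace ℂ (Fin (n + 1)) =>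
      ((z 0).re ^ 2 + (z 0).im ^ 2) + ∑ j : Fin n, ((z j.succ).re ^ 2 + (z j.succ).im ^ 2) - 2 := by
    ext z
    simp [radial, star_dotProduct_self_re, Complex.normSq_apply, sq, tail]
  have := contDiff_apply (n := n)
  have h1 : ContDiff ℝ ∞ Complex.re := Complex.reCLM.contDiff
  have h2 : ContDiff ℝ ∞ Complex.im := Complex.imCLM.contDiff
  have h3 (i : Fin (n + 1)) := h1.comp (this i)
  have h4 (i : Fin (n + 1)) := h2.comp (this i)
  simp only [Function.comp_def] at h3 h4
  rw [he]
  fun_prop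

end Coordinates

/-! ### Regularity of the equations of W, B and the pages, and their tangent spaces. -/

section BrieskornTangents

variable {n k : ℕ}

theorem rotationForm_apply (j : Fin (n + 1)) (z w : EuclideanSpace ℂ (Fin (n + 1))) :
    rotationForm n j z w = (star (z j) * w j).im := by
  simp [rotationForm]
  ring

theorem brieskornForm_apply (z w : EuclideanSpace ℂ (Fin (n + 1))) :
    brieskornForm n k z w = k * (star (z 0) * w 0).im + 2 * (star (tail z) ⬝ᵥ tail w).im := by
  simp [brieskornForm, rotationForm_apply, dotProduct, tail]

/-- The constant `2`-form `dα_k`. -/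
def brieskornTwoForm (n k : ℕ) (v w : EuclideanSpace ℂ (Fin (n + 1))) : ℝ :=
  2 * k * (star (v 0) * w 0).im + 4 * (star (tail v) ⬝ᵥ tail w).im

/-- The coefficients of α_k are real linear in z, so its derivative, and with it dα_k, is constant.
-/
theorem exists_brieskornForm_eq_linear :
    ∃ A : EuclideanSpace ℂ (Fin (n + 1)) →L[ℝ] EuclideanSpace ℂ (Fin (n + 1)) →L[ℝ] ℝ,
      (∀ y, A y = brieskornForm n k y) := by
  have hs (c d : ℝ) (x y : EuclideanSpace ℂ (Fin (n + 1))) :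
      brieskornForm n k (c • x + d • y) = c • brieskornForm n k x + d • brieskornForm n k y := by
    ext w
    simp only [brieskornForm_apply, add_apply, smul_apply,
      tail_add, tail_real_smul, star_add, star_smul, add_dotProduct, smul_dotProduct]
    simp
    ring
  let L : EuclideanSpace ℂ (Fin (n + 1)) →ₗ[ℝ] EuclideanSpace ℂ (Fin (n + 1)) →L[ℝ] ℝ :=
    { toFun := brieskornForm n k
      map_add' := fun x y => by simpa using hs 1 1 x y
      map_smul' := fun c x => by simpa using hs c 0 x 0 }
  exact ⟨L.toContinuousLinearMap, fun y => rfl⟩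

theorem contDiff_brieskornForm : ContDiff ℝ ∞ (brieskornForm n k) := by
  obtain ⟨A, hA⟩ := exists_brieskornForm_eq_linear (n := n) (k := k)
  rw [← funext hA]
  exact A.contDiff

theorem extDer_brieskornForm (z v w : EuclideanSpace ℂ (Fin (n + 1))) :
    extDer (brieskornForm n k) z v w = brieskornTwoForm n k v w := by
  rw [extDer_eq _ _ _ _ (contDiff_brieskornForm.differentiable (by simp) z)]
  obtain ⟨A, hA⟩ := exists_brieskornForm_eq_linear (n := n) (k := k)
  have : fderiv ℝ (brieskornForm n k) z = A := by
    rw [← funext hA]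
    exact A.hasFDerivAt.fderiv
  rw [this, hA, hA, brieskornForm_apply, brieskornForm_apply, brieskornTwoForm,
    star_dotProduct_comm (tail w) (tail v)]
  simp
  ring

theorem finrank_complexSpace : Module.finrank ℝ (EuclideanSpace ℂ (Fin (n + 1))) = 2 * n + 2 := by
  rw [← Module.finrank_mul_finrank ℝ ℂ (EuclideanSpace ℂ (Fin (n + 1))), Complex.finrank_real_complex]
  simp
  ring

/-- The defining function of the Brieskorn manifold. -/
def brieskornEq (n k : ℕ) (z : EuclideanSpace ℂ (Fin (n + 1))) : ℂ × ℝ :=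
  (brieskornPoly n k z, radial n z)

/-- The differential of the defining function of the Brieskorn manifold. -/
def brieskornEqDeriv (n k : ℕ) (z : EuclideanSpace ℂ (Fin (n + 1))) :
    EuclideanSpace ℂ (Fin (n + 1)) →L[ℝ] ℂ × ℝ :=
  ((brieskornPolyDeriv n k z).restrictScalars ℝ).prod ((2 : ℝ) • radialDeriv n z)

theorem brieskornEqDeriv_fst (z w : EuclideanSpace ℂ (Fin (n + 1))) :
    (brieskornEqDeriv n k z w).1 = brieskornPolyDeriv n k z w := rfl

theorem brieskornEqDeriv_snd (z w : EuclideanSpace ℂ (Fin (n + 1))) :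
    (brieskornEqDeriv n k z w).2 = 2 * radialDeriv n z w := rfl

theorem contDiff_brieskornEq : ContDiff ℝ ∞ (brieskornEq n k) :=
  contDiff_brieskornPoly.prodMk contDiff_radial

theorem hasFDerivAt_brieskornEq (z : EuclideanSpace ℂ (Fin (n + 1))) :
    HasFDerivAt (brieskornEq n k) (brieskornEqDeriv n k z) z :=
  (hasFDerivAt_brieskornPoly z).prodMk (hasFDerivAt_radial z)

theorem brieskornEq_eq_zero {z : EuclideanSpace ℂ (Fin (n + 1))} :
    brieskornEq n k z = 0 ↔ z ∈ brieskorn n k := by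
  rw [mem_brieskorn, brieskornEq, Prod.mk_eq_zero, brieskornPoly, radial, sub_eq_zero]

/-- The vector field generating the weighted scaling; it is tangent to the levels of
`z₀ᵏ + z₁² + ⋯ + zₙ²` along its zero level. -/
def eulerField (n k : ℕ) (z : EuclideanSpace ℂ (Fin (n + 1))) : EuclideanSpace ℂ (Fin (n + 1)) :=
  cvec (2 / k * z 0) (tail z)

/-- Euler's identity: with weights 2/k and 1 the polynomial is homogeneous of degree 2, so its
derivative along the field is twice its value. -/
theorem polyDeriv_eulerField (hk : 1 ≤ k) {z : EuclideanSpace ℂ (Fin (n + 1))}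
    (hz : z ∈ brieskorn n k) : brieskornPolyDeriv n k z (eulerField n k z) = 0 := by
  have hk' : (k : ℂ) ≠ 0 := by exact_mod_cast (by omega : k ≠ 0)
  have h := (mem_brieskorn.1 hz).1
  obtain ⟨m, rfl⟩ : ∃ m, k = m + 1 := ⟨k - 1, by omega⟩
  rw [brieskornPolyDeriv_apply]
  simp only [eulerField, cvec_zero, tail_cvec, Nat.add_sub_cancel]
  field_simp
  linear_combination 2 * h

theorem radialDeriv_eulerField (z : EuclideanSpace ℂ (Fin (n + 1))) :
    radialDeriv n z (eulerField n k z) =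
      2 / k * Complex.normSq (z 0) + (star (tail z) ⬝ᵥ tail z).re := by
  rw [radialDeriv_apply]
  simp only [eulerField, cvec_zero, tail_cvec]
  congr 1
  have : (2 / (k : ℂ)) = ((2 / k : ℝ) : ℂ) := by push_cast; rfl
  rw [this]
  simp [Complex.normSq_apply]
  ring

theorem radialDeriv_eulerField_pos (hk : 1 ≤ k) {z : EuclideanSpace ℂ (Fin (n + 1))}
    (hz : z ∈ brieskorn n k) : 0 < radialDeriv n z (eulerField n k z) := by
  rw [radialDeriv_eulerField]
  have := brieskorn_tail_pos hk hz
  have := Complex.normSq_nonneg (z 0)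
  positivity

theorem two_div_eq_ofReal : (2 / (k : ℂ)) = ((2 / k : ℝ) : ℂ) := by push_cast; rfl

theorem im_mul_reeb_zero (s : ℂ) (z : EuclideanSpace ℂ (Fin (n + 1))) :
    (star s * (Complex.I • eulerField n k z) 0).im = 2 / k * (star s * z 0).re := by
  rw [PiLp.smul_apply, eulerField, cvec_zero, two_div_eq_ofReal]
  simp
  ring

theorem radialDeriv_reeb (z : EuclideanSpace ℂ (Fin (n + 1))) :
    radialDeriv n z (Complex.I • eulerField n k z) = 0 := by
  rw [radialDeriv_apply, PiLp.smul_apply, tail_smul, eulerField, cvec_zero, tail_cvec,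
    two_div_eq_ofReal, dotProduct_smul, star_dotProduct_self_eq]
  simp
  ring

/-- The vector `i X`, with `X` the Euler field, spans the kernel of `dα_k` on the sphere. -/
theorem brieskornTwoForm_reeb (hk : 1 ≤ k) (z w : EuclideanSpace ℂ (Fin (n + 1))) :
    brieskornTwoForm n k (Complex.I • eulerField n k z) w = -4 * radialDeriv n z w := by
  have hk' : (k : ℝ) ≠ 0 := by exact_mod_cast (by omega : k ≠ 0)
  rw [radialDeriv_apply, brieskornTwoForm, PiLp.smul_apply, tail_smul, eulerField, cvec_zero,
    tail_cvec, two_div_eq_ofReal, star_smul (Complex.I) (tail z), smul_dotProduct]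
  simp
  field_simp
  ring

/-- The value is 2|z|², and |z|² = 2 on W. So iX/4 is the Reeb field. -/
theorem brieskornForm_reeb (hk : 1 ≤ k) {z : EuclideanSpace ℂ (Fin (n + 1))}
    (hz : z ∈ brieskorn n k) :
    brieskornForm n k z (Complex.I • eulerField n k z) = 4 := by
  have hk' : (k : ℝ) ≠ 0 := by exact_mod_cast (by omega : k ≠ 0)
  have h := (mem_brieskorn.1 hz).2
  rw [brieskornForm_apply, PiLp.smul_apply, tail_smul, eulerField, cvec_zero,
    tail_cvec, two_div_eq_ofReal, dotProduct_smul, star_dotProduct_self_eq]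
  rw [Complex.normSq_apply] at h
  simp
  field_simp
  linear_combination 2 * h

/-- A complex multiple of `(0, z̄₁, …, z̄ₙ)` on which the differential of
`z₀ᵏ + z₁² + ⋯ + zₙ²` takes the value `a`. -/
def conjField (a : ℂ) (z : EuclideanSpace ℂ (Fin (n + 1))) : EuclideanSpace ℂ (Fin (n + 1)) :=
  cvec 0 ((a / (2 * (star (tail z) ⬝ᵥ tail z))) • star (tail z))

theorem star_dotProduct_self_ne_zero (hk : 1 ≤ k) {z : EuclideanSpace ℂ (Fin (n + 1))}
    (hz : z ∈ brieskorn n k) : star (tail z) ⬝ᵥ tail z ≠ 0 := fun h => by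
  have := brieskorn_tail_pos hk hz
  rw [h] at this
  simp at this

theorem polyDeriv_conjField (hk : 1 ≤ k) {z : EuclideanSpace ℂ (Fin (n + 1))}
    (hz : z ∈ brieskorn n k) (a : ℂ) : brieskornPolyDeriv n k z (conjField a z) = a := by
  have := star_dotProduct_self_ne_zero hk hz
  rw [brieskornPolyDeriv_apply]
  simp only [conjField, cvec_zero, tail_cvec, dotProduct_smul, smul_eq_mul,
    dotProduct_comm (tail z) (star (tail z))]
  field_simp
  ring

/-- The conjugate field reaches every value of the complex equation. The Euler field then corrects
the radial one without disturbing the complex one. -/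
theorem brieskornEqDeriv_surjective (hk : 1 ≤ k) {z : EuclideanSpace ℂ (Fin (n + 1))}
    (hz : z ∈ brieskorn n k) : Function.Surjective (brieskornEqDeriv n k z) := by
  rintro ⟨a, b⟩
  have hX := (radialDeriv_eulerField_pos hk hz).ne'
  refine ⟨conjField a z + ((b / 2 - radialDeriv n z (conjField a z)) /
    radialDeriv n z (eulerField n k z)) • eulerField n k z, ?_⟩
  refine Prod.ext ?_ ?_
  · simp [brieskornEqDeriv, polyDeriv_conjField hk hz, polyDeriv_eulerField hk hz]
  · rw [brieskornEqDeriv_snd, map_add, map_smul, smul_eq_mul]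
    field_simp
    ring

/-- The defining function of the binding. -/
def bindingEq (n k : ℕ) (z : EuclideanSpace ℂ (Fin (n + 1))) : (ℂ × ℝ) × ℂ :=
  (brieskornEq n k z, z 0)

/-- The differential of the defining function of the binding. -/
def bindingEqDeriv (n k : ℕ) (z : EuclideanSpace ℂ (Fin (n + 1))) :
    EuclideanSpace ℂ (Fin (n + 1)) →L[ℝ] (ℂ × ℝ) × ℂ :=
  (brieskornEqDeriv n k z).prod (proj0.restrictScalars ℝ)

theorem bindingEqDeriv_fst (z w : EuclideanSpace ℂ (Fin (n + 1))) :
    (bindingEqDeriv n k z w).1 = brieskornEqDeriv n k z w := rfl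

theorem contDiff_bindingEq : ContDiff ℝ ∞ (bindingEq n k) :=
  contDiff_brieskornEq.prodMk (contDiff_apply 0)

theorem hasFDerivAt_bindingEq (z : EuclideanSpace ℂ (Fin (n + 1))) :
    HasFDerivAt (bindingEq n k) (bindingEqDeriv n k z) z :=
  (hasFDerivAt_brieskornEq z).prodMk (proj0.restrictScalars ℝ).hasFDerivAt

theorem bindingEq_eq_zero {z : EuclideanSpace ℂ (Fin (n + 1))} :
    bindingEq n k z = 0 ↔ z ∈ binding n k := by
  rw [bindingEq, Prod.mk_eq_zero, brieskornEq_eq_zero, mem_binding]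

theorem bindingEqDeriv_surjective (hk : 1 ≤ k) {z : EuclideanSpace ℂ (Fin (n + 1))}
    (hz : z ∈ binding n k) : Function.Surjective (bindingEqDeriv n k z) := by
  rintro ⟨⟨a, b⟩, e⟩
  have hz0 : z 0 = 0 := hz.2
  have hX := (radialDeriv_eulerField_pos hk hz.1).ne'
  -- The z₀-component is prescribed first; the conjugate field, which has none, then adjusts the
  -- polynomial. The Euler field used below for the radial equation has no z₀-component along B.
  obtain ⟨w, hw0, hw⟩ : ∃ w, w 0 = e ∧ brieskornPolyDeriv n k z w = a := by
    refine ⟨cvec e 0 + conjField (a - brieskornPolyDeriv n k z (cvec e 0)) z,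
      by simp [conjField], ?_⟩
    rw [map_add, polyDeriv_conjField hk hz.1]
    ring
  refine ⟨w + ((b / 2 - radialDeriv n z w) /
    radialDeriv n z (eulerField n k z)) • eulerField n k z, ?_⟩
  refine Prod.ext (Prod.ext ?_ ?_) ?_
  · simp [bindingEqDeriv, brieskornEqDeriv, polyDeriv_eulerField hk hz.1, hw]
  · rw [bindingEqDeriv_fst, brieskornEqDeriv_snd, map_add, map_smul, smul_eq_mul]
    field_simp
    ring
  · simp [bindingEqDeriv, eulerField, hz0, hw0]

/-- The defining function of the page over `s`. -/
def pageEq (n k : ℕ) (s : ℂ) (z : EuclideanSpace ℂ (Fin (n + 1))) : (ℂ × ℝ) × ℝ :=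
  (brieskornEq n k z, (star s * z 0).im)

/-- The differential of the defining function of the page over `s`. -/
def pageEqDeriv (n k : ℕ) (s : ℂ) (z : EuclideanSpace ℂ (Fin (n + 1))) :
    EuclideanSpace ℂ (Fin (n + 1)) →L[ℝ] (ℂ × ℝ) × ℝ :=
  (brieskornEqDeriv n k z).prod (Complex.imCLM.comp ((star s • proj0).restrictScalars ℝ))

theorem pageEqDeriv_fst (s : ℂ) (z w : EuclideanSpace ℂ (Fin (n + 1))) :
    (pageEqDeriv n k s z w).1 = brieskornEqDeriv n k z w := rfl

theorem pageEqDeriv_snd (s : ℂ) (z w : EuclideanSpace ℂ (Fin (n + 1))) :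
    (pageEqDeriv n k s z w).2 = (star s * w 0).im := rfl

theorem contDiff_pageEq (s : ℂ) : ContDiff ℝ ∞ (pageEq n k s) :=
  contDiff_brieskornEq.prodMk
    (Complex.imCLM.comp ((star s • proj0 (n := n)).restrictScalars ℝ)).contDiff

theorem hasFDerivAt_pageEq (s : ℂ) (z : EuclideanSpace ℂ (Fin (n + 1))) :
    HasFDerivAt (pageEq n k s) (pageEqDeriv n k s z) z :=
  (hasFDerivAt_brieskornEq z).prodMk
    (Complex.imCLM.comp ((star s • proj0 (n := n)).restrictScalars ℝ)).hasFDerivAt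

theorem fibration_eq_iff {s : ℂ} {z : EuclideanSpace ℂ (Fin (n + 1))} (hz : z 0 ≠ 0) :
    fibration n z = s ↔ z 0 = ‖z 0‖ * s := by
  have : (‖z 0‖ : ℂ) ≠ 0 := by simpa using hz
  rw [fibration, div_eq_iff this, mul_comm]

theorem star_mul_self_of_mem_sphere {s : ℂ} (hs : s ∈ Metric.sphere (0 : ℂ) 1) :
    star s * s = 1 := by
  rw [Complex.star_def, ← Complex.normSq_eq_conj_mul_self, Complex.normSq_eq_norm_sq]
  simp at hs
  simp [hs]

theorem mem_page {s : ℂ} (hs : s ∈ Metric.sphere (0 : ℂ) 1)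
    {z : EuclideanSpace ℂ (Fin (n + 1))} :
    z ∈ page (brieskorn n k) (binding n k) (fibration n) s ↔
      z ∈ brieskorn n k ∧ 0 < (star s * z 0).re ∧ (star s * z 0).im = 0 := by
  have hss := star_mul_self_of_mem_sphere hs
  rw [page, mem_ofPred_eq, mem_brieskorn_diff_binding]
  constructor
  · rintro ⟨⟨h1, h2⟩, h3⟩
    rw [fibration_eq_iff h2] at h3
    have : star s * z 0 = ‖z 0‖ := by
      linear_combination (star s) * h3 + (‖z 0‖ : ℂ) * hss
    rw [this]
    simpa using ⟨h1, h2⟩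
  · rintro ⟨h1, h2, h3⟩
    have h0 : z 0 ≠ 0 := by rintro h; simp [h] at h2
    refine ⟨⟨h1, h0⟩, ?_⟩
    rw [fibration_eq_iff h0]
    have h4 : star s * z 0 = ((star s * z 0).re : ℂ) := Complex.ext (by simp) (by simpa using h3)
    have h5 : ‖z 0‖ = (star s * z 0).re := by
      have := congrArg norm h4
      simp only [norm_mul, norm_star, mem_sphere_zero_iff_norm.1 hs, one_mul] at this
      rw [this, Complex.norm_real, Real.norm_of_nonneg h2.le]
    rw [h5, ← h4]
    linear_combination -z 0 * hss

/-- The third equation is handled by iX: it is tangent to W, and the imaginary part of s̄z₀ grows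
along it at the rate (2/k) Re(s̄z₀), which is positive on the page. -/
theorem pageEqDeriv_surjective (hk : 1 ≤ k) {s : ℂ} (hs : s ∈ Metric.sphere (0 : ℂ) 1)
    {z : EuclideanSpace ℂ (Fin (n + 1))}
    (hz : z ∈ page (brieskorn n k) (binding n k) (fibration n) s) :
    Function.Surjective (pageEqDeriv n k s z) := by
  rw [mem_page hs] at hz
  obtain ⟨hz, h1, h2⟩ := hz
  rintro ⟨a, b⟩
  obtain ⟨w, hw⟩ := brieskornEqDeriv_surjective hk hz a
  have hk' : (0 : ℝ) < k := by exact_mod_cast hk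
  refine ⟨w + ((b - (star s * w 0).im) / (2 / k * (star s * z 0).re)) •
    (Complex.I • eulerField n k z), ?_⟩
  have hR : brieskornEqDeriv n k z (Complex.I • eulerField n k z) = 0 := by
    refine Prod.ext ?_ ?_
    · simp [brieskornEqDeriv, polyDeriv_eulerField hk hz]
    · rw [brieskornEqDeriv_snd, radialDeriv_reeb]
      simp
  refine Prod.ext ?_ ?_
  · rw [pageEqDeriv_fst, map_add, map_smul, hw, hR, smul_zero, add_zero]
  · rw [pageEqDeriv_snd, PiLp.add_apply, PiLp.smul_apply, mul_add, Complex.add_im, mul_smul_comm,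
      Complex.smul_im, im_mul_reeb_zero, smul_eq_mul]
    field_simp
    ring

theorem isSmoothSubmanifold_brieskorn {d : ℕ} (hd : 2 * n = d + 1) (hk : 1 ≤ k) :
    IsSmoothSubmanifold d (brieskorn n k) :=
  isSmoothSubmanifold_of_regular (by
    rw [finrank_complexSpace]; simp [Complex.finrank_real_complex]; omega)
    (brieskornEq n k) contDiff_brieskornEq
    (fun z hz => by
      rw [(hasFDerivAt_brieskornEq z).fderiv]; exact brieskornEqDeriv_surjective hk hz)
    fun z _ => ⟨univ, isOpen_univ, mem_univ z, by
      ext y; simp [brieskornEq_eq_zero]⟩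

theorem isSmoothSubmanifold_binding {d : ℕ} (hd : 2 * n = d + 3) (hk : 1 ≤ k) :
    IsSmoothSubmanifold d (binding n k) :=
  isSmoothSubmanifold_of_regular (by
    rw [finrank_complexSpace]; simp [Complex.finrank_real_complex]; omega)
    (bindingEq n k) contDiff_bindingEq
    (fun z hz => by
      rw [(hasFDerivAt_bindingEq z).fderiv]; exact bindingEqDeriv_surjective hk hz)
    fun z _ => ⟨univ, isOpen_univ, mem_univ z, by
      ext y; simp [bindingEq_eq_zero]⟩

theorem isOpen_re_pos (s : ℂ) :
    IsOpen {z : EuclideanSpace ℂ (Fin (n + 1)) | 0 < (star s * z 0).re} :=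
  isOpen_lt continuous_const (Complex.continuous_re.comp
    (continuous_const.mul (contDiff_apply 0).continuous))

/-- The page equations also hold on B and on the opposite page; the open half-space singles out the
page over s. -/
theorem page_inter {s : ℂ} (hs : s ∈ Metric.sphere (0 : ℂ) 1) :
    page (brieskorn n k) (binding n k) (fibration n) s ∩ {z | 0 < (star s * z 0).re} =
      {z ∈ {z : EuclideanSpace ℂ (Fin (n + 1)) | 0 < (star s * z 0).re} | pageEq n k s z = 0} := by
  ext z
  simp only [mem_inter_iff, mem_page hs, mem_ofPred_eq, pageEq, Prod.mk_eq_zero,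
    brieskornEq_eq_zero]
  tauto

theorem isSmoothSubmanifold_page {d : ℕ} (hd : 2 * n = d + 2) (hk : 1 ≤ k) {s : ℂ}
    (hs : s ∈ Metric.sphere (0 : ℂ) 1) :
    IsSmoothSubmanifold d (page (brieskorn n k) (binding n k) (fibration n) s) :=
  isSmoothSubmanifold_of_regular (by
    rw [finrank_complexSpace]; simp [Complex.finrank_real_complex]; omega)
    (pageEq n k s) (contDiff_pageEq s)
    (fun z hz => by
      rw [(hasFDerivAt_pageEq s z).fderiv]; exact pageEqDeriv_surjective hk hs hz)
    fun _ hz => ⟨_, isOpen_re_pos s, ((mem_page hs).1 hz).2.1, page_inter hs⟩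

theorem hasStrictFDerivAt_of_contDiff {E F : Type*} [NormedAddCommGroup E] [NormedSpace ℝ E]
    [NormedAddCommGroup F] [NormedSpace ℝ F] {f : E → F} {f' : E →L[ℝ] F} {x : E}
    (hf : ContDiff ℝ ∞ f) (h : HasFDerivAt f f' x) : HasStrictFDerivAt f f' x :=
  hf.contDiffAt.hasStrictFDerivAt' h (by simp)

theorem mem_tangentAt_brieskorn (hk : 1 ≤ k) {z v : EuclideanSpace ℂ (Fin (n + 1))}
    (hz : z ∈ brieskorn n k) : v ∈ tangentAt (brieskorn n k) z ↔
      brieskornPolyDeriv n k z v = 0 ∧ radialDeriv n z v = 0 := by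
  rw [tangentAt_eq_ker (hasStrictFDerivAt_of_contDiff contDiff_brieskornEq
    (hasFDerivAt_brieskornEq z)) (brieskornEqDeriv_surjective hk hz) (brieskornEq_eq_zero.2 hz)
    (Eventually.of_forall fun y => brieskornEq_eq_zero.symm), LinearMap.mem_ker]
  change brieskornEqDeriv n k z v = 0 ↔ _
  rw [Prod.ext_iff, brieskornEqDeriv_fst, brieskornEqDeriv_snd]
  simp

theorem mem_tangentAt_binding (hk : 1 ≤ k) {z v : EuclideanSpace ℂ (Fin (n + 1))}
    (hz : z ∈ binding n k) : v ∈ tangentAt (binding n k) z ↔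
      brieskornPolyDeriv n k z v = 0 ∧ radialDeriv n z v = 0 ∧ v 0 = 0 := by
  rw [tangentAt_eq_ker (hasStrictFDerivAt_of_contDiff contDiff_bindingEq
    (hasFDerivAt_bindingEq z)) (bindingEqDeriv_surjective hk hz) (bindingEq_eq_zero.2 hz)
    (Eventually.of_forall fun y => bindingEq_eq_zero.symm), LinearMap.mem_ker]
  change bindingEqDeriv n k z v = 0 ↔ _
  rw [Prod.ext_iff, bindingEqDeriv_fst, Prod.ext_iff, brieskornEqDeriv_fst, brieskornEqDeriv_snd]
  simp [bindingEqDeriv, and_assoc]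

theorem mem_tangentAt_page (hk : 1 ≤ k) {s : ℂ} (hs : s ∈ Metric.sphere (0 : ℂ) 1)
    {z v : EuclideanSpace ℂ (Fin (n + 1))}
    (hz : z ∈ page (brieskorn n k) (binding n k) (fibration n) s) :
    v ∈ tangentAt (page (brieskorn n k) (binding n k) (fibration n) s) z ↔
      brieskornPolyDeriv n k z v = 0 ∧ radialDeriv n z v = 0 ∧ (star s * v 0).im = 0 := by
  have hU := isOpen_re_pos (n := n) s
  have hzU := ((mem_page hs).1 hz).2.1
  have hev := eventually_mem_iff hU hzU (page_inter (k := k) hs)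
  rw [tangentAt_eq_ker (hasStrictFDerivAt_of_contDiff (contDiff_pageEq s)
    (hasFDerivAt_pageEq s z)) (pageEqDeriv_surjective hk hs hz) (hev.self_of_nhds.1 hz) hev,
    LinearMap.mem_ker]
  change pageEqDeriv n k s z v = 0 ↔ _
  rw [Prod.ext_iff, pageEqDeriv_fst, Prod.ext_iff, brieskornEqDeriv_fst, brieskornEqDeriv_snd,
    pageEqDeriv_snd]
  simp [and_assoc]

theorem finrank_tangentAt_binding (hk : 1 ≤ k) {z : EuclideanSpace ℂ (Fin (n + 1))}
    (hz : z ∈ binding n k) : Module.finrank ℝ (tangentAt (binding n k) z) + 3 = 2 * n := by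
  have := finrank_tangentAt (hasStrictFDerivAt_of_contDiff contDiff_bindingEq
    (hasFDerivAt_bindingEq z)) (bindingEqDeriv_surjective hk hz) (bindingEq_eq_zero.2 hz)
    (Eventually.of_forall fun y => bindingEq_eq_zero.symm)
  rw [finrank_complexSpace] at this
  simp [Complex.finrank_real_complex] at this
  omega

theorem finrank_tangentAt_page (hk : 1 ≤ k) {s : ℂ} (hs : s ∈ Metric.sphere (0 : ℂ) 1)
    {z : EuclideanSpace ℂ (Fin (n + 1))}
    (hz : z ∈ page (brieskorn n k) (binding n k) (fibration n) s) :
    Module.finrank ℝ (tangentAt (page (brieskorn n k) (binding n k) (fibration n) s) z) + 2 =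
      2 * n := by
  have hev := eventually_mem_iff (isOpen_re_pos (n := n) s) ((mem_page hs).1 hz).2.1
    (page_inter (k := k) hs)
  have := finrank_tangentAt (hasStrictFDerivAt_of_contDiff (contDiff_pageEq s)
    (hasFDerivAt_pageEq s z)) (pageEqDeriv_surjective hk hs hz) (hev.self_of_nhds.1 hz) hev
  rw [finrank_complexSpace] at this
  simp [Complex.finrank_real_complex] at this
  omega

end BrieskornTangents

/-! ### Contact forms on W and B, symplectic forms on the pages. -/

section Contact

variable {n k : ℕ}

theorem brieskornTwoForm_add_right (u v w : EuclideanSpace ℂ (Fin (n + 1))) :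
    brieskornTwoForm n k u (v + w) = brieskornTwoForm n k u v + brieskornTwoForm n k u w := by
  simp only [brieskornTwoForm, PiLp.add_apply, tail_add, dotProduct_add, mul_add, Complex.add_im]
  ring

theorem brieskornTwoForm_smul_right (c : ℝ) (u v : EuclideanSpace ℂ (Fin (n + 1))) :
    brieskornTwoForm n k u (c • v) = c * brieskornTwoForm n k u v := by
  simp only [brieskornTwoForm, PiLp.smul_apply, tail_real_smul, dotProduct_smul, mul_smul_comm,
    Complex.smul_im, smul_eq_mul, Complex.im_ofReal_mul]
  ring

theorem brieskornTwoForm_swap (u v : EuclideanSpace ℂ (Fin (n + 1))) :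
    brieskornTwoForm n k u v = -brieskornTwoForm n k v u := by
  rw [brieskornTwoForm, brieskornTwoForm, star_dotProduct_comm (tail v)]
  simp
  ring

theorem brieskornTwoForm_sub_smul_left (c : ℝ) (u v w : EuclideanSpace ℂ (Fin (n + 1))) :
    brieskornTwoForm n k (u - c • v) w =
      brieskornTwoForm n k u w - c * brieskornTwoForm n k v w := by
  rw [brieskornTwoForm_swap, sub_eq_add_neg, ← neg_smul, brieskornTwoForm_add_right,
    brieskornTwoForm_smul_right, brieskornTwoForm_swap u, brieskornTwoForm_swap v]
  ring

/-- dα_k is a positive combination of the standard Kähler forms of the coordinate lines, so dα_k(v,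
iv) is a positive definite quadratic form. -/
theorem eq_zero_of_brieskornTwoForm_I (hk : 1 ≤ k) {v : EuclideanSpace ℂ (Fin (n + 1))}
    (h : brieskornTwoForm n k v (Complex.I • v) = 0) : v = 0 := by
  have hk' : (0 : ℝ) < k := by exact_mod_cast hk
  have h1 := star_dotProduct_self_nonneg (tail v)
  have h2 := Complex.normSq_nonneg (v 0)
  have : brieskornTwoForm n k v (Complex.I • v) =
      2 * k * Complex.normSq (v 0) + 4 * (star (tail v) ⬝ᵥ tail v).re := by
    rw [brieskornTwoForm, PiLp.smul_apply, tail_smul, dotProduct_smul, star_dotProduct_self_eq,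
      Complex.normSq_apply]
    simp
  rw [this] at h
  have h3 : 0 ≤ 2 * k * Complex.normSq (v 0) := by positivity
  have h4 : Complex.normSq (v 0) = 0 := by
    have : 2 * k * Complex.normSq (v 0) = 0 := by linarith
    simpa [hk'.ne'] using this
  refine ext_tail (by simpa using h4) ?_
  rw [tail_zero]
  apply eq_zero_of_star_dotProduct_self
  nlinarith

/-- On the intersection of a complex subspace with the tangent space of the sphere, the kernel of
`dα_k` is spanned by `i X`, where `X` is the Euler field. -/
theorem eq_smul_reeb_of_null (hk : 1 ≤ k) {z v : EuclideanSpace ℂ (Fin (n + 1))}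
    (hz : z ∈ brieskorn n k) (S : Submodule ℂ (EuclideanSpace ℂ (Fin (n + 1))))
    (hX : eulerField n k z ∈ S) (hv : v ∈ S)
    (hnull : ∀ w ∈ S, radialDeriv n z w = 0 → brieskornTwoForm n k v w = 0) :
    ∃ c : ℝ, v = c • (Complex.I • eulerField n k z) := by
  set X := eulerField n k z with hXdef
  have hpos := radialDeriv_eulerField_pos hk hz
  rw [← hXdef] at hpos
  -- Chosen so that v - c iX annihilates X as well. As X and the vectors tangent to the sphere span
  -- S, it annihilates all of S, in particular its own multiple by i.
  set c : ℝ := brieskornTwoForm n k v X / (-4 * radialDeriv n z X) with hc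
  have hreal : ∀ (a : ℝ) (u : EuclideanSpace ℂ (Fin (n + 1))), u ∈ S → a • u ∈ S := by
    intro a u hu
    have : a • u = (a : ℂ) • u := by ext i; simp
    rw [this]
    exact S.smul_mem _ hu
  refine ⟨c, sub_eq_zero.1 (eq_zero_of_brieskornTwoForm_I hk ?_)⟩
  set v' := v - c • (Complex.I • X) with hv'
  have hv'S : v' ∈ S := S.sub_mem hv (hreal _ _ (S.smul_mem _ hX))
  have hall : ∀ u ∈ S, brieskornTwoForm n k v' u = 0 := by
    intro u hu
    set d : ℝ := radialDeriv n z u / radialDeriv n z X with hd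
    have hw : radialDeriv n z (u + (-d) • X) = 0 := by
      rw [map_add, map_smul, smul_eq_mul, hd]
      field_simp
      ring
    have h1 := hnull _ (S.add_mem hu (hreal _ _ hX)) hw
    rw [brieskornTwoForm_add_right, brieskornTwoForm_smul_right] at h1
    rw [hv', brieskornTwoForm_sub_smul_left, hXdef, brieskornTwoForm_reeb hk]
    have h2 : c * (-4 * radialDeriv n z X) = brieskornTwoForm n k v X := by
      rw [hc]; field_simp
    have h3 : radialDeriv n z u = d * radialDeriv n z X := by rw [hd]; field_simp
    rw [h3]
    linear_combination h1 - d * h2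
  exact hall _ (S.smul_mem _ hv'S)

/-- Submanifolds of the Brieskorn manifold cut out by complex linear conditions on the tangent
spaces which hold for the Euler field are contact submanifolds. -/
theorem isContactForm_of_tangentAt (hk : 1 ≤ k) {M : Set (EuclideanSpace ℂ (Fin (n + 1)))}
    (hM : M ⊆ brieskorn n k)
    (S : EuclideanSpace ℂ (Fin (n + 1)) → Submodule ℂ (EuclideanSpace ℂ (Fin (n + 1))))
    (hX : ∀ z ∈ M, eulerField n k z ∈ S z)
    (hT : ∀ z ∈ M, ∀ v, v ∈ tangentAt M z ↔ v ∈ S z ∧ radialDeriv n z v = 0) :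
    IsContactForm M (brieskornForm n k) := by
  have hR : ∀ z ∈ M, Complex.I • eulerField n k z ∈ tangentAt M z := fun z hz =>
    (hT z hz _).2 ⟨(S z).smul_mem _ (hX z hz), radialDeriv_reeb z⟩
  refine ⟨fun z _ => contDiff_brieskornForm.contDiffAt, fun z hz => ⟨_, hR z hz, ?_⟩, ?_⟩
  · rw [brieskornForm_reeb hk (hM hz)]
    norm_num
  · intro z hz v hv hα hω
    simp only [extDer_brieskornForm] at hω
    obtain ⟨c, rfl⟩ := eq_smul_reeb_of_null (v := v) hk (hM hz) (S z) (hX z hz)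
      ((hT z hz v).1 hv).1 fun w hw hw' => by
        -- Correcting w along iX brings it into ker α. This does not change the pairing with v,
        -- because v is tangent to the sphere.
        have hwT : w + (-(brieskornForm n k z w / 4)) • (Complex.I • eulerField n k z) ∈
            tangentAt M z :=
          add_mem ((hT z hz w).2 ⟨hw, hw'⟩) (Submodule.smul_mem _ _ (hR z hz))
        have h := hω _ hwT (by
          rw [map_add, map_smul, brieskornForm_reeb hk (hM hz), smul_eq_mul]; ring)
        rw [brieskornTwoForm_add_right, brieskornTwoForm_smul_right, brieskornTwoForm_swap _
          (Complex.I • _), brieskornTwoForm_reeb hk, ((hT z hz v).1 hv).2] at h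
        linarith
    rw [map_smul, brieskornForm_reeb hk (hM hz)] at hα
    have : c = 0 := by simpa using hα
    simp [this]

theorem isContactForm_brieskorn (hk : 1 ≤ k) :
    IsContactForm (brieskorn n k) (brieskornForm n k) :=
  isContactForm_of_tangentAt hk subset_rfl (fun z => (brieskornPolyDeriv n k z).ker)
    (fun _ hz => polyDeriv_eulerField hk hz) fun _ hz _ => mem_tangentAt_brieskorn hk hz

theorem isContactForm_binding (hk : 1 ≤ k) :
    IsContactForm (binding n k) (brieskornForm n k) :=
  isContactForm_of_tangentAt hk (fun _ h => h.1)
    (fun z => (brieskornPolyDeriv n k z).ker ⊓ (proj0 (n := n)).ker)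
    (fun z hz => ⟨polyDeriv_eulerField hk hz.1, by
      change eulerField n k z 0 = 0
      rw [eulerField, cvec_zero, hz.2, mul_zero]⟩) fun _ hz v => by
      rw [mem_tangentAt_binding hk hz, Submodule.mem_inf]
      change _ ↔ (brieskornPolyDeriv n k _ v = 0 ∧ v 0 = 0) ∧ _
      tauto

/-- The tangent space of the page is not complex, but every vector tangent to W becomes tangent to
the page after adding a multiple of iX. So the null vectors of dα are multiples of iX, and no
nonzero multiple is tangent to the page. -/
theorem isSymplecticDifferential_page (hk : 1 ≤ k) {s : ℂ} (hs : s ∈ Metric.sphere (0 : ℂ) 1) :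
    IsSymplecticDifferential (page (brieskorn n k) (binding n k) (fibration n) s)
      (brieskornForm n k) where
  smooth z _ := contDiff_brieskornForm.contDiffAt
  nondegenerate z hz v hv hω := by
    simp only [extDer_brieskornForm] at hω
    have hzW := ((mem_page hs).1 hz).1
    have hpos := ((mem_page hs).1 hz).2.1
    have hk' : (0 : ℝ) < k := by exact_mod_cast hk
    have hv' := (mem_tangentAt_page hk hs hz).1 hv
    obtain ⟨c, rfl⟩ := eq_smul_reeb_of_null (v := v) hk hzW (brieskornPolyDeriv n k z).ker
      (polyDeriv_eulerField hk hzW) hv'.1 fun w hw hw' => by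
        have hwT : w + (-((star s * w 0).im / (2 / k * (star s * z 0).re))) •
            (Complex.I • eulerField n k z) ∈
              tangentAt (page (brieskorn n k) (binding n k) (fibration n) s) z := by
          have hw : brieskornPolyDeriv n k z w = 0 := hw
          refine (mem_tangentAt_page hk hs hz).2 ⟨?_, ?_, ?_⟩
          · simp [hw, polyDeriv_eulerField hk hzW]
          · rw [map_add, map_smul, hw', radialDeriv_reeb, smul_zero, add_zero]
          · rw [PiLp.add_apply, PiLp.smul_apply, mul_add, Complex.add_im, mul_smul_comm,
              Complex.smul_im, im_mul_reeb_zero, smul_eq_mul]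
            field_simp
            ring
        have h := hω _ hwT
        rw [brieskornTwoForm_add_right, brieskornTwoForm_smul_right, brieskornTwoForm_swap _
          (Complex.I • _), brieskornTwoForm_reeb hk, hv'.2.1] at h
        linarith
    have h := hv'.2.2
    rw [PiLp.smul_apply, mul_smul_comm, Complex.smul_im, im_mul_reeb_zero, smul_eq_mul] at h
    have : c = 0 := by
      rcases mul_eq_zero.1 h with h | h
      · exact h
      · have : 0 < 2 / k * (star s * z 0).re := by positivity
        linarith
    simp [this]

end Contact

/-! ### Alternating sums: contraction of α ∧ η ∧ ⋯ ∧ η with a vector. -/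

section Volumes

open Equiv Equiv.Perm

variable {V : Type*}

/-- The value of `a ∧ η ∧ ⋯ ∧ η` (`m` factors `η`), up to a positive constant. -/
def oddVolume (a : V → ℝ) (η : V → V → ℝ) {m : ℕ} (v : Fin (2 * m + 1) → V) : ℝ :=
  ∑ σ : Perm (Fin (2 * m + 1)), ((sign σ : ℤ) : ℝ) *
    (a (v (σ 0)) * ∏ i : Fin m, η (v (σ ⟨2 * i + 1, by omega⟩)) (v (σ ⟨2 * i + 2, by omega⟩)))

/-- The value of `r ∧ a ∧ η ∧ ⋯ ∧ η` (`j` factors `η`), up to a positive constant. -/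
def mixedVolume (r a : V → ℝ) (η : V → V → ℝ) {j : ℕ} (u : Fin (2 * j + 1 + 1) → V) : ℝ :=
  ∑ σ : Perm (Fin (2 * j + 1 + 1)), ((sign σ : ℤ) : ℝ) *
    (r (u (σ 0)) * (a (u (σ 1)) *
      ∏ i : Fin j, η (u (σ ⟨2 * i + 2, by omega⟩)) (u (σ ⟨2 * i + 3, by omega⟩))))

/-- Permutations fixing 0 are permutations of the other indices. This strips one argument from an
alternating sum. -/
theorem sum_perm_of_apply_zero {N : ℕ} (F : Perm (Fin (N + 1)) → ℝ)
    (hF : ∀ σ, σ 0 ≠ 0 → F σ = 0) :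
    ∑ σ, F σ = ∑ τ : Perm (Fin N), F (decomposeFin.symm (0, τ)) := by
  rw [← Equiv.sum_comp decomposeFin.symm, Fintype.sum_prod_type]
  refine Finset.sum_eq_single_of_mem 0 (Finset.mem_univ _) fun p _ hp => ?_
  exact Finset.sum_eq_zero fun τ _ => hF _ (by simpa using hp)

theorem decomposeFin_symm_zero_apply {N : ℕ} (τ : Perm (Fin N)) (x : Fin N) :
    decomposeFin.symm (0, τ) x.succ = (τ x).succ := by
  rw [decomposeFin_symm_apply_succ]; simp

theorem sign_decomposeFin_symm_zero {N : ℕ} (τ : Perm (Fin N)) :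
    sign (decomposeFin.symm (0, τ)) = sign τ := by
  rw [decomposeFin.symm_sign]; simp

theorem coe_swap_apply {N : ℕ} (a b x : Fin N) :
    (swap a b x : ℕ) = if (x : ℕ) = a then (b : ℕ) else if (x : ℕ) = b then (a : ℕ) else x := by
  simp only [swap_apply_def, Fin.ext_iff]
  split_ifs <;> rfl

theorem swap_zero_one_of_two_le {N : ℕ} (x : Fin (N + 2)) (h : 2 ≤ (x : ℕ)) : swap 0 1 x = x := by
  apply Fin.ext
  rw [coe_swap_apply]
  rw [if_neg, if_neg] <;> simp only [Fin.val_zero, Fin.val_one] <;> omega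

theorem odd_slot_lt {m : ℕ} (i : Fin m) : 2 * (i : ℕ) + 1 < 2 * m + 1 := by omega

theorem even_slot_lt {m : ℕ} (i : Fin m) : 2 * (i : ℕ) + 2 < 2 * m + 1 := by omega

/-- Reindexing by the transposition of the two equal arguments changes the sign of the sum. -/
theorem oddVolume_eq_zero_of_eq (a : V → ℝ) (η : V → V → ℝ) {m : ℕ} (v : Fin (2 * m + 1) → V)
    {x y : Fin (2 * m + 1)} (hxy : x ≠ y) (h : v x = v y) : oddVolume a η v = 0 := by
  have hv : ∀ i, v (swap x y i) = v i := by
    intro i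
    rw [swap_apply_def]
    split_ifs with h1 h2
    · rw [h1, h]
    · rw [h2, h]
    · rfl
  have : oddVolume a η v = -oddVolume a η v := by
    conv_lhs => rw [oddVolume, ← Equiv.sum_comp (Equiv.mulLeft (swap x y))]
    rw [oddVolume, ← Finset.sum_neg_distrib]
    refine Finset.sum_congr rfl fun σ _ => ?_
    simp [hv, sign_swap hxy]
  linarith

theorem mixedVolume_cons (r a : V → ℝ) (η : V → V → ℝ) {j : ℕ} (y : V) (v : Fin (2 * j + 1) → V)
    (hr : ∀ i, r (v i) = 0) :
    mixedVolume r a η (Fin.cons y v : Fin (2 * j + 1 + 1) → V) = r y * oddVolume a η v := by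
  rw [mixedVolume, sum_perm_of_apply_zero, oddVolume, Finset.mul_sum]
  · refine Finset.sum_congr rfl fun τ _ => ?_
    have h1 (i : ℕ) (hi : i + 1 < 2 * j + 1 + 1) :
        decomposeFin.symm (0, τ) (⟨i + 1, hi⟩ : Fin (2 * j + 1 + 1)) =
          (τ ⟨i, by omega⟩).succ := decomposeFin_symm_zero_apply τ ⟨i, by omega⟩
    have h2 : decomposeFin.symm (0, τ) (1 : Fin (2 * j + 1 + 1)) = (τ 0).succ := h1 0 (by omega)
    simp only [sign_decomposeFin_symm_zero, decomposeFin_symm_apply_zero, Fin.cons_zero, h1, h2,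
      Fin.cons_succ]
    ring
  · intro σ hσ
    obtain ⟨i, hi⟩ := Fin.exists_succ_eq.2 hσ
    simp [← hi, hr]

/-- Expansion by the slot that y occupies. If y is the argument of a, the first term results. Each
of the other 2(j + 1) slots contributes the same amount: exchanging the two slots of a factor costs
a sign which antisymmetry of η restores, and exchanging two factors is an even permutation. -/
theorem oddVolume_cons (a : V → ℝ) (η : V → V → ℝ) (hη : ∀ x y, η x y = -η y x) {j : ℕ} (y : V)
    (u : Fin (2 * j + 1 + 1) → V) :
    oddVolume (m := j + 1) a η (Fin.cons y u : Fin (2 * j + 1 + 1 + 1) → V) =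
      a y * symplecticVolume η (j := j + 1) u + 2 * (j + 1) * mixedVolume (η y) a η u := by
  set v : Fin (2 * (j + 1) + 1) → V := (Fin.cons y u : Fin (2 * j + 1 + 1 + 1) → V) with hv
  set F : Perm (Fin (2 * (j + 1) + 1)) → ℝ := fun σ => ((sign σ : ℤ) : ℝ) *
    (a (v (σ 0)) * ∏ i : Fin (j + 1),
      η (v (σ ⟨2 * i + 1, odd_slot_lt i⟩)) (v (σ ⟨2 * i + 2, even_slot_lt i⟩))) with hF
  -- The terms in which y, the argument with index 0, sits in slot p.
  set S : Fin (2 * (j + 1) + 1) → ℝ := fun p => ∑ σ, if σ p = 0 then F σ else 0 with hS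
  have hsum : oddVolume (m := j + 1) a η v = ∑ p, S p := by
    rw [hS, Finset.sum_comm]
    refine Finset.sum_congr rfl fun σ _ => ?_
    rw [Finset.sum_eq_single_of_mem (σ.symm 0) (Finset.mem_univ _)]
    · simp [hF]
    · intro p _ hp
      rw [if_neg]
      rintro h
      exact hp (by rw [← h]; simp)
  have hinv (π : Perm (Fin (2 * (j + 1) + 1))) (hπ : ∀ σ, F (σ * π) = F σ) (p) : S (π p) = S p := by
    simp only [hS]
    rw [← Equiv.sum_comp (Equiv.mulRight π) fun σ => if σ p = 0 then F σ else 0]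
    refine Finset.sum_congr rfl fun σ _ => ?_
    simp [hπ]
  -- exchanging the two slots of a factor
  have hflip (i₀ : Fin (j + 1)) (σ) :
      F (σ * swap ⟨2 * i₀ + 1, odd_slot_lt i₀⟩ ⟨2 * i₀ + 2, even_slot_lt i₀⟩) = F σ := by
    set π : Perm (Fin (2 * (j + 1) + 1)) := swap ⟨2 * i₀ + 1, odd_slot_lt i₀⟩ ⟨2 * i₀ + 2, even_slot_lt i₀⟩
    have hs : sign π = -1 := sign_swap (Fin.ne_of_val_ne (Nat.succ_ne_self _).symm)
    have h0 : π 0 = 0 := by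
      apply Fin.ext
      rw [coe_swap_apply]
      simp only [Fin.val_zero]
      split_ifs <;> omega
    have hprod : (∏ i : Fin (j + 1),
        η (v (σ (π ⟨2 * i + 1, odd_slot_lt i⟩))) (v (σ (π ⟨2 * i + 2, even_slot_lt i⟩)))) =
        ∏ i : Fin (j + 1), (if i = i₀ then (-1 : ℝ) else 1) *
          η (v (σ ⟨2 * i + 1, odd_slot_lt i⟩)) (v (σ ⟨2 * i + 2, even_slot_lt i⟩)) := by
      refine Finset.prod_congr rfl fun i _ => ?_
      by_cases hi : i = i₀
      · subst hi
        rw [if_pos rfl, swap_apply_left, swap_apply_right, hη]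
        ring
      · have hi' : (i : ℕ) ≠ i₀ := fun h => hi (Fin.ext h)
        rw [if_neg hi, swap_apply_of_ne_of_ne, swap_apply_of_ne_of_ne, one_mul] <;>
          simp only [ne_eq, Fin.mk.injEq] <;> omega
    simp only [hF, Perm.mul_apply, Perm.sign_mul, hs, h0, hprod, Finset.prod_mul_distrib]
    simp
  -- exchanging two factors
  have hblock (i₀ : Fin (j + 1)) (σ) :
      F (σ * (swap ⟨1, by omega⟩ ⟨2 * i₀ + 1, odd_slot_lt i₀⟩ *
        swap ⟨2, by omega⟩ ⟨2 * i₀ + 2, even_slot_lt i₀⟩)) = F σ := by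
    by_cases hi₀ : i₀ = 0
    · subst hi₀
      congr 1
      ext x
      simp only [Perm.mul_apply]
      congr 2
      apply Fin.ext
      simp only [coe_swap_apply, Fin.val_zero]
      split_ifs <;> omega
    have hi₀' : (i₀ : ℕ) ≠ 0 := fun h => hi₀ (Fin.ext h)
    have hz : ((0 : Fin (j + 1)) : ℕ) = 0 := rfl
    set π : Perm (Fin (2 * (j + 1) + 1)) := swap ⟨1, by omega⟩ ⟨2 * i₀ + 1, odd_slot_lt i₀⟩ *
      swap ⟨2, by omega⟩ ⟨2 * i₀ + 2, even_slot_lt i₀⟩ with hπ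
    have hs : sign π = 1 := by
      rw [hπ, Perm.sign_mul, sign_swap, sign_swap]
      · simp
      · simp only [ne_eq, Fin.mk.injEq]; omega
      · simp only [ne_eq, Fin.mk.injEq]; omega
    have h0 : π 0 = 0 := by
      apply Fin.ext
      simp only [hπ, Perm.mul_apply, coe_swap_apply, Fin.val_zero]
      split_ifs <;> omega
    have h1 (i : Fin (j + 1)) :
        π ⟨2 * i + 1, odd_slot_lt i⟩ = ⟨2 * (swap 0 i₀ i) + 1, odd_slot_lt _⟩ := by
      apply Fin.ext
      simp only [hπ, Perm.mul_apply, coe_swap_apply, hz]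
      split_ifs <;> omega
    have h2 (i : Fin (j + 1)) :
        π ⟨2 * i + 2, even_slot_lt i⟩ = ⟨2 * (swap 0 i₀ i) + 2, even_slot_lt _⟩ := by
      apply Fin.ext
      simp only [hπ, Perm.mul_apply, coe_swap_apply, hz]
      split_ifs <;> omega
    simp only [hF, Perm.mul_apply, Perm.sign_mul, hs, h0, h1, h2]
    rw [Equiv.prod_comp (swap 0 i₀) fun i : Fin (j + 1) =>
      η (v (σ ⟨2 * i + 1, odd_slot_lt i⟩)) (v (σ ⟨2 * i + 2, even_slot_lt i⟩))]
    simp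
  have hodd (i : Fin (j + 1)) : S ⟨2 * i + 1, odd_slot_lt i⟩ = S 1 := by
    rw [← hinv _ (hblock i) 1]
    congr 1
  have heven (i : Fin (j + 1)) : S ⟨2 * i + 2, even_slot_lt i⟩ = S 1 := by
    rw [← hodd i, ← hinv _ (hflip i) ⟨2 * i + 1, odd_slot_lt i⟩, swap_apply_left]
  have hall (p : Fin (2 * j + 1 + 1)) : S p.succ = S 1 := by
    rcases Nat.even_or_odd' (p : ℕ) with ⟨c, hc | hc⟩
    · rw [← hodd ⟨c, by omega⟩]; congr 1; ext; simp [hc]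
    · rw [← heven ⟨c, by omega⟩]; congr 1; ext; simp [hc]
  have hsucc (τ : Perm (Fin (2 * j + 1 + 1))) (i : ℕ) (hi : i + 1 < 2 * (j + 1) + 1) :
      decomposeFin.symm (0, τ) (⟨i + 1, hi⟩ : Fin (2 * j + 1 + 1 + 1)) =
        (τ ⟨i, by omega⟩).succ := decomposeFin_symm_zero_apply τ ⟨i, by omega⟩
  have hS0 : S 0 = a y * symplecticVolume η (j := j + 1) u := by
    have h := sum_perm_of_apply_zero (N := 2 * j + 1 + 1) (fun σ => if σ 0 = 0 then F σ else 0)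
      fun σ hσ => if_neg hσ
    refine h.trans ?_
    rw [symplecticVolume, Finset.mul_sum]
    refine Finset.sum_congr rfl fun τ _ => ?_
    rw [if_pos (decomposeFin_symm_apply_zero _ _)]
    simp only [hF, hv, hsucc]
    rw [sign_decomposeFin_symm_zero, decomposeFin_symm_apply_zero]
    simp only [Fin.cons_zero, Fin.cons_succ]
    exact mul_left_comm _ _ _
  -- Here y is the first argument of the first factor η. Transposing slots 0 and 1 makes y the
  -- leading vector, and a second transposition of the remaining slots puts η y in front of a. The
  -- two signs cancel.
  have hS1 : S 1 = mixedVolume (η y) a η u := by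
    have h := sum_perm_of_apply_zero (N := 2 * j + 1 + 1)
      (fun σ => if σ 0 = 0 then F (σ * swap 0 1) else 0) fun σ hσ => if_neg hσ
    simp only [hS]
    rw [← Equiv.sum_comp (Equiv.mulRight (swap 0 1)) fun σ => if σ 1 = 0 then F σ else 0]
    simp only [Equiv.coe_mulRight, Perm.mul_apply, swap_apply_right]
    refine h.trans ?_
    rw [mixedVolume, ← Equiv.sum_comp (Equiv.mulRight (swap 0 1))]
    refine Finset.sum_congr rfl fun τ _ => ?_
    rw [if_pos (decomposeFin_symm_apply_zero _ _)]
    have h01 : (0 : Fin (2 * (j + 1) + 1)) ≠ 1 := Fin.ne_of_val_ne Nat.zero_ne_one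
    have h01' : (0 : Fin (2 * j + 1 + 1)) ≠ 1 := Fin.ne_of_val_ne Nat.zero_ne_one
    simp only [hF, Perm.mul_apply, Perm.sign_mul, sign_swap h01,
      swap_apply_left, Fin.prod_univ_succ, Equiv.coe_mulRight]
    rw [sign_decomposeFin_symm_zero]
    have e1 : swap (0 : Fin (2 * (j + 1) + 1)) 1
        ⟨2 * ((0 : Fin (j + 1)) : ℕ) + 1, odd_slot_lt 0⟩ = 0 := swap_apply_right _ _
    have e2 : swap (0 : Fin (2 * (j + 1) + 1)) 1
        ⟨2 * ((0 : Fin (j + 1)) : ℕ) + 2, even_slot_lt 0⟩ = ⟨1 + 1, by omega⟩ :=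
      swap_zero_one_of_two_le (N := 2 * j + 1) _ le_rfl
    have e3 (i : Fin j) : swap (0 : Fin (2 * (j + 1) + 1)) 1
        ⟨2 * (i.succ : ℕ) + 1, odd_slot_lt i.succ⟩ = ⟨2 * i + 2 + 1, by omega⟩ :=
      swap_zero_one_of_two_le (N := 2 * j + 1) _ (by simp only [Fin.val_succ]; omega)
    have e4 (i : Fin j) : swap (0 : Fin (2 * (j + 1) + 1)) 1
        ⟨2 * (i.succ : ℕ) + 2, even_slot_lt i.succ⟩ = ⟨2 * i + 3 + 1, by omega⟩ :=
      swap_zero_one_of_two_le (N := 2 * j + 1) _ (by simp only [Fin.val_succ]; omega)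
    have e5 : (1 : Fin (2 * (j + 1) + 1)) = ⟨0 + 1, by omega⟩ := rfl
    have f0 : (τ * swap 0 1 : Perm (Fin (2 * j + 1 + 1))) ⟨0, by omega⟩ = τ 1 := by
      rw [Perm.mul_apply]; exact congrArg τ (swap_apply_left _ _)
    have f1 : (τ * swap 0 1 : Perm (Fin (2 * j + 1 + 1))) ⟨1, by omega⟩ = τ 0 := by
      rw [Perm.mul_apply]; exact congrArg τ (swap_apply_right _ _)
    have f2 (i : Fin j) : (τ * swap 0 1 : Perm (Fin (2 * j + 1 + 1))) ⟨2 * i + 2, by omega⟩ = τ ⟨2 * i + 2, by omega⟩ := by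
      rw [Perm.mul_apply]
      exact congrArg τ (swap_zero_one_of_two_le (N := 2 * j) _ (Nat.le_add_left _ _))
    have f3 (i : Fin j) : (τ * swap 0 1 : Perm (Fin (2 * j + 1 + 1))) ⟨2 * i + 3, by omega⟩ = τ ⟨2 * i + 3, by omega⟩ := by
      rw [Perm.mul_apply]
      exact congrArg τ (swap_zero_one_of_two_le (N := 2 * j) _ (by simp only; omega))
    simp only [e1, e2, e3, e4]
    simp only [e5, hsucc, f0, f1, f2, f3]
    rw [decomposeFin_symm_apply_zero, Perm.sign_mul, sign_swap h01']
    simp only [hv, Fin.cons_zero, Fin.cons_succ]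
    push_cast
    ring
  have hsplit : ∑ p, S p = S 0 + ∑ p : Fin (2 * j + 1 + 1), S p.succ := Fin.sum_univ_succ S
  rw [hsum, hsplit, hS0, Finset.sum_congr rfl fun p _ => hall p, hS1]
  rw [Finset.sum_const, Finset.card_univ, Fintype.card_fin, nsmul_eq_mul]
  push_cast
  ring

/-- If the vector `y` in the span of `u` is dual to `r` with respect to `η`, then on `u` the forms
`a(y) η ∧ ⋯ ∧ η` and `r ∧ a ∧ η ∧ ⋯ ∧ η` are proportional. -/
theorem apply_mul_symplecticVolume {V : Type*} [AddCommGroup V] [Module ℝ V] (r : V → ℝ)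
    (a : V →ₗ[ℝ] ℝ) (η : V →ₗ[ℝ] V →ₗ[ℝ] ℝ) (hη : ∀ x y, η x y = -η y x) {j : ℕ}
    (u : Fin (2 * j + 1 + 1) → V) {y : V} (hy : y ∈ Submodule.span ℝ (range u)) {μ : ℝ}
    (hμ : ∀ i, η y (u i) = μ * r (u i)) :
    a y * symplecticVolume (fun v w => η v w) (j := j + 1) u =
      -(2 * (j + 1) * μ) * mixedVolume r a (fun v w => η v w) u := by
  obtain ⟨c, rfl⟩ := (Submodule.mem_span_range_iff_exists_fun ℝ).1 hy
  -- The expansion with u i placed in front of u: the argument u i is repeated, so the left side of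
  -- the expansion vanishes. Summing with the coefficients of y gives the contraction by y.
  have key (i) : a (u i) * symplecticVolume (fun v w => η v w) (j := j + 1) u +
      2 * (j + 1) * mixedVolume (fun w => η (u i) w) a (fun v w => η v w) u = 0 := by
    rw [← oddVolume_cons a (fun v w => η v w) hη (u i) u]
    exact oddVolume_eq_zero_of_eq (m := j + 1) _ _ _
      (x := (0 : Fin (2 * j + 1 + 1 + 1))) (y := i.succ) (Fin.succ_ne_zero i).symm (by simp)
  have hmix : μ * mixedVolume r a (fun v w => η v w) u =
      ∑ i, c i * mixedVolume (fun w => η (u i) w) a (fun v w => η v w) u := by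
    simp only [mixedVolume, Finset.mul_sum]
    rw [Finset.sum_comm]
    refine Finset.sum_congr rfl fun σ _ => ?_
    have := hμ (σ 0)
    simp only [map_sum, map_smul, LinearMap.sum_apply, LinearMap.smul_apply, smul_eq_mul] at this
    calc _ = ((sign σ : ℤ) : ℝ) * ((μ * r (u (σ 0))) * (a (u (σ 1)) *
      ∏ i : Fin j, η (u (σ ⟨2 * i + 2, by omega⟩)) (u (σ ⟨2 * i + 3, by omega⟩)))) := by ring
      _ = _ := by
        rw [← this, Finset.sum_mul, Finset.mul_sum]
        exact Finset.sum_congr rfl fun i _ => by ring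
  have h0 : ∑ i, c i * (a (u i) * symplecticVolume (fun v w => η v w) (j := j + 1) u +
      2 * (j + 1) * mixedVolume (fun w => η (u i) w) a (fun v w => η v w) u) = 0 :=
    Finset.sum_eq_zero fun i _ => by rw [key, mul_zero]
  simp only [mul_add, Finset.sum_add_distrib] at h0
  have h1 : ∑ i, c i * (2 * (j + 1) * mixedVolume (fun w => η (u i) w) a (fun v w => η v w) u) =
      2 * (j + 1) * (μ * mixedVolume r a (fun v w => η v w) u) := by
    rw [hmix, Finset.mul_sum]
    exact Finset.sum_congr rfl fun i _ => by ring
  rw [map_sum, Finset.sum_mul]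
  simp only [map_smul, smul_eq_mul]
  have h2 : ∑ i, c i * a (u i) * symplecticVolume (fun v w => η v w) (j := j + 1) u =
      ∑ i, c i * (a (u i) * symplecticVolume (fun v w => η v w) (j := j + 1) u) :=
    Finset.sum_congr rfl fun i _ => by ring
  rw [h2]
  simp only [mul_add] at h1
  linarith

end Volumes

/-! ### The boundary orientation of the binding. -/

section Orientation

variable {n k : ℕ}

/-- The `2`-form `dα_k` as a bilinear map. -/
def brieskornTwoFormₗ (n k : ℕ) :
    EuclideanSpace ℂ (Fin (n + 1)) →ₗ[ℝ] EuclideanSpace ℂ (Fin (n + 1)) →ₗ[ℝ] ℝ :=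
  LinearMap.mk₂ ℝ (brieskornTwoForm n k)
    (fun u v w => by
      rw [brieskornTwoForm_swap, brieskornTwoForm_add_right, brieskornTwoForm_swap w u,
        brieskornTwoForm_swap w v]
      ring)
    (fun c u v => by
      rw [brieskornTwoForm_swap, brieskornTwoForm_smul_right, brieskornTwoForm_swap v u]
      simp)
    brieskornTwoForm_add_right brieskornTwoForm_smul_right

/-- The vector field on a page which is dual to the differential of `|z₀|` with respect to `dα_k`,
up to a negative function. -/
def pageField (z : EuclideanSpace ℂ (Fin (n + 1))) : EuclideanSpace ℂ (Fin (n + 1)) :=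
  cvec 0 ((-Complex.I) • ((star (tail z) ⬝ᵥ tail z) • tail z - (tail z ⬝ᵥ tail z) • star (tail z)))

theorem re_star_mul_of_im_eq_zero {s a b : ℂ} (hs : s ∈ Metric.sphere (0 : ℂ) 1)
    (ha : (star s * a).im = 0) : (star a * b).re = (star s * a).re * (star s * b).re := by
  have hss := star_mul_self_of_mem_sphere hs
  have h1 : star s * a = ((star s * a).re : ℂ) := Complex.ext (by simp) (by simpa using ha)
  have h2 : a = ((star s * a).re : ℂ) * s := by
    rw [← h1]; linear_combination -a * hss
  have h3 : star a = ((star s * a).re : ℂ) * star s := by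
    conv_lhs => rw [h2]
    simp
  rw [h3, mul_assoc, Complex.re_ofReal_mul]

theorem pageField_mem (hk : 1 ≤ k) {s : ℂ} (hs : s ∈ Metric.sphere (0 : ℂ) 1)
    {z : EuclideanSpace ℂ (Fin (n + 1))}
    (hz : z ∈ page (brieskorn n k) (binding n k) (fibration n) s) :
    pageField z ∈ tangentAt (page (brieskorn n k) (binding n k) (fibration n) s) z := by
  refine (mem_tangentAt_page hk hs hz).2 ⟨?_, ?_, by simp [pageField]⟩
  · rw [brieskornPolyDeriv_apply, pageField, cvec_zero, tail_cvec, dotProduct_smul,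
      dotProduct_sub, dotProduct_smul, dotProduct_smul, dotProduct_comm (tail z) (star (tail z))]
    simp only [smul_eq_mul]
    ring
  · rw [radialDeriv_apply, pageField, cvec_zero, tail_cvec, dotProduct_smul,
      dotProduct_sub, dotProduct_smul, dotProduct_smul, star_dotProduct_self_eq,
      Matrix.star_dotProduct_star]
    simp [sub_eq_add_neg]
    ring

theorem brieskornForm_pageField (z : EuclideanSpace ℂ (Fin (n + 1))) :
    brieskornForm n k z (pageField z) =
      -2 * ((star (tail z) ⬝ᵥ tail z).re ^ 2 - Complex.normSq (tail z ⬝ᵥ tail z)) := by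
  rw [brieskornForm_apply, pageField, cvec_zero, tail_cvec, dotProduct_smul,
      dotProduct_sub, dotProduct_smul, dotProduct_smul, star_dotProduct_self_eq,
      Matrix.star_dotProduct_star, Complex.normSq_apply]
  simp [sub_eq_add_neg]
  ring

/-- The difference |u|⁴ - |u·u|² is positive for |z₀| < 1, since then |u|² = 2 - |z₀|² > 1 while
|u·u| = |z₀|^k ≤ 1. The bound stays away from zero at the binding. -/
theorem brieskornForm_pageField_neg {z : EuclideanSpace ℂ (Fin (n + 1))}
    (hz : z ∈ brieskorn n k) (h1 : ‖z 0‖ < 1) : brieskornForm n k z (pageField z) < 0 := by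
  obtain ⟨hz1, hz2⟩ := mem_brieskorn.1 hz
  have hq : tail z ⬝ᵥ tail z = -z 0 ^ k := by linear_combination hz1
  rw [brieskornForm_pageField, hq, Complex.normSq_eq_norm_sq, norm_neg, norm_pow]
  rw [Complex.normSq_eq_norm_sq] at hz2
  have h3 : ‖z 0‖ ^ k ≤ 1 := pow_le_one₀ (norm_nonneg _) h1.le
  have h4 : 0 ≤ ‖z 0‖ ^ k := by positivity
  have h5 : 1 < (star (tail z) ⬝ᵥ tail z).re := by nlinarith [norm_nonneg (z 0)]
  nlinarith

/-- For w tangent to the page, the differentiated polynomial expresses u·w through w₀, and the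
sphere equation expresses the real part of ū·w through it. Only the radial component of w₀ is left.
The factor Re(s̄z₀) tends to 0 at the binding, where dα degenerates. -/
theorem brieskornTwoForm_pageField (hk : 1 ≤ k) {s : ℂ} (hs : s ∈ Metric.sphere (0 : ℂ) 1)
    {z w : EuclideanSpace ℂ (Fin (n + 1))}
    (hz : z ∈ page (brieskorn n k) (binding n k) (fibration n) s)
    (hw : w ∈ tangentAt (page (brieskorn n k) (binding n k) (fibration n) s) z) :
    brieskornTwoForm n k (pageField z) w =
      -4 * (star s * z 0).re * ((star (tail z) ⬝ᵥ tail z).re +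
        k / 2 * Complex.normSq (z 0) ^ (k - 1)) * (star s * w 0).re := by
  obtain ⟨hw1, hw2, hw3⟩ := (mem_tangentAt_page hk hs hz).1 hw
  obtain ⟨hzW, hpos, him⟩ := (mem_page hs).1 hz
  obtain ⟨hz1, hz2⟩ := mem_brieskorn.1 hzW
  have hq : tail z ⬝ᵥ tail z = -z 0 ^ k := by linear_combination hz1
  rw [brieskornPolyDeriv_apply] at hw1
  rw [radialDeriv_apply, re_star_mul_of_im_eq_zero hs him] at hw2
  have hb : tail z ⬝ᵥ tail w = -(k / 2) * z 0 ^ (k - 1) * w 0 := by linear_combination hw1 / 2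
  have hzk : star (z 0) ^ k * (z 0 ^ (k - 1) * w 0) =
      ((Complex.normSq (z 0) ^ (k - 1) : ℝ) : ℂ) * (star (z 0) * w 0) := by
    obtain ⟨m, rfl⟩ : ∃ m, k = m + 1 := ⟨k - 1, by omega⟩
    push_cast
    rw [Complex.normSq_eq_conj_mul_self, Complex.star_def]
    ring
  have h1 : star (tail (pageField z)) ⬝ᵥ tail w = Complex.I *
      (((star (tail z) ⬝ᵥ tail z).re : ℂ) * (star (tail z) ⬝ᵥ tail w) -
        (k / 2 : ℝ) * (((Complex.normSq (z 0) ^ (k - 1) : ℝ) : ℂ) * (star (z 0) * w 0))) := by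
    rw [← hzk, pageField, tail_cvec, star_smul, smul_dotProduct, star_sub, sub_dotProduct,
      star_smul, star_smul, smul_dotProduct, smul_dotProduct, star_star, hb, hq,
      ← star_dotProduct_self_eq, ← star_dotProduct_comm]
    simp
    ring
  rw [brieskornTwoForm, h1]
  have h2 := re_star_mul_of_im_eq_zero (b := w 0) hs him
  simp only [pageField, cvec_zero, star_zero, zero_mul, Complex.zero_im, mul_zero, zero_add,
    Complex.I_mul_im, Complex.sub_re, Complex.re_ofReal_mul, h2]
  linear_combination 4 * (star (tail z) ⬝ᵥ tail z).re * hw2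

theorem continuous_brieskornTwoForm : Continuous
    fun p : EuclideanSpace ℂ (Fin (n + 1)) × EuclideanSpace ℂ (Fin (n + 1)) =>
      brieskornTwoForm n k p.1 p.2 := by
  have h := fun i => (contDiff_apply (n := n) i).continuous
  have h1 (i : Fin (n + 1)) : Continuous fun p : EuclideanSpace ℂ (Fin (n + 1)) ×
    EuclideanSpace ℂ (Fin (n + 1)) => p.1 i := (h i).comp continuous_fst
  have h2 (i : Fin (n + 1)) : Continuous fun p : EuclideanSpace ℂ (Fin (n + 1)) ×
    EuclideanSpace ℂ (Fin (n + 1)) => p.2 i := (h i).comp continuous_snd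
  simp only [brieskornTwoForm, dotProduct, tail, Pi.star_apply]
  fun_prop

theorem continuousWithinAt_brieskornTwoForm {X : Type*} [TopologicalSpace X] {S : Set X} {b : X}
    {u v : X → EuclideanSpace ℂ (Fin (n + 1))} (hu : ContinuousWithinAt u S b)
    (hv : ContinuousWithinAt v S b) :
    ContinuousWithinAt (fun x => brieskornTwoForm n k (u x) (v x)) S b :=
  ContinuousAt.comp_continuousWithinAt (f := fun x => (u x, v x))
    (g := fun p : EuclideanSpace ℂ (Fin (n + 1)) × EuclideanSpace ℂ (Fin (n + 1)) =>
      brieskornTwoForm n k p.1 p.2) continuous_brieskornTwoForm.continuousAt (hu.prodMk hv)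

theorem pageEq_eq_zero_of_mem_closure {s : ℂ} (hs : s ∈ Metric.sphere (0 : ℂ) 1)
    {z : EuclideanSpace ℂ (Fin (n + 1))}
    (hz : z ∈ closure (page (brieskorn n k) (binding n k) (fibration n) s)) :
    pageEq n k s z = 0 ∧ 0 ≤ (star s * z 0).re := by
  have hc : IsClosed {z : EuclideanSpace ℂ (Fin (n + 1)) |
      pageEq n k s z = 0 ∧ 0 ≤ (star s * z 0).re} :=
    (isClosed_eq (contDiff_pageEq s).continuous continuous_const).inter
      (isClosed_le continuous_const (Complex.continuous_re.comp
        (continuous_const.mul (contDiff_apply 0).continuous)))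
  refine closure_minimal (fun y hy => ?_) hc hz
  have hy' : y ∈ {z : EuclideanSpace ℂ (Fin (n + 1)) | 0 < (star s * z 0).re} :=
    ((mem_page hs).1 hy).2.1
  have := (Set.ext_iff.1 (page_inter (k := k) hs) y).1 ⟨hy, hy'⟩
  exact ⟨this.2, le_of_lt hy'⟩

/-- The derivative of the radial coordinate on the page over `s`. -/
def pageRadial (n : ℕ) (s : ℂ) : EuclideanSpace ℂ (Fin (n + 1)) →L[ℝ] ℝ :=
  Complex.reCLM.comp ((star s • proj0 (n := n)).restrictScalars ℝ)

theorem pageRadial_apply (s : ℂ) (w : EuclideanSpace ℂ (Fin (n + 1))) :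
    pageRadial n s w = (star s * w 0).re := rfl

/-- The closed page lies in Re(s̄z₀) ≥ 0 and satisfies the page equations. An outward vector thus
has nonpositive radial derivative; if it were zero, ν₀ would vanish and ν would be tangent to B. -/
theorem pageRadial_neg_of_outward (hk : 1 ≤ k) {s : ℂ} (hs : s ∈ Metric.sphere (0 : ℂ) 1)
    {b ν : EuclideanSpace ℂ (Fin (n + 1))} (hb : b ∈ binding n k)
    (hout : -ν ∈ posTangentConeAt
      (closure (page (brieskorn n k) (binding n k) (fibration n) s)) b)
    (hνb : ν ∉ tangentAt (binding n k) b) : pageRadial n s ν < 0 := by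
  have hs0 : star s ≠ 0 := fun h => by
    have := star_mul_self_of_mem_sphere hs
    simp [h] at this
  have hbP : b ∈ closure (page (brieskorn n k) (binding n k) (fibration n) s) := by
    simpa using mem_closure_of_nonempty_tangentConeAt ⟨_, hout⟩
  have h1 : 0 ≤ pageRadial n s (-ν) :=
    fderiv_nonneg_of_posTangentConeAt (pageRadial n s).hasFDerivAt
      (fun y hy => by
        rw [pageRadial_apply, pageRadial_apply, hb.2]
        simpa using (pageEq_eq_zero_of_mem_closure hs hy).2) hout
  have h2 : pageEqDeriv n k s b (-ν) = 0 := fderiv_eq_zero_of_const (hasFDerivAt_pageEq s b)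
    (fun y hy => (pageEq_eq_zero_of_mem_closure hs hy).1) hbP
    (posTangentConeAt_subset_tangentAt hout)
  rw [map_neg, neg_nonneg] at h1
  rw [map_neg, neg_eq_zero] at h2
  refine lt_of_le_of_ne h1 fun h3 => hνb ?_
  have h4 := congrArg Prod.fst h2
  rw [pageEqDeriv_fst] at h4
  have h5 := congrArg Prod.fst h4
  have h6 := congrArg Prod.snd h4
  have h7 := congrArg Prod.snd h2
  rw [brieskornEqDeriv_fst] at h5
  rw [brieskornEqDeriv_snd] at h6
  rw [pageEqDeriv_snd] at h7
  refine (mem_tangentAt_binding hk hb).2 ⟨h5, by simpa using h6, ?_⟩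
  have : star s * ν 0 = 0 := Complex.ext h3 h7
  exact (mul_eq_zero.1 this).resolve_left hs0

theorem continuousWithinAt_mixedVolume {X V : Type*} [TopologicalSpace X] {S : Set X} {b : X}
    {r : V → ℝ} {a : X → V → ℝ} {η : V → V → ℝ} {j : ℕ} {U : X → Fin (2 * j + 1 + 1) → V}
    (h1 : ∀ i, ContinuousWithinAt (fun x => r (U x i)) S b)
    (h2 : ∀ i, ContinuousWithinAt (fun x => a x (U x i)) S b)
    (h3 : ∀ i l, ContinuousWithinAt (fun x => η (U x i) (U x l)) S b) :
    ContinuousWithinAt (fun x => mixedVolume r (a x) η (U x)) S b :=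
  tendsto_finsetSum _ fun _ _ => tendsto_const_nhds.mul ((h1 _).mul ((h2 _).mul
    (tendsto_finsetProd _ fun _ _ => h3 _ _)))

/-- The frame u spans the tangent space of the page, so the page field Y can be contracted. Both
α(Y) and the factor relating dα(Y, ·) to the radial differential are negative. -/
theorem symplecticVolume_pos_of_mixedVolume_neg (hk : 1 ≤ k) {s : ℂ}
    (hs : s ∈ Metric.sphere (0 : ℂ) 1) {x : EuclideanSpace ℂ (Fin (n + 1))}
    (hx : x ∈ page (brieskorn n k) (binding n k) (fibration n) s) (hx1 : ‖x 0‖ < 1) {j : ℕ}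
    (hj : 2 * j + 4 = 2 * n) {u : Fin (2 * j + 1 + 1) → EuclideanSpace ℂ (Fin (n + 1))}
    (hu : ∀ i, u i ∈ tangentAt (page (brieskorn n k) (binding n k) (fibration n) s) x)
    (hli : LinearIndependent ℝ u)
    (hmix : mixedVolume (pageRadial n s) (brieskornForm n k x) (brieskornTwoForm n k) u < 0) :
    0 < symplecticVolume (brieskornTwoForm n k) (j := j + 1) u := by
  have hYspan : pageField x ∈ Submodule.span ℝ (range u) := by
    have h1 : Submodule.span ℝ (range u) ≤
        tangentAt (page (brieskorn n k) (binding n k) (fibration n) s) x :=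
      Submodule.span_le.2 (by rintro _ ⟨i, rfl⟩; exact hu i)
    have h2 := finrank_span_eq_card hli
    have h3 := finrank_tangentAt_page hk hs hx
    rw [Fintype.card_fin] at h2
    rw [Submodule.eq_of_le_of_finrank_eq h1 (by omega)]
    exact pageField_mem hk hs hx
  have hxW := ((mem_page hs).1 hx).1
  have key : brieskornForm n k x (pageField x) *
      symplecticVolume (brieskornTwoForm n k) (j := j + 1) u = _ :=
    apply_mul_symplecticVolume (pageRadial n s) (brieskornForm n k x : _ →ₗ[ℝ] ℝ)
      (brieskornTwoFormₗ n k) brieskornTwoForm_swap u hYspan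
      (fun i => brieskornTwoForm_pageField hk hs hx (hu i))
  have hneg := brieskornForm_pageField_neg hxW hx1
  have hρ := ((mem_page hs).1 hx).2.1
  have hN := brieskorn_tail_pos hk hxW
  have hq := Complex.normSq_nonneg (x 0)
  refine pos_of_mul_neg_right ?_ hneg.le
  rw [key]
  refine mul_neg_of_pos_of_neg ?_ hmix
  have : 0 < (star s * x 0).re * ((star (tail x) ⬝ᵥ tail x).re +
      k / 2 * Complex.normSq (x 0) ^ (k - 1)) := by positivity
  nlinarith

theorem mixedVolume_cons_neg (hk : 1 ≤ k) {s : ℂ} (hs : s ∈ Metric.sphere (0 : ℂ) 1)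
    {b ν : EuclideanSpace ℂ (Fin (n + 1))} (hb : b ∈ binding n k)
    (hout : -ν ∈ posTangentConeAt
      (closure (page (brieskorn n k) (binding n k) (fibration n) s)) b)
    (hνb : ν ∉ tangentAt (binding n k) b) {j : ℕ}
    {v : Fin (2 * j + 1) → EuclideanSpace ℂ (Fin (n + 1))}
    (hv : ∀ i, v i ∈ tangentAt (binding n k) b)
    (hpos : 0 < contactVolume (brieskornForm n k) b v) :
    mixedVolume (pageRadial n s) (brieskornForm n k b) (brieskornTwoForm n k)
      (Fin.cons ν v : Fin (2 * j + 1 + 1) → EuclideanSpace ℂ (Fin (n + 1))) < 0 := by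
  have hrv (i) : pageRadial n s (v i) = 0 := by
    rw [pageRadial_apply, ((mem_tangentAt_binding hk hb).1 (hv i)).2.2]
    simp
  rw [mixedVolume_cons _ _ _ _ _ hrv]
  have : oddVolume (brieskornForm n k b) (brieskornTwoForm n k) v =
      contactVolume (brieskornForm n k) b v := by
    simp only [oddVolume, contactVolume, extDer_brieskornForm]
  rw [this]
  exact mul_neg_of_neg_of_pos (pageRadial_neg_of_outward hk hs hb hout hνb) hpos

/-- The sign of (dα)^(j+1) on the page is reduced to that of d|z₀| ∧ α ∧ (dα)^j. The latter makes
sense at b too, where it is the radial derivative of ν times the contact volume, hence negative. By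
continuity it is negative nearby. -/
theorem inducesBoundaryOrientation (hk : 1 ≤ k) {s : ℂ} (hs : s ∈ Metric.sphere (0 : ℂ) 1) :
    InducesBoundaryOrientation (page (brieskorn n k) (binding n k) (fibration n) s) (binding n k)
      (brieskornForm n k) := by
  intro b hb j ν v htan hν hv hout hνb hli hspan hpos
  set P := page (brieskorn n k) (binding n k) (fibration n) s with hP
  set U : EuclideanSpace ℂ (Fin (n + 1)) → Fin (2 * j + 1 + 1) → EuclideanSpace ℂ (Fin (n + 1)) :=
    fun x => Fin.cons (ν x) (fun i => v i x) with hU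
  have hUc : ∀ i, ContinuousWithinAt (fun x => U x i) (closure P) b :=
    Fin.cases (by simpa only [hU, Fin.cons_zero] using hν)
      (fun i => by simpa only [hU, Fin.cons_succ] using hv i)
  -- The integer j is arbitrary in the definition; a basis of T_bB has 2n - 3 elements.
  have hdim : 2 * j + 4 = 2 * n := by
    have h1 := finrank_span_eq_card hli
    rw [hspan, Fintype.card_fin] at h1
    have := finrank_tangentAt_binding hk hb
    omega
  have hle : 𝓝[P] b ≤ 𝓝[closure P] b := nhdsWithin_mono b subset_closure
  have hmixb : mixedVolume (pageRadial n s) (brieskornForm n k b) (brieskornTwoForm n k) (U b) < 0 :=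
    mixedVolume_cons_neg hk hs hb hout hνb
    (fun i => by rw [← hspan]; exact Submodule.subset_span ⟨i, rfl⟩) hpos
  have hU1 (i) : ContinuousWithinAt (fun x => pageRadial n s (U x i)) (closure P) b :=
    (pageRadial n s).continuous.continuousAt.comp_continuousWithinAt (hUc i)
  have hU2 (i) : ContinuousWithinAt (fun x => brieskornForm n k x (U x i)) (closure P) b :=
    (contDiff_brieskornForm.continuous.continuousWithinAt).clm_apply (hUc i)
  have hU3 (i l) : ContinuousWithinAt (fun x => brieskornTwoForm n k (U x i) (U x l))
      (closure P) b := continuousWithinAt_brieskornTwoForm (hUc i) (hUc l)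
  have hmix : ContinuousWithinAt (fun x => mixedVolume (pageRadial n s) (brieskornForm n k x)
      (brieskornTwoForm n k) (U x)) (closure P) b :=
    continuousWithinAt_mixedVolume (a := fun x => brieskornForm n k x) hU1 hU2 hU3
  have hliU : ∀ᶠ x in 𝓝[P] b, LinearIndependent ℝ (U x) := by
    have h1 : LinearIndependent ℝ (U b) := linearIndependent_finCons.2 ⟨hli, by rwa [hspan]⟩
    have h2 : Tendsto U (𝓝[closure P] b) (𝓝 (U b)) := tendsto_pi_nhds.2 hUc
    exact (h2.eventually h1.eventually).filter_mono hle
  have hnorm : ∀ᶠ x in 𝓝[P] b, ‖x 0‖ < 1 := by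
    have h1 : ContinuousAt (fun x : EuclideanSpace ℂ (Fin (n + 1)) => ‖x 0‖) b :=
      (contDiff_apply 0).continuous.norm.continuousAt
    have h2 : ‖b 0‖ < 1 := by rw [hb.2]; simp
    exact (h1.eventually_lt continuousAt_const h2).filter_mono nhdsWithin_le_nhds
  have hmixe : ∀ᶠ x in 𝓝[P] b, mixedVolume (pageRadial n s) (brieskornForm n k x)
      (brieskornTwoForm n k) (U x) < 0 := (hmix.tendsto.eventually_lt_const hmixb).filter_mono hle
  have hmem : ∀ᶠ x in 𝓝[P] b, x ∈ P := self_mem_nhdsWithin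
  apply (hmem.and (hliU.and (hnorm.and hmixe))).mono
  rintro x ⟨hx, hlix, hx1, hmx⟩
  have hUT : ∀ i, U x i ∈ tangentAt P x :=
    Fin.cases (by simpa only [hU, Fin.cons_zero] using (htan x hx).1)
      (fun i => by simpa only [hU, Fin.cons_succ] using (htan x hx).2 i)
  have hext : extDer (brieskornForm n k) x = brieskornTwoForm n k := by
    ext u w; exact extDer_brieskornForm x u w
  rw [hext]
  exact symplecticVolume_pos_of_mixedVolume_neg hk hs hx hx1 hdim hUT hlix hmx

theorem isSupportedBy_brieskorn (hk : 1 ≤ k) :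
    IsSupportedBy (brieskorn n k) (brieskornForm n k) (binding n k) (fibration n) where
  contact := isContactForm_brieskorn hk
  binding_contact := isContactForm_binding hk
  page_symplectic _ hs := isSymplecticDifferential_page hk hs
  orientation _ hs := inducesBoundaryOrientation hk hs

end Orientation

/-! ### Compactness and local triviality of the fibration. -/

section OpenBook

variable {n k : ℕ} {X : Type*} [NormedAddCommGroup X] [NormedSpace ℝ X]

theorem contDiffAt_cvec {f : X → ℂ} {u : X → Fin n → ℂ} {x : X} (hf : ContDiffAt ℝ ∞ f x)
    (hu : ∀ j, ContDiffAt ℝ ∞ (fun y => u y j) x) :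
    ContDiffAt ℝ ∞ (fun y => cvec (f y) (u y)) x :=
  contDiffAt_piLp' _ fun i => Fin.cases hf (fun j => hu j) i

theorem isClosed_brieskorn : IsClosed (brieskorn n k) := by
  have : brieskorn n k = brieskornEq n k ⁻¹' {0} := by
    ext z; exact brieskornEq_eq_zero.symm
  rw [this]
  exact isClosed_singleton.preimage contDiff_brieskornEq.continuous

theorem isCompact_brieskorn : IsCompact (brieskorn n k) :=
  (isCompact_sphere _ _).of_isClosed_subset isClosed_brieskorn fun _ hz => hz.2

theorem isCompact_binding : IsCompact (binding n k) :=
  isCompact_brieskorn.of_isClosed_subset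
    (isClosed_brieskorn.inter (isClosed_eq (contDiff_apply 0).continuous continuous_const))
    fun _ hz => hz.1

theorem contDiffAt_fibration {z : EuclideanSpace ℂ (Fin (n + 1))} (hz : z 0 ≠ 0) :
    ContDiffAt ℝ ∞ (fibration n) z := by
  have h0 := (contDiff_apply (n := n) 0).contDiffAt (x := z)
  have h1 : ContDiffAt ℝ ∞ (fun y : EuclideanSpace ℂ (Fin (n + 1)) => (‖y 0‖ : ℂ)) z :=
    Complex.ofRealCLM.contDiff.contDiffAt.comp z (h0.norm ℝ hz)
  exact h0.mul (h1.inv (by simpa using hz))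

theorem norm_fibration {z : EuclideanSpace ℂ (Fin (n + 1))} (hz : z 0 ≠ 0) :
    ‖fibration n z‖ = 1 := by
  have : ‖z 0‖ ≠ 0 := by simpa using hz
  simp [fibration, this]

/-- The circle action with weights `1` and `k / 2` on `ℂⁿ⁺¹`. -/
def weightedRotation (n k : ℕ) (φ : ℝ) (z : EuclideanSpace ℂ (Fin (n + 1))) :
    EuclideanSpace ℂ (Fin (n + 1)) :=
  cvec (Complex.exp (φ * Complex.I) * z 0) (Complex.exp (k * φ / 2 * Complex.I) • tail z)

theorem star_exp_mul_exp (x : ℂ) (hx : x.im = 0) :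
    star (Complex.exp (x * Complex.I)) * Complex.exp (x * Complex.I) = 1 := by
  rw [Complex.star_def, ← Complex.exp_conj, ← Complex.exp_add]
  have : (starRingEnd ℂ) x = x := Complex.conj_eq_iff_im.2 hx
  simp [this]

/-- Both z₀^k and the sum of squares are multiplied by exp(ikφ), and all norms are kept. -/
theorem weightedRotation_mem {φ : ℝ} {z : EuclideanSpace ℂ (Fin (n + 1))}
    (hz : z ∈ brieskorn n k) : weightedRotation n k φ z ∈ brieskorn n k := by
  obtain ⟨h1, h2⟩ := mem_brieskorn.1 hz
  rw [mem_brieskorn, weightedRotation, cvec_zero, tail_cvec]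
  constructor
  · have : Complex.exp (φ * Complex.I) ^ k =
        Complex.exp (k * φ / 2 * Complex.I) * Complex.exp (k * φ / 2 * Complex.I) := by
      rw [← Complex.exp_nat_mul, ← Complex.exp_add]
      ring_nf
    rw [mul_pow, this, smul_dotProduct, dotProduct_smul, smul_eq_mul, smul_eq_mul]
    linear_combination
      Complex.exp (k * φ / 2 * Complex.I) * Complex.exp (k * φ / 2 * Complex.I) * h1
  · rw [star_smul, smul_dotProduct, dotProduct_smul, smul_eq_mul, smul_eq_mul, ← mul_assoc,
      star_exp_mul_exp _ (by simp [← Complex.ofReal_natCast]), one_mul, map_mul,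
      Complex.normSq_eq_norm_sq (Complex.exp _),
      Complex.norm_exp_ofReal_mul_I]
    simpa using h2

theorem weightedRotation_neg_apply (φ : ℝ) (z : EuclideanSpace ℂ (Fin (n + 1))) :
    weightedRotation n k (-φ) (weightedRotation n k φ z) = z := by
  refine ext_tail ?_ ?_
  · simp only [weightedRotation, cvec_zero, ← mul_assoc, ← Complex.exp_add]
    simp
  · simp only [weightedRotation, tail_cvec, smul_smul, ← Complex.exp_add]
    rw [show (k * ((-φ : ℝ) : ℂ) / 2 * Complex.I + k * φ / 2 * Complex.I) = 0 by push_cast; ring]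
    simp

theorem fibration_weightedRotation (φ : ℝ) (z : EuclideanSpace ℂ (Fin (n + 1))) :
    fibration n (weightedRotation n k φ z) = Complex.exp (φ * Complex.I) * fibration n z := by
  simp only [fibration, weightedRotation, cvec_zero, norm_mul, Complex.norm_exp_ofReal_mul_I,
    one_mul]
  ring

theorem contDiffAt_weightedRotation {φ : X → ℝ} {f : X → EuclideanSpace ℂ (Fin (n + 1))} {x : X}
    (hφ : ContDiffAt ℝ ∞ φ x) (hf : ContDiffAt ℝ ∞ f x) :
    ContDiffAt ℝ ∞ (fun y => weightedRotation n k (φ y) (f y)) x := by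
  have h1 (i : Fin (n + 1)) : ContDiffAt ℝ ∞ (fun y => f y i) x :=
    (contDiff_apply i).contDiffAt.comp x hf
  have h2 : ContDiffAt ℝ ∞ (fun y => (φ y : ℂ)) x :=
    Complex.ofRealCLM.contDiff.contDiffAt.comp x hφ
  have h3 (c : ℂ) : ContDiffAt ℝ ∞ (fun y => Complex.exp (c * φ y * Complex.I)) x :=
    ((contDiffAt_const.mul h2).mul contDiffAt_const).cexp
  refine contDiffAt_cvec ?_ fun j => ?_
  · simpa using (h3 1).mul (h1 0)
  · have := (h3 (k / 2)).mul (h1 j.succ)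
    refine this.congr_of_eventuallyEq (Eventually.of_forall fun y => ?_)
    change Complex.exp (k * φ y / 2 * Complex.I) * f y j.succ = _
    ring_nf

theorem contDiffAt_arg {w : ℂ} (hw : w ∈ Complex.slitPlane) : ContDiffAt ℝ ∞ Complex.arg w := by
  have : Complex.arg = fun z => (Complex.log z).im := funext fun z => (Complex.log_im z).symm
  rw [this]
  exact Complex.imCLM.contDiff.contDiffAt.comp w ((Complex.contDiffAt_log hw).restrict_scalars ℝ)

theorem exp_arg_of_norm_eq_one {w : ℂ} (hw : ‖w‖ = 1) :
    Complex.exp (Complex.arg w * Complex.I) = w := by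
  have := Complex.norm_mul_exp_arg_mul_I w
  rwa [hw, Complex.ofReal_one, one_mul] at this

/-- Rotating the page over s by the weighted angle arg(s̄w) gives the page over w. The angle is
smooth where s̄w avoids the negative axis, and rotating back is the inverse. -/
theorem fibration_locally_trivial {s : ℂ} (hs : s ∈ Metric.sphere (0 : ℂ) 1) :
    ∃ V : Set ℂ, IsOpen V ∧ s ∈ V ∧
      ∃ T : ℂ × EuclideanSpace ℂ (Fin (n + 1)) → EuclideanSpace ℂ (Fin (n + 1)),
        IsDiffeo T ((Metric.sphere 0 1 ∩ V) ×ˢ page (brieskorn n k) (binding n k) (fibration n) s)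
          ((brieskorn n k \ binding n k) ∩ fibration n ⁻¹' V) ∧
        ∀ w ∈ Metric.sphere (0 : ℂ) 1 ∩ V,
          ∀ x ∈ page (brieskorn n k) (binding n k) (fibration n) s, fibration n (T (w, x)) = w := by
  have hss := star_mul_self_of_mem_sphere hs
  have hs1 : ‖s‖ = 1 := by simpa using hs
  have hT : ∀ w, ‖w‖ = 1 → Complex.exp (Complex.arg (star s * w) * Complex.I) = star s * w :=
    fun w hw => exp_arg_of_norm_eq_one (by rw [norm_mul, norm_star, hs1, hw, one_mul])
  have hfib : ∀ w, ‖w‖ = 1 → ∀ x ∈ page (brieskorn n k) (binding n k) (fibration n) s,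
      fibration n (weightedRotation n k (Complex.arg (star s * w)) x) = w := fun w hw x hx => by
    rw [fibration_weightedRotation, hT w hw, hx.2]
    linear_combination w * hss
  have hne : ∀ {z : EuclideanSpace ℂ (Fin (n + 1))} (φ : ℝ), z ∈ brieskorn n k \ binding n k →
      weightedRotation n k φ z ∈ brieskorn n k \ binding n k := fun φ hz => by
    rw [mem_brieskorn_diff_binding] at hz ⊢
    exact ⟨weightedRotation_mem hz.1, by simp [weightedRotation, hz.2]⟩
  refine ⟨{w | star s * w ∈ Complex.slitPlane},
    Complex.isOpen_slitPlane.preimage (continuous_const.mul continuous_id), ?_,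
    fun y => weightedRotation n k (Complex.arg (star s * y.1)) y.2, ⟨?_, ?_, ?_⟩, ?_⟩
  · change star s * s ∈ Complex.slitPlane
    rw [hss]; exact Complex.one_mem_slitPlane
  · rintro ⟨w, x⟩ ⟨⟨-, hw⟩, -⟩
    refine (contDiffAt_weightedRotation ?_ contDiffAt_snd).contDiffWithinAt
    exact (contDiffAt_arg hw).comp (w, x) (contDiffAt_const.mul contDiffAt_fst)
  · rintro ⟨w, x⟩ ⟨⟨hw1, hw⟩, hx⟩
    have hw1' : ‖w‖ = 1 := by simpa using hw1
    refine ⟨hne _ hx.1, ?_⟩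
    rw [mem_preimage, hfib w hw1' x hx]
    exact hw
  · refine ⟨fun z => (fibration n z,
      weightedRotation n k (-Complex.arg (star s * fibration n z)) z), ?_, ?_, ?_, ?_⟩
    · rintro z ⟨hz, hzV⟩
      have hf := contDiffAt_fibration (mem_brieskorn_diff_binding.1 hz).2
      refine (hf.prodMk (contDiffAt_weightedRotation ?_ contDiffAt_id)).contDiffWithinAt
      exact ((contDiffAt_arg hzV).comp z (contDiffAt_const.mul hf)).neg
    · rintro z ⟨hz, hzV⟩
      have h1 := norm_fibration (mem_brieskorn_diff_binding.1 hz).2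
      refine ⟨⟨by simpa using h1, hzV⟩, hne _ hz, ?_⟩
      simp only
      rw [fibration_weightedRotation, Complex.ofReal_neg, neg_mul, Complex.exp_neg, hT _ h1]
      have h2 : fibration n z ≠ 0 := fun h => by simp [h] at h1
      have h3 : star s ≠ 0 := fun h => by simp [h] at hss
      field_simp
      linear_combination -hss
    · rintro ⟨w, x⟩ ⟨⟨hw1, hw⟩, hx⟩
      have hw1' : ‖w‖ = 1 := by simpa using hw1
      simp only
      rw [hfib w hw1' x hx, weightedRotation_neg_apply]
    · rintro z ⟨hz, hzV⟩
      simpa using weightedRotation_neg_apply (k := k) (-Complex.arg (star s * fibration n z)) z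
  · rintro w ⟨hw1, -⟩ x hx
    exact hfib w (by simpa using hw1) x hx

end OpenBook

/-! ### The product neighbourhood of the binding. -/

section Tube

variable {n k : ℕ} {X : Type*} [NormedAddCommGroup X] [NormedSpace ℝ X]

/-- The discriminant of the quadratic equation for the square of `tubeScale`. -/
def tubeDisc (k : ℕ) (w : ℂ) : ℝ := (1 - Complex.normSq w / 2) ^ 2 - Complex.normSq w ^ k / 4

/-- The positive number `λ` with `λ² + |μ|² = 1 - |w|² / 2` and `λ² - |μ|² > 0`, where
`4 λ μ = - wᵏ`. -/
def tubeScale (k : ℕ) (w : ℂ) : ℝ := √(((1 - Complex.normSq w / 2) + √(tubeDisc k w)) / 2)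

/-- The complex number `μ` with `4 λ μ = - wᵏ`. -/
def tubeShift (k : ℕ) (w : ℂ) : ℂ := -w ^ k / (4 * tubeScale k w)

theorem tubeDisc_pos {w : ℂ} (hw : ‖w‖ < 1) : 0 < tubeDisc k w := by
  have h1 : Complex.normSq w < 1 := by
    rw [Complex.normSq_eq_norm_sq]; nlinarith [norm_nonneg w]
  have h0 := Complex.normSq_nonneg w
  have h2 : Complex.normSq w ^ k ≤ 1 := pow_le_one₀ h0 h1.le
  unfold tubeDisc
  nlinarith

theorem tubeScale_arg_pos {w : ℂ} (hw : ‖w‖ < 1) :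
    0 < ((1 - Complex.normSq w / 2) + √(tubeDisc k w)) / 2 := by
  have h1 : Complex.normSq w < 1 := by
    rw [Complex.normSq_eq_norm_sq]; nlinarith [norm_nonneg w]
  have := Real.sqrt_nonneg (tubeDisc k w)
  linarith

theorem tubeScale_pos {w : ℂ} (hw : ‖w‖ < 1) : 0 < tubeScale k w :=
  Real.sqrt_pos.2 (tubeScale_arg_pos hw)

theorem tubeScale_mul_tubeShift {w : ℂ} (hw : ‖w‖ < 1) :
    4 * (tubeScale k w : ℂ) * tubeShift k w = -w ^ k := by
  have : (tubeScale k w : ℂ) ≠ 0 := by exact_mod_cast (tubeScale_pos hw).ne'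
  rw [tubeShift]
  field_simp

theorem tubeScale_sq {w : ℂ} (hw : ‖w‖ < 1) :
    tubeScale k w ^ 2 = ((1 - Complex.normSq w / 2) + √(tubeDisc k w)) / 2 :=
  Real.sq_sqrt (tubeScale_arg_pos hw).le

/-- λ² and |μ|² have sum 1 - |w|²/2 and product |w|^(2k)/16, so they are the two roots of a
quadratic with discriminant `tubeDisc k w`. `tubeScale` takes the larger root. -/
theorem normSq_tubeShift {w : ℂ} (hw : ‖w‖ < 1) :
    Complex.normSq (tubeShift k w) = ((1 - Complex.normSq w / 2) - √(tubeDisc k w)) / 2 := by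
  have h1 := congrArg Complex.normSq (tubeScale_mul_tubeShift (k := k) hw)
  rw [map_mul, map_mul, Complex.normSq_ofReal, Complex.normSq_neg, map_pow, ← sq,
    tubeScale_sq hw] at h1
  have h2 : Complex.normSq 4 = 16 := by
    rw [Complex.normSq_ofNat]; norm_num
  have h3 := Real.sq_sqrt (tubeDisc_pos (k := k) hw).le
  have h4 : √(tubeDisc k w) ^ 2 =
    (1 - Complex.normSq w / 2) ^ 2 - Complex.normSq w ^ k / 4 := h3
  have h5 := tubeScale_arg_pos (k := k) hw
  rw [h2] at h1
  apply mul_left_cancel₀ h5.ne'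
  linear_combination h1 / 16 + h4 / 4

theorem tubeShift_mul_star {w : ℂ} (hw : ‖w‖ < 1) :
    (tubeScale k w : ℂ) ^ 2 - tubeShift k w * star (tubeShift k w) = (√(tubeDisc k w) : ℝ) ∧
    (tubeScale k w : ℂ) ^ 2 + tubeShift k w * star (tubeShift k w) =
      (1 - Complex.normSq w / 2 : ℝ) := by
  rw [Complex.star_def, Complex.mul_conj, normSq_tubeShift (k := k) hw, ← Complex.ofReal_pow,
    tubeScale_sq hw, ← Complex.ofReal_sub, ← Complex.ofReal_add]
  constructor <;> congr 1 <;> ring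

theorem contDiffAt_normSq {w : ℂ} : ContDiffAt ℝ ∞ (fun w : ℂ => Complex.normSq w) w := by
  simp only [Complex.normSq_apply]
  have h1 : ContDiff ℝ ∞ Complex.re := Complex.reCLM.contDiff
  have h2 : ContDiff ℝ ∞ Complex.im := Complex.imCLM.contDiff
  fun_prop

theorem contDiffAt_tubeDisc {w : ℂ} : ContDiffAt ℝ ∞ (tubeDisc k) w :=
  ((contDiffAt_const.sub (contDiffAt_normSq.div_const 2)).pow 2).sub
    ((contDiffAt_normSq.pow k).div_const 4)

theorem contDiffAt_sqrt_tubeDisc {w : ℂ} (hw : ‖w‖ < 1) :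
    ContDiffAt ℝ ∞ (fun w => √(tubeDisc k w)) w :=
  contDiffAt_tubeDisc.sqrt (tubeDisc_pos (k := k) hw).ne'

theorem contDiffAt_tubeScale {w : ℂ} (hw : ‖w‖ < 1) :
    ContDiffAt ℝ ∞ (fun w => (tubeScale k w : ℂ)) w :=
  Complex.ofRealCLM.contDiff.contDiffAt.comp w
    ((((contDiffAt_const.sub (contDiffAt_normSq.div_const 2)).add
      (contDiffAt_sqrt_tubeDisc (k := k) hw)).div_const 2).sqrt (tubeScale_arg_pos hw).ne')

theorem contDiffAt_tubeShift {w : ℂ} (hw : ‖w‖ < 1) :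
    ContDiffAt ℝ ∞ (tubeShift k) w := by
  have h1 : ContDiffAt ℝ ∞ (fun w : ℂ => -w ^ k) w := (contDiffAt_id.pow k).neg
  have h2 := contDiffAt_const (c := (4 : ℂ)).mul (contDiffAt_tubeScale (k := k) hw)
  have h3 : (tubeScale k w : ℂ) ≠ 0 := by exact_mod_cast (tubeScale_pos hw).ne'
  exact h1.mul (h2.inv (mul_ne_zero (by norm_num) h3))

theorem dotProduct_self_comb (a c : ℂ) (t : Fin n → ℂ) :
    (a • t + c • star t) ⬝ᵥ (a • t + c • star t) =
      a ^ 2 * (t ⬝ᵥ t) + 2 * a * c * (star t ⬝ᵥ t) + c ^ 2 * star (t ⬝ᵥ t) := by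
  simp only [add_dotProduct, dotProduct_add, smul_dotProduct, dotProduct_smul, smul_eq_mul,
    Matrix.star_dotProduct_star, dotProduct_comm t (star t)]
  ring

theorem star_dotProduct_self_comb (a c : ℂ) (t : Fin n → ℂ) :
    star (a • t + c • star t) ⬝ᵥ (a • t + c • star t) =
      (star a * a + star c * c) * (star t ⬝ᵥ t) + star a * c * star (t ⬝ᵥ t) +
        star c * a * (t ⬝ᵥ t) := by
  simp only [star_add, star_smul, star_star, add_dotProduct, dotProduct_add, smul_dotProduct,
    dotProduct_smul, smul_eq_mul, Matrix.star_dotProduct_star, dotProduct_comm t (star t)]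
  ring

/-- On B one has u·u = 0 and |u|² = 2. Then λu + μū has square 4λμ = -w^k and squared norm 2(λ² +
|μ|²) = 2 - |w|². -/
theorem tube_mem (hk : 1 ≤ k) {b : EuclideanSpace ℂ (Fin (n + 1))} (hb : b ∈ binding n k) {w : ℂ}
    (hw : ‖w‖ < 1) : cvec w ((tubeScale k w : ℂ) • tail b + tubeShift k w • star (tail b)) ∈
      brieskorn n k := by
  obtain ⟨h1, h2⟩ := mem_brieskorn.1 hb.1
  rw [hb.2] at h1 h2
  have hq : tail b ⬝ᵥ tail b = 0 := by simpa [show k ≠ 0 by omega] using h1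
  have hN : star (tail b) ⬝ᵥ tail b = 2 := by
    rw [star_dotProduct_self_eq]
    have : (star (tail b) ⬝ᵥ tail b).re = 2 := by simpa using h2
    rw [this]; norm_num
  obtain ⟨-, h3⟩ := tubeShift_mul_star (k := k) hw
  have h4 := tubeScale_mul_tubeShift (k := k) hw
  rw [mem_brieskorn, cvec_zero, tail_cvec, dotProduct_self_comb, star_dotProduct_self_comb, hq, hN]
  constructor
  · simp only [star_zero]
    linear_combination h4
  · have h5 : (star (tubeScale k w : ℂ) * tubeScale k w +
        star (tubeShift k w) * tubeShift k w) * 2 + star (tubeScale k w : ℂ) * tubeShift k w * star 0 +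
        star (tubeShift k w) * tubeScale k w * 0 = ((2 - Complex.normSq w : ℝ) : ℂ) := by
      rw [Complex.star_def, Complex.conj_ofReal, ← Complex.star_def]
      push_cast at h3 ⊢
      simp only [star_zero]
      linear_combination 2 * h3
    rw [h5, Complex.ofReal_re]
    ring

/-- The real linear map u ↦ λu + μū is inverted by u ↦ (λu - μū)/(λ² - |μ|²), whose denominator is
the root of the discriminant. -/
theorem tube_symm_mem (hk : 1 ≤ k) {z : EuclideanSpace ℂ (Fin (n + 1))} (hz : z ∈ brieskorn n k)
    (hw : ‖z 0‖ < 1) : cvec 0 ((√(tubeDisc k (z 0)) : ℂ)⁻¹ • ((tubeScale k (z 0) : ℂ) • tail z +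
      (-tubeShift k (z 0)) • star (tail z))) ∈ binding n k := by
  obtain ⟨h1, h2⟩ := mem_brieskorn.1 hz
  obtain ⟨h5, h3⟩ := tubeShift_mul_star (k := k) hw
  have h4 := tubeScale_mul_tubeShift (k := k) hw
  have hD := Real.sqrt_pos.2 (tubeDisc_pos (k := k) hw)
  have hD' : (√(tubeDisc k (z 0)) : ℂ) ≠ 0 := by exact_mod_cast hD.ne'
  set l : ℂ := (tubeScale k (z 0) : ℂ) with hl
  set m : ℂ := tubeShift k (z 0) with hm
  set D : ℂ := (√(tubeDisc k (z 0)) : ℂ) with hDdef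
  have hls : star l = l := by rw [hl, Complex.star_def, Complex.conj_ofReal]
  have hDs : star D = D := by rw [hDdef, Complex.star_def, Complex.conj_ofReal]
  have hq : tail z ⬝ᵥ tail z = 4 * l * m := by linear_combination h1 - h4
  have hqs : star (tail z ⬝ᵥ tail z) = 4 * l * star m := by
    rw [hq, star_mul', star_mul', hls]; simp
  have hN : star (tail z) ⬝ᵥ tail z = 2 * (l ^ 2 + m * star m) := by
    rw [h3, star_dotProduct_self_eq]
    have : (star (tail z) ⬝ᵥ tail z).re = 2 * (1 - Complex.normSq (z 0) / 2) := by
      linarith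
    rw [this]; push_cast; ring
  refine ⟨mem_brieskorn.2 ⟨?_, ?_⟩, cvec_zero _ _⟩
  · rw [cvec_zero, tail_cvec, smul_dotProduct, dotProduct_smul, dotProduct_self_comb, hqs, hq, hN,
      zero_pow (by omega)]
    simp only [smul_eq_mul]
    ring
  · have h6 : star (D⁻¹ • (l • tail z + (-m) • star (tail z))) ⬝ᵥ
        (D⁻¹ • (l • tail z + (-m) • star (tail z))) = 2 := by
      rw [star_smul, smul_dotProduct, dotProduct_smul, star_dotProduct_self_comb, hqs, hq, hN,
        star_inv₀, hDs, star_neg, hls]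
      simp only [smul_eq_mul]
      field_simp
      rw [← h5]
      ring
    rw [cvec_zero, tail_cvec, h6]
    simp

theorem exists_tube (hk : 1 ≤ k) :
    ∃ U : Set (EuclideanSpace ℂ (Fin (n + 1))), IsOpen U ∧
      ∃ T : EuclideanSpace ℂ (Fin (n + 1)) × ℂ → EuclideanSpace ℂ (Fin (n + 1)),
        IsDiffeo T (binding n k ×ˢ Metric.ball 0 1) (brieskorn n k ∩ U) ∧
        (∀ b ∈ binding n k, T (b, 0) = b) ∧
        ∀ b ∈ binding n k, ∀ w ∈ Metric.ball (0 : ℂ) 1, w ≠ 0 →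
          fibration n (T (b, w)) = w / (‖w‖ : ℂ) := by
  have hstar {x : EuclideanSpace ℂ (Fin (n + 1)) × ℂ} (j : Fin n) :
      ContDiffAt ℝ ∞ (fun x : EuclideanSpace ℂ (Fin (n + 1)) × ℂ => star (x.1 j.succ)) x :=
    Complex.conjCLE.contDiff.contDiffAt.comp x
      ((contDiff_apply j.succ).contDiffAt.comp x contDiffAt_fst)
  refine ⟨{z | ‖z 0‖ < 1},
    isOpen_lt (contDiff_apply 0).continuous.norm continuous_const,
    fun y => cvec y.2 ((tubeScale k y.2 : ℂ) • tail y.1 + tubeShift k y.2 • star (tail y.1)),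
    ⟨?_, ?_, ?_⟩, ?_, ?_⟩
  · rintro ⟨b, w⟩ ⟨-, hw⟩
    have hw : ‖w‖ < 1 := by simpa using hw
    refine (contDiffAt_cvec contDiffAt_snd fun j => ?_).contDiffWithinAt
    have h1 := (contDiffAt_tubeScale (k := k) hw).comp (b, w) contDiffAt_snd
    have h2 := (contDiffAt_tubeShift (k := k) hw).comp (b, w) contDiffAt_snd
    have h3 := (contDiff_apply j.succ).contDiffAt.comp (b, w) contDiffAt_fst
    exact (h1.mul h3).add (h2.mul (hstar j))
  · rintro ⟨b, w⟩ ⟨hb, hw⟩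
    have hw : ‖w‖ < 1 := by simpa using hw
    exact ⟨tube_mem hk hb hw, by simpa using hw⟩
  · refine ⟨fun z => (cvec 0 ((√(tubeDisc k (z 0)) : ℂ)⁻¹ • ((tubeScale k (z 0) : ℂ) • tail z +
      (-tubeShift k (z 0)) • star (tail z))), z 0), ?_, ?_, ?_, ?_⟩
    · rintro z ⟨-, hw⟩
      have hw : ‖z 0‖ < 1 := hw
      have h0 := fun i => (contDiff_apply (n := n) i).contDiffAt (x := z)
      have hstar' (j : Fin n) : ContDiffAt ℝ ∞
          (fun x : EuclideanSpace ℂ (Fin (n + 1)) => star (x j.succ)) z :=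
        Complex.conjCLE.contDiff.contDiffAt.comp z (h0 j.succ)
      have h1 := (contDiffAt_tubeScale (k := k) hw).comp z (h0 0)
      have h2 := (contDiffAt_tubeShift (k := k) hw).comp z (h0 0)
      have h3 : ContDiffAt ℝ ∞
          (fun x : EuclideanSpace ℂ (Fin (n + 1)) => (√(tubeDisc k (x 0)) : ℂ)) z :=
        Complex.ofRealCLM.contDiff.contDiffAt.comp z
          (ContDiffAt.comp (g := fun w => √(tubeDisc k w)) z (contDiffAt_sqrt_tubeDisc (k := k) hw) (h0 0))
      have hD' : (√(tubeDisc k (z 0)) : ℂ) ≠ 0 := by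
        exact_mod_cast (Real.sqrt_pos.2 (tubeDisc_pos (k := k) hw)).ne'
      refine (ContDiffAt.prodMk (contDiffAt_cvec contDiffAt_const fun j => ?_)
        (h0 0)).contDiffWithinAt
      exact (h3.inv hD').mul ((h1.mul (h0 j.succ)).add (h2.neg.mul (hstar' j)))
    · rintro z ⟨hz, hw⟩
      exact ⟨tube_symm_mem hk hz hw, by simpa using hw⟩
    · rintro ⟨b, w⟩ ⟨hb, hw⟩
      have hw : ‖w‖ < 1 := by simpa using hw
      have hD' : (√(tubeDisc k w) : ℂ) ≠ 0 := by
        exact_mod_cast (Real.sqrt_pos.2 (tubeDisc_pos (k := k) hw)).ne'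
      have h5 := (tubeShift_mul_star (k := k) hw).1
      refine Prod.ext (ext_tail hb.2.symm ?_) rfl
      ext j
      simp only [tail_cvec, cvec_zero, Pi.smul_apply, Pi.add_apply, Pi.star_apply, smul_eq_mul,
        star_add, star_mul', Complex.star_def, Complex.conj_ofReal, Complex.conj_conj] at h5 ⊢
      field_simp
      linear_combination (tail b j) * h5
    · rintro z ⟨-, hw⟩
      have hw : ‖z 0‖ < 1 := hw
      have hD' : (√(tubeDisc k (z 0)) : ℂ) ≠ 0 := by
        exact_mod_cast (Real.sqrt_pos.2 (tubeDisc_pos (k := k) hw)).ne'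
      have h5 := (tubeShift_mul_star (k := k) hw).1
      refine ext_tail rfl ?_
      ext j
      simp only [tail_cvec, Pi.smul_apply, Pi.add_apply, Pi.star_apply, smul_eq_mul,
        star_add, star_mul', star_neg, star_inv₀, Complex.star_def, Complex.conj_ofReal,
        Complex.conj_conj] at h5 ⊢
      field_simp
      linear_combination (tail z j) * h5
  · intro b hb
    have h1 : tubeScale k 0 = 1 := by
      simp [tubeScale, tubeDisc, show k ≠ 0 by omega]
    refine ext_tail (by simpa using hb.2.symm) ?_
    simp [h1, tubeShift, show k ≠ 0 by omega]
  · intro b hb w hw hw0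
    simp [fibration]

theorem isOpenBook_brieskorn (hn : 2 ≤ n) (hk : 1 ≤ k) :
    IsOpenBook (2 * n - 3) (brieskorn n k) (binding n k) (fibration n) where
  compact := isCompact_brieskorn
  submanifold := isSmoothSubmanifold_brieskorn (by omega) hk
  binding_subset _ hz := hz.1
  binding_compact := isCompact_binding
  binding_submanifold := isSmoothSubmanifold_binding (by omega) hk
  smooth _ hz := (contDiffAt_fibration (mem_brieskorn_diff_binding.1 hz).2).contDiffWithinAt
  mapsTo _ hz := by simpa using norm_fibration (mem_brieskorn_diff_binding.1 hz).2
  page_submanifold _ hs := isSmoothSubmanifold_page (by omega) hk hs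
  locally_trivial _ hs := fibration_locally_trivial hs
  tube := exists_tube hk

end Tube

/-! ### The binding as a Brieskorn manifold of lower dimension. -/

section BindingContactomorphism

variable {n k : ℕ}

/-- The projection `(z₀, z₁, …, zₙ) ↦ (z₁, …, zₙ)`, as a map to `ℂᵐ⁺¹` with `n = m + 1`. -/
def dropFirst (m : ℕ) : EuclideanSpace ℂ (Fin (m + 1 + 1)) →L[ℝ] EuclideanSpace ℂ (Fin (m + 1)) :=
  LinearMap.toContinuousLinearMap
    { toFun := fun z => WithLp.toLp 2 (tail z)
      map_add' := fun _ _ => rfl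
      map_smul' := fun _ _ => rfl }

/-- The inclusion `(z₁, …, zₙ) ↦ (0, z₁, …, zₙ)`. -/
def consZero (m : ℕ) : EuclideanSpace ℂ (Fin (m + 1)) →L[ℝ] EuclideanSpace ℂ (Fin (m + 1 + 1)) :=
  LinearMap.toContinuousLinearMap
    { toFun := fun z => cvec 0 z
      map_add' := fun _ _ => ext_tail (by simp) rfl
      map_smul' := fun _ _ => ext_tail (by simp) rfl }

theorem dotProduct_eq_tail {m : ℕ} (u v : Fin (m + 1) → ℂ) :
    u ⬝ᵥ v = u 0 * v 0 + (fun j : Fin m => u j.succ) ⬝ᵥ fun j => v j.succ := by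
  simp [dotProduct, Fin.sum_univ_succ]

theorem mem_binding_iff_dropFirst (hk : 1 ≤ k) {m : ℕ} {z : EuclideanSpace ℂ (Fin (m + 1 + 1))} :
    z ∈ binding (m + 1) k ↔ z 0 = 0 ∧ dropFirst m z ∈ brieskorn m 2 := by
  have h1 : tail z ⬝ᵥ tail z =
      dropFirst m z 0 ^ 2 + tail (dropFirst m z) ⬝ᵥ tail (dropFirst m z) := by
    rw [dotProduct_eq_tail, sq]; rfl
  have h2 : star (tail z) ⬝ᵥ tail z = star (dropFirst m z 0) * dropFirst m z 0 +
      star (tail (dropFirst m z)) ⬝ᵥ tail (dropFirst m z) := by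
    rw [dotProduct_eq_tail]; rfl
  have h3 : (star (dropFirst m z 0) * dropFirst m z 0).re = Complex.normSq (dropFirst m z 0) := by
    simp [Complex.normSq_apply]
  rw [mem_binding, mem_brieskorn, mem_brieskorn, h1, h2, Complex.add_re, h3]
  constructor
  · rintro ⟨⟨h, h'⟩, h0⟩
    rw [h0] at h h'
    refine ⟨h0, by simpa [show k ≠ 0 by omega] using h, by simpa using h'⟩
  · rintro ⟨h0, h, h'⟩
    rw [h0]
    exact ⟨⟨by simpa [show k ≠ 0 by omega] using h, by simpa using h'⟩, rfl⟩

/-- Forgetting z₀ = 0 leaves a sum of squares. For exponent 2 the weight of the first coordinate is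
2 like all others, so the forms correspond exactly, with conformal factor 1. -/
theorem binding_contactomorphic (hn : 2 ≤ n) (hk : 1 ≤ k) :
    ∃ b : EuclideanSpace ℂ (Fin (n + 1)) → EuclideanSpace ℂ (Fin (n - 1 + 1)),
      IsContactomorphism b (binding n k) (brieskornForm n k)
        (brieskorn (n - 1) 2) (brieskornForm (n - 1) 2) := by
  obtain ⟨m, rfl⟩ : ∃ m, n = m + 1 := ⟨n - 1, by omega⟩
  change ∃ b : EuclideanSpace ℂ (Fin (m + 1 + 1)) → EuclideanSpace ℂ (Fin (m + 1)),
    IsContactomorphism b (binding (m + 1) k) (brieskornForm (m + 1) k)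
      (brieskorn m 2) (brieskornForm m 2)
  refine ⟨dropFirst m, ⟨(dropFirst m).contDiff.contDiffOn,
    fun z hz => ((mem_binding_iff_dropFirst hk).1 hz).2, consZero m,
    (consZero m).contDiff.contDiffOn, fun z hz => (mem_binding_iff_dropFirst hk).2 ⟨rfl, hz⟩,
    fun z hz => ext_tail hz.2.symm rfl, fun z _ => rfl⟩, fun _ => 1, fun z hz => ⟨one_pos, ?_⟩⟩
  intro v hv
  rw [fderivWithin_apply_of_mem_tangentAt (dropFirst m).hasFDerivAt.hasFDerivWithinAt hv,
    brieskornForm_apply, brieskornForm_apply, ((mem_tangentAt_binding hk hz).1 hv).2.2,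
    dotProduct_eq_tail (star (tail z))]
  simp only [mul_zero, Complex.zero_im, zero_add, one_mul, Complex.add_im, mul_add]
  push_cast
  rfl

end BindingContactomorphism

/-! ### Smooth inverses, and smooth functions of the norm. -/

section OneVariable

/-- A left inverse of a function with nonvanishing derivative is smooth. -/
theorem contDiffAt_leftInverse {f g : ℝ → ℝ} {O : Set ℝ} {f' x : ℝ} (hO : O ∈ 𝓝 x)
    (hg : LeftInvOn g f O) (hf : ContDiffAt ℝ ∞ f x) (hd : HasDerivAt f f' x) (h0 : f' ≠ 0) :
    ContDiffAt ℝ ∞ g (f x) := by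
  have hfe : HasFDerivAt f
      (ContinuousLinearEquiv.unitsEquivAut ℝ (Units.mk0 f' h0) : ℝ →L[ℝ] ℝ) x := hd
  have hn : (∞ : WithTop ℕ∞) ≠ 0 := by simp
  have hs := hf.hasStrictFDerivAt' hfe hn
  have h1 := hf.to_localInverse hfe hn
  -- Near f x the given left inverse coincides with the local inverse of the inverse function
  -- theorem.
  refine h1.congr_of_eventuallyEq ?_
  have h2 := hs.eventually_right_inverse
  have h3 : ∀ᶠ y in 𝓝 (f x), hs.localInverse f _ x y ∈ O := by
    have h4 := hs.localInverse_continuousAt.tendsto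
    rw [hs.localInverse_apply_image] at h4
    exact h4 hO
  filter_upwards [h2, h3] with y hy1 hy2
  have := hg hy2
  rw [hy1] at this
  exact this

/-- A function which is smooth, and constant on a neighbourhood of the origin, is smooth as a
function of the norm. -/
theorem contDiffAt_comp_norm {V G : Type*} [NormedAddCommGroup V] [InnerProductSpace ℝ V]
    [NormedAddCommGroup G] [NormedSpace ℝ G] {φ : ℝ → G} {a : ℝ} (ha : 0 < a) {c : G}
    (hc : ∀ r ≤ a, φ r = c) {p : V} (hφ : ContDiffAt ℝ ∞ φ ‖p‖) :
    ContDiffAt ℝ ∞ (fun p : V => φ ‖p‖) p := by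
  by_cases hp : p = 0
  · have : (fun p : V => φ ‖p‖) =ᶠ[𝓝 p] fun _ => c := by
      have h : ∀ᶠ q : V in 𝓝 p, ‖q‖ < a :=
        continuous_norm.continuousAt.eventually_lt continuousAt_const (by simpa [hp] using ha)
      filter_upwards [h] with q hq using hc _ hq.le
    exact contDiffAt_const.congr_of_eventuallyEq this
  · exact ContDiffAt.comp (g := φ) p hφ (contDiffAt_id.norm ℝ hp)

end OneVariable

/-! ### Twist profiles and the rescaling of the covector norm. -/

section Profile

variable {k : ℕ} {f : ℝ → ℝ}

/-- The function `1 + ∫₀ʳ f`, which is `h + r f` for `h = twistPrimitive f`. -/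
def twistPotential (f : ℝ → ℝ) (r : ℝ) : ℝ := 1 + ∫ s in (0 : ℝ)..r, f s

theorem IsTwistProfile.hasDerivAt_potential (h : IsTwistProfile k f) (r : ℝ) :
    HasDerivAt (twistPotential f) (f r) r :=
  (intervalIntegral.integral_hasDerivAt_right (h.smooth.continuous.intervalIntegrable _ _)
    (h.smooth.continuous.stronglyMeasurableAtFilter _ _) h.smooth.continuous.continuousAt).const_add 1

theorem IsTwistProfile.contDiff_potential (h : IsTwistProfile k f) :
    ContDiff ℝ ∞ (twistPotential f) := by
  rw [contDiff_infty_iff_deriv]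
  refine ⟨fun r => (h.hasDerivAt_potential r).differentiableAt, ?_⟩
  rw [funext fun r => (h.hasDerivAt_potential r).deriv]
  exact h.smooth

/-- Integration by parts of ∫ s f'(s) ds. -/
theorem IsTwistProfile.potential_eq (h : IsTwistProfile k f) (r : ℝ) :
    twistPotential f r = twistPrimitive f r + r * f r := by
  have hf' : Continuous (deriv f) := h.smooth.continuous_deriv (by simp)
  have hd (s : ℝ) : HasDerivAt f (deriv f s) s :=
    (h.smooth.differentiable (by simp) s).hasDerivAt
  have := intervalIntegral.integral_mul_deriv_eq_deriv_mul (a := 0) (b := r) (u := fun s => s)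
    (u' := fun _ => 1) (v := f) (fun s _ => hasDerivAt_id s) (fun s _ => hd s)
    (continuous_const.intervalIntegrable _ _) (hf'.intervalIntegrable _ _)
  simp only [one_mul, zero_mul, sub_zero] at this
  rw [twistPotential, twistPrimitive, this]
  ring

theorem IsTwistProfile.nonneg (h : IsTwistProfile k f) (r : ℝ) : 0 ≤ f r := by
  obtain ⟨a, -, ha⟩ := h.near_zero
  have := h.mono (min_le_right a r)
  rwa [ha _ (min_le_left a r)] at this

theorem potential_eq_one {a : ℝ} (ha : 0 < a) (hfa : ∀ r ≤ a, f r = 0) {r : ℝ} (hr : r ≤ a) :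
    twistPotential f r = 1 := by
  have : ∫ s in (0 : ℝ)..r, f s = ∫ s in (0 : ℝ)..r, (0 : ℝ) :=
    intervalIntegral.integral_congr fun s hs => hfa s (hs.2.trans (sup_le ha.le hr))
  rw [twistPotential, this]
  simp

theorem IsTwistProfile.potential_pos (h : IsTwistProfile k f) (r : ℝ) :
    0 < twistPotential f r := by
  rcases le_total 0 r with hr | hr
  · have := intervalIntegral.integral_nonneg (μ := MeasureTheory.volume) hr
      fun s _ => h.nonneg s
    unfold twistPotential
    linarith
  · obtain ⟨a, ha, hfa⟩ := h.near_zero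
    rw [potential_eq_one ha hfa (hr.trans ha.le)]
    exact one_pos

/-- The function `r / (1 + ∫₀ʳ f)`. -/
def twistScale (f : ℝ → ℝ) (r : ℝ) : ℝ := r / twistPotential f r

theorem IsTwistProfile.primitive_pos' (h : IsTwistProfile k f) (r : ℝ) :
    0 < twistPrimitive f r := by
  rcases le_total 0 r with hr | hr
  · exact h.primitive_pos r hr
  · obtain ⟨a, ha, hfa⟩ := h.near_zero
    have := h.potential_eq r
    rw [potential_eq_one ha hfa (hr.trans ha.le), hfa r (hr.trans ha.le)] at this
    linarith

/-- The quotient rule has numerator Φ - r f, which is h. So positivity of h is exactly what makes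
the rescaling strictly increasing. -/
theorem IsTwistProfile.hasDerivAt_scale (h : IsTwistProfile k f) (r : ℝ) :
    HasDerivAt (twistScale f) (twistPrimitive f r / twistPotential f r ^ 2) r := by
  refine ((hasDerivAt_id r).div (h.hasDerivAt_potential r) (h.potential_pos r).ne').congr_deriv ?_
  simp only [id, one_mul]
  congr 1
  linarith [h.potential_eq r]

theorem IsTwistProfile.scale_deriv_pos (h : IsTwistProfile k f) (r : ℝ) :
    0 < twistPrimitive f r / twistPotential f r ^ 2 :=
  div_pos (h.primitive_pos' r) (pow_pos (h.potential_pos r) 2)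

theorem IsTwistProfile.strictMono_scale (h : IsTwistProfile k f) : StrictMono (twistScale f) :=
  strictMono_of_deriv_pos fun r => by
    rw [(h.hasDerivAt_scale r).deriv]; exact h.scale_deriv_pos r

theorem IsTwistProfile.contDiff_scale (h : IsTwistProfile k f) : ContDiff ℝ ∞ (twistScale f) :=
  contDiff_id.div h.contDiff_potential fun r => (h.potential_pos r).ne'

/-- The inverse function of `twistScale f`. -/
def twistScaleInv (f : ℝ → ℝ) : ℝ → ℝ := Function.invFun (twistScale f)

theorem IsTwistProfile.scaleInv_scale (h : IsTwistProfile k f) (r : ℝ) :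
    twistScaleInv f (twistScale f r) = r :=
  Function.leftInverse_invFun h.strictMono_scale.injective r

theorem IsTwistProfile.contDiffAt_scaleInv (h : IsTwistProfile k f) (r : ℝ) :
    ContDiffAt ℝ ∞ (twistScaleInv f) (twistScale f r) :=
  contDiffAt_leftInverse univ_mem (fun s _ => h.scaleInv_scale s) h.contDiff_scale.contDiffAt
    (h.hasDerivAt_scale r) (h.scale_deriv_pos r).ne'

theorem IsTwistProfile.exists_potential_eq (h : IsTwistProfile k f) :
    ∃ b c : ℝ, 0 < c ∧ ∀ r ≥ b, twistPotential f r = c + Real.pi * k * r := by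
  obtain ⟨b, hb⟩ := h.near_infinity
  refine ⟨b, twistPrimitive f b, h.primitive_pos' b, fun r hr => ?_⟩
  have h1 : ∫ s in b..r, f s = ∫ s in b..r, Real.pi * k :=
    intervalIntegral.integral_congr fun s hs => hb s (by
      rw [uIcc_of_le hr] at hs; exact hs.1)
  have h2 := intervalIntegral.integral_add_adjacent_intervals (μ := MeasureTheory.volume)
    (h.smooth.continuous.intervalIntegrable 0 b) (h.smooth.continuous.intervalIntegrable b r)
  have h3 := h.potential_eq b
  rw [hb b le_rfl] at h3
  rw [h1, intervalIntegral.integral_const, smul_eq_mul] at h2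
  unfold twistPotential at h3 ⊢
  linarith

theorem IsTwistProfile.scale_lt (h : IsTwistProfile k f) (r : ℝ) :
    Real.pi * k * twistScale f r < 1 := by
  obtain ⟨b, c, hc, hb⟩ := h.exists_potential_eq
  have h1 : twistScale f r ≤ twistScale f (max b r) :=
    h.strictMono_scale.monotone (le_max_right _ _)
  have h2 : Real.pi * k * twistScale f (max b r) < 1 := by
    rw [twistScale, ← mul_div_assoc, div_lt_one (h.potential_pos _), hb _ (le_max_left _ _)]
    linarith
  exact (mul_le_mul_of_nonneg_left h1 (by positivity)).trans_lt h2

/-- For large r, Φ is c + πkr with c > 0, so r/Φ(r) comes arbitrarily close to 1/(πk) from below;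
then the intermediate value theorem applies. -/
theorem IsTwistProfile.exists_scale_eq (h : IsTwistProfile k f) {y : ℝ} (h0 : 0 ≤ y)
    (hy : Real.pi * k * y < 1) : ∃ r ≥ 0, twistScale f r = y := by
  obtain ⟨b, c, hc, hb⟩ := h.exists_potential_eq
  -- The third bound is the solution of s = y (c + πks).
  set s := max (max b 0) (y * c / (1 - Real.pi * k * y)) with hs
  have hs0 : 0 ≤ s := (le_max_right b 0).trans (le_max_left _ _)
  have h1 : y ≤ twistScale f s := by
    rw [twistScale, le_div_iff₀ (h.potential_pos _),
      hb s ((le_max_left b 0).trans (le_max_left _ _))]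
    have := le_max_right (max b 0) (y * c / (1 - Real.pi * k * y))
    rw [← hs, div_le_iff₀ (by linarith)] at this
    linarith
  have h2 := intermediate_value_Icc hs0 h.contDiff_scale.continuous.continuousOn
  have h3 : twistScale f 0 = 0 := by simp [twistScale]
  obtain ⟨r, hr, hry⟩ := h2 ⟨by rw [h3]; exact h0, h1⟩
  exact ⟨r, hr.1, hry⟩

theorem exists_isTwistProfile (hk : 1 ≤ k) : ∃ f : ℝ → ℝ, IsTwistProfile k f := by
  have hk' : (1 : ℝ) ≤ k := by exact_mod_cast hk
  -- The profile rises on [a, 2a] only, so ∫ s f' ≤ 2a · πk = π/4 < 1.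
  set a : ℝ := 1 / (8 * k) with ha
  have ha0 : 0 < a := by positivity
  set f : ℝ → ℝ := fun r => Real.pi * k * Real.smoothTransition ((r - a) / a) with hf
  have hsm : ContDiff ℝ ∞ f :=
    contDiff_const.mul (Real.smoothTransition.contDiff.comp
      ((contDiff_id.sub contDiff_const).div_const a))
  have hmono : Monotone f := fun r s hrs => by
    refine mul_le_mul_of_nonneg_left (Real.smoothTransition.monotone ?_) (by positivity)
    gcongr
  have h0 : ∀ r ≤ a, f r = 0 := fun r hr => by
    simp only [hf]
    rw [Real.smoothTransition.zero_of_nonpos (div_nonpos_of_nonpos_of_nonneg (by linarith) ha0.le),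
      mul_zero]
  have h1 : ∀ r ≥ 2 * a, f r = Real.pi * k := fun r hr => by
    simp only [hf]
    rw [Real.smoothTransition.one_of_one_le ((one_le_div ha0).2 (by linarith)), mul_one]
  refine ⟨f, hsm, hmono, ⟨a, ha0, h0⟩, ⟨2 * a, h1⟩, fun r hr => ?_⟩
  have hc : Continuous (deriv f) := hsm.continuous_deriv (by simp)
  have h2 : ∫ s in (0 : ℝ)..r, s * deriv f s ≤ ∫ s in (0 : ℝ)..r, 2 * a * deriv f s := by
    refine intervalIntegral.integral_mono_on hr ((continuous_id.mul hc).intervalIntegrable _ _)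
      ((continuous_const.mul hc).intervalIntegrable _ _) fun s _ => ?_
    rcases le_or_gt s (2 * a) with hs | hs
    · exact mul_le_mul_of_nonneg_right hs (hmono.deriv_nonneg)
    · have : deriv f s = 0 := by
        have : f =ᶠ[𝓝 s] fun _ => Real.pi * k := by
          filter_upwards [lt_mem_nhds hs] with x hx using h1 x hx.le
        rw [this.deriv_eq, deriv_const]
      simp [this]
  rw [intervalIntegral.integral_const_mul, intervalIntegral.integral_deriv_eq_sub
    (fun s _ => hsm.differentiable (by simp) s) (hc.intervalIntegrable _ _), h0 0 ha0.le,
    sub_zero] at h2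
  have h3 : f r ≤ Real.pi * k := by
    have := hmono (le_max_left r (2 * a))
    rwa [h1 _ (le_max_right _ _)] at this
  have h4 : 2 * a * f r ≤ 2 * a * (Real.pi * k) := mul_le_mul_of_nonneg_left h3 (by positivity)
  have h5 : 2 * a * (Real.pi * k) = Real.pi / 4 := by
    rw [ha]; field_simp; norm_num
  have h6 := Real.pi_lt_four
  unfold twistPrimitive
  linarith

end Profile

/-! ### The modulus of z₀ as a function of |ξ||η|. -/

section Modulus

variable {k : ℕ}

/-- The product of the squares of the norms of the real and imaginary parts of `w ∈ ℂⁿ` with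
`w · w = - rᵏ` and `|w|² = 2 - r²`. -/
def partsProduct (k : ℕ) (r : ℝ) : ℝ := ((2 - r ^ 2) ^ 2 - r ^ (2 * k)) / 4

theorem hasDerivAt_partsProduct (r : ℝ) : HasDerivAt (partsProduct k)
    ((2 * (2 - r ^ 2) * (-(2 * r)) - (2 * k : ℕ) * r ^ (2 * k - 1)) / 4) r := by
  have h1 := (((hasDerivAt_pow 2 r).const_sub 2).pow 2).sub (hasDerivAt_pow (2 * k) r)
  refine (h1.div_const 4).congr_deriv ?_
  norm_num

/-- Only r ≤ 1 occurs on W. The larger interval makes r = 1, which is the zero section, an interior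
point at which the inverse is smooth; 6/5 is a convenient number between 1 and √2. -/
theorem partsProduct_deriv_neg {r : ℝ} (hr : r ∈ Ioo (0 : ℝ) (6 / 5)) :
    (2 * (2 - r ^ 2) * (-(2 * r)) - (2 * k : ℕ) * r ^ (2 * k - 1)) / 4 < 0 := by
  have h1 : 0 < 2 - r ^ 2 := by nlinarith [hr.1, hr.2]
  have h2 : 0 ≤ (2 * k : ℕ) * r ^ (2 * k - 1) := mul_nonneg (by positivity) (pow_nonneg hr.1.le _)
  have h3 := mul_pos h1 hr.1
  linarith

theorem contDiff_partsProduct : ContDiff ℝ ∞ (partsProduct k) := by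
  unfold partsProduct
  fun_prop

/-- The inverse function of `partsProduct k` on `(0, 6 / 5)`. -/
def partsProductInv (k : ℕ) : ℝ → ℝ := Function.invFunOn (partsProduct k) (Ioo 0 (6 / 5))

theorem partsProductInv_leftInvOn :
    LeftInvOn (partsProductInv k) (partsProduct k) (Ioo 0 (6 / 5)) := by
  refine InjOn.leftInvOn_invFunOn (StrictAntiOn.injOn ?_)
  refine strictAntiOn_of_deriv_neg (convex_Ioo _ _) contDiff_partsProduct.continuous.continuousOn
    fun r hr => ?_
  rw [interior_Ioo] at hr
  rw [(hasDerivAt_partsProduct r).deriv]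
  exact partsProduct_deriv_neg hr

theorem contDiffAt_partsProductInv {r : ℝ} (hr : r ∈ Ioo (0 : ℝ) (6 / 5)) :
    ContDiffAt ℝ ∞ (partsProductInv k) (partsProduct k r) :=
  contDiffAt_leftInverse (isOpen_Ioo.mem_nhds hr) partsProductInv_leftInvOn
    contDiff_partsProduct.contDiffAt (hasDerivAt_partsProduct r) (partsProduct_deriv_neg hr).ne

theorem exists_partsProduct_eq (hk : 1 ≤ k) {m : ℝ} (h0 : 0 ≤ m) (h1 : m < 1) :
    ∃ r ∈ Ioc (0 : ℝ) 1, partsProduct k r = m := by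
  have h := intermediate_value_Icc' (zero_le_one' ℝ)
    (contDiff_partsProduct (k := k)).continuous.continuousOn
  have h2 : partsProduct k 0 = 1 := by
    simp [partsProduct, show k ≠ 0 by omega]; norm_num
  have h3 : partsProduct k 1 = 0 := by simp [partsProduct]; norm_num
  obtain ⟨r, hr, hrm⟩ := h (show m ∈ Icc _ _ by rw [h2, h3]; exact ⟨h0, h1.le⟩)
  refine ⟨r, ⟨lt_of_le_of_ne hr.1 ?_, hr.2⟩, hrm⟩
  rintro rfl
  exact h1.ne (hrm.symm.trans h2)

end Modulus

/-! ### The normalized geodesic flow with variable time. -/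

section GeodesicRotation

variable {V Y : Type*} [NormedAddCommGroup V] [InnerProductSpace ℝ V]
  [NormedAddCommGroup Y] [NormedSpace ℝ Y] {n : ℕ}

theorem hasDerivAt_fst {f : ℝ → V × Y} {f' : V × Y} {ε : ℝ} (h : HasDerivAt f f' ε) :
    HasDerivAt (fun s => (f s).1) f'.1 ε :=
  (hasFDerivAt_fst (𝕜 := ℝ) (p := f ε)).comp_hasDerivAt ε h

theorem hasDerivAt_snd {f : ℝ → V × Y} {f' : V × Y} {ε : ℝ} (h : HasDerivAt f f' ε) :
    HasDerivAt (fun s => (f s).2) f'.2 ε :=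
  (hasFDerivAt_snd (𝕜 := ℝ) (p := f ε)).comp_hasDerivAt ε h

/-- The normalized geodesic flow at time `c` on the cotangent bundle of the unit sphere. -/
def geodesicRotation (c : ℝ) (x : V × V) : V × V :=
  (Real.cos c • x.1 + (‖x.2‖⁻¹ * Real.sin c) • x.2, -(‖x.2‖ * Real.sin c) • x.1 + Real.cos c • x.2)

theorem dehnTwist_eq (k : ℕ) (f : ℝ → ℝ)
    (x : EuclideanSpace ℝ (Fin n) × EuclideanSpace ℝ (Fin n)) :
    dehnTwist n k f x = geodesicRotation (Real.pi * k + f ‖x.2‖) x := rfl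

theorem geodesicRotation_of_sin_eq_zero {c : ℝ} (hc : Real.sin c = 0) (x : V × V) :
    geodesicRotation c x = Real.cos c • x := by
  ext <;> simp [geodesicRotation, hc]

theorem norm_geodesicRotation_snd {c : ℝ} {x : V × V} (h1 : ‖x.1‖ = 1)
    (h2 : inner ℝ x.1 x.2 = 0) : ‖(geodesicRotation c x).2‖ = ‖x.2‖ := by
  rw [← sq_eq_sq₀ (norm_nonneg _) (norm_nonneg _), geodesicRotation, norm_add_sq_real]
  simp only [norm_smul, inner_smul_left, inner_smul_right, h1, h2, mul_pow, Real.norm_eq_abs,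
    sq_abs]
  linear_combination ‖x.2‖ ^ 2 * Real.sin_sq_add_cos_sq c

/-- For p = 0 the term with p/|p| is absent (the inverse of 0 is 0), which leaves cos c · q. So the
sine has to vanish there. -/
theorem norm_geodesicRotation_fst {c : ℝ} {x : V × V} (h1 : ‖x.1‖ = 1)
    (h2 : inner ℝ x.1 x.2 = 0) (hc : x.2 = 0 → Real.sin c = 0) :
    ‖(geodesicRotation c x).1‖ = 1 := by
  rw [← sq_eq_sq₀ (norm_nonneg _) zero_le_one, geodesicRotation, norm_add_sq_real]
  simp only [norm_smul, inner_smul_left, inner_smul_right, h1, h2, mul_pow, Real.norm_eq_abs,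
    sq_abs]
  have := Real.sin_sq_add_cos_sq c
  by_cases hx : x.2 = 0
  · rw [hc hx] at this ⊢
    linear_combination this
  · have hx : ‖x.2‖ ≠ 0 := by simpa using hx
    have h3 : (‖x.2‖⁻¹ * ‖x.2‖) ^ 2 = 1 := by rw [inv_mul_cancel₀ hx, one_pow]
    linear_combination Real.sin c ^ 2 * h3 + this

theorem inner_geodesicRotation {c : ℝ} {x : V × V} (h1 : ‖x.1‖ = 1)
    (h2 : inner ℝ x.1 x.2 = 0) :
    inner ℝ (geodesicRotation c x).1 (geodesicRotation c x).2 = 0 := by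
  have h3 : inner ℝ x.2 x.1 = 0 := by rw [real_inner_comm, h2]
  simp only [geodesicRotation, inner_add_left, inner_add_right, inner_smul_left, inner_smul_right,
    h2, h3, real_inner_self_eq_norm_sq, h1, conj_trivial]
  by_cases hx : ‖x.2‖ = 0
  · simp [hx]
  · field_simp
    ring

theorem geodesicRotation_mem {c : ℝ} {x : EuclideanSpace ℝ (Fin n) × EuclideanSpace ℝ (Fin n)}
    (hx : x ∈ cotangentSphere n) (hc : x.2 = 0 → Real.sin c = 0) :
    geodesicRotation c x ∈ cotangentSphere n :=
  ⟨norm_geodesicRotation_fst hx.1 hx.2 hc, inner_geodesicRotation hx.1 hx.2⟩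

theorem geodesicRotation_geodesicRotation {c d : ℝ} {x : V × V} (h1 : ‖x.1‖ = 1)
    (h2 : inner ℝ x.1 x.2 = 0) (hd : x.2 = 0 → Real.sin d = 0) :
    geodesicRotation c (geodesicRotation d x) = geodesicRotation (c + d) x := by
  have h3 : ‖(geodesicRotation d x).2‖ = ‖x.2‖ := norm_geodesicRotation_snd h1 h2
  by_cases hx : x.2 = 0
  · rw [geodesicRotation_of_sin_eq_zero (hd hx)]
    ext1 <;> simp [geodesicRotation, hx, Real.cos_add, hd hx, mul_smul]
  · have hx : ‖x.2‖ ≠ 0 := by simpa using hx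
    rw [geodesicRotation, h3]
    simp only [geodesicRotation, Real.cos_add, Real.sin_add]
    ext1
    · match_scalars <;> field_simp <;> ring
    · match_scalars <;> field_simp <;> ring

/-- Where p ≠ 0 the formula is smooth. At p = 0 the sine vanishes on a neighbourhood, and the map is
locally multiplication by cos c. -/
theorem contDiffAt_geodesicRotation {c : Y → ℝ} {x : Y → V × V} {y : Y} (hc : ContDiffAt ℝ ∞ c y)
    (hx : ContDiffAt ℝ ∞ x y) (h : (x y).2 = 0 → ∀ᶠ z in 𝓝 y, Real.sin (c z) = 0) :
    ContDiffAt ℝ ∞ (fun z => geodesicRotation (c z) (x z)) y := by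
  have hcos := Real.contDiff_cos.contDiffAt.comp y (hc.of_le le_rfl)
  by_cases hp : (x y).2 = 0
  · refine (hcos.smul hx).congr_of_eventuallyEq ?_
    filter_upwards [h hp] with z hz using geodesicRotation_of_sin_eq_zero hz _
  · have hsin := Real.contDiff_sin.contDiffAt.comp y (hc.of_le le_rfl)
    have hq : ContDiffAt ℝ ∞ (fun z => (x z).1) y := contDiffAt_fst.comp y hx
    have hp' : ContDiffAt ℝ ∞ (fun z => (x z).2) y := contDiffAt_snd.comp y hx
    have hn := hp'.norm ℝ hp
    exact ((hcos.smul hq).add (((hn.inv (by simpa using hp)).mul hsin).smul hp')).prodMk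
      (((hn.mul hsin).neg.smul hq).add (hcos.smul hp'))

/-- For fixed time the flow preserves p·dq. Its velocity pairs with the moved covector to |p|,
whence the additional term |p| dc. -/
theorem inner_deriv_geodesicRotation {c : ℝ → ℝ} {q p : ℝ → V} {c' ε : ℝ} {q' p' : V}
    (hc : HasDerivAt c c' ε) (hq : HasDerivAt q q' ε) (hp : HasDerivAt p p' ε) (h0 : p ε ≠ 0)
    (h1 : ‖q ε‖ = 1) (h2 : inner ℝ (q ε) (p ε) = 0) (h3 : inner ℝ (q ε) q' = 0)
    (h4 : inner ℝ (q ε) p' + inner ℝ q' (p ε) = 0) {w : V}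
    (hw : HasDerivAt (fun s => (geodesicRotation (c s) (q s, p s)).1) w ε) :
    inner ℝ (geodesicRotation (c ε) (q ε, p ε)).2 w =
      inner ℝ (p ε) q' + ‖p ε‖ * c' := by
  have hn0 : ‖p ε‖ ≠ 0 := by simpa using h0
  have hn : HasDerivAt (fun s => ‖p s‖) (inner ℝ (p ε) p' / ‖p ε‖) ε := by
    have h5 := (hp.norm_sq).sqrt (by simpa using h0)
    simp only [Real.sqrt_sq (norm_nonneg _)] at h5
    refine h5.congr_deriv ?_
    field_simp
  have hQ := (hc.cos.smul hq).add (((hn.inv hn0).mul hc.sin).smul hp)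
  rw [hw.unique hQ]
  have h2' : inner ℝ (p ε) (q ε) = 0 := by rw [real_inner_comm, h2]
  have h4' : inner ℝ (q ε) p' = -inner ℝ (p ε) q' := by
    rw [real_inner_comm] at h4; rw [real_inner_comm q' (p ε)]; linarith [real_inner_comm p' (q ε)]
  simp only [geodesicRotation, inner_add_left, inner_add_right, inner_smul_left, inner_smul_right,
    h2, h2', h3, h4', real_inner_self_eq_norm_sq, h1, conj_trivial, Pi.mul_apply, Pi.inv_apply]
  have h6 := Real.sin_sq_add_cos_sq (c ε)
  field_simp
  linear_combination ‖p ε‖ ^ 2 * (inner ℝ (p ε) q' + ‖p ε‖ * c') * h6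

end GeodesicRotation

/-! ### The Dehn twist is a diffeomorphism and the form β_k descends. -/

section DehnTwist

variable {n k : ℕ} {f : ℝ → ℝ}

theorem tangentAt_cotangentSphere
    {y v : ℝ × EuclideanSpace ℝ (Fin n) × EuclideanSpace ℝ (Fin n)}
    (hy : y ∈ (univ : Set ℝ) ×ˢ cotangentSphere n)
    (hv : v ∈ tangentAt ((univ : Set ℝ) ×ˢ cotangentSphere n) y) :
    inner ℝ y.2.1 v.2.1 = 0 ∧ inner ℝ y.2.1 v.2.2 + inner ℝ v.2.1 y.2.2 = 0 := by
  have hq : HasFDerivAt (fun a : ℝ × EuclideanSpace ℝ (Fin n) × EuclideanSpace ℝ (Fin n) => a.2.1)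
      ((ContinuousLinearMap.fst ℝ _ _).comp (ContinuousLinearMap.snd ℝ _ _)) y :=
    hasFDerivAt_fst.comp y hasFDerivAt_snd
  have hp : HasFDerivAt (fun a : ℝ × EuclideanSpace ℝ (Fin n) × EuclideanSpace ℝ (Fin n) => a.2.2)
      ((ContinuousLinearMap.snd ℝ _ _).comp (ContinuousLinearMap.snd ℝ _ _)) y :=
    hasFDerivAt_snd.comp y hasFDerivAt_snd
  have h1 := fderiv_eq_zero_of_const (c := 1) (hq.inner ℝ hq) (fun a ha => by
    have : ‖a.2.1‖ = 1 := ha.2.1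
    rw [real_inner_self_eq_norm_sq, this, one_pow]) hy hv
  have h2 := fderiv_eq_zero_of_const (c := 0) (hq.inner ℝ hp) (fun a ha => ha.2.2) hy hv
  simp only [ContinuousLinearMap.comp_apply, ContinuousLinearMap.prod_apply, fderivInnerCLM_apply,
    ContinuousLinearMap.coe_fst', ContinuousLinearMap.coe_snd'] at h1 h2
  refine ⟨?_, h2⟩
  rw [real_inner_comm y.2.1 v.2.1] at h1
  linarith

theorem inner_fderiv_geodesicRotation
    {c : ℝ × EuclideanSpace ℝ (Fin n) × EuclideanSpace ℝ (Fin n) → ℝ}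
    {y v : ℝ × EuclideanSpace ℝ (Fin n) × EuclideanSpace ℝ (Fin n)}
    (hc : ContDiffAt ℝ ∞ c y) (h0 : y.2.2 = 0 → ∀ᶠ z in 𝓝 y, Real.sin (c z) = 0)
    (hy : y ∈ (univ : Set ℝ) ×ˢ cotangentSphere n)
    (hv : v ∈ tangentAt ((univ : Set ℝ) ×ˢ cotangentSphere n) y) :
    inner ℝ (geodesicRotation (c y) y.2).2
        (fderiv ℝ (fun z => geodesicRotation (c z) z.2) y v).1 =
      inner ℝ y.2.2 v.2.1 + ‖y.2.2‖ * fderiv ℝ c y v := by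
  -- On the zero section the moved covector vanishes, and so do both sides. Elsewhere the
  -- one-parameter formula is applied along the line through y in direction v.
  by_cases hp : y.2.2 = 0
  · simp [geodesicRotation, hp]
  · obtain ⟨h1, h2⟩ := tangentAt_cotangentSphere hy hv
    have hR : DifferentiableAt ℝ (fun z => geodesicRotation (c z) z.2) y :=
      (contDiffAt_geodesicRotation hc contDiffAt_snd h0).differentiableAt (by simp)
    have hline : HasDerivAt (fun ε : ℝ => y + ε • v) v 0 := by
      simpa using ((hasDerivAt_id (0 : ℝ)).smul_const v).const_add y
    have hc' : HasDerivAt (fun ε : ℝ => c (y + ε • v)) (fderiv ℝ c y v) 0 :=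
      (hc.differentiableAt (by simp)).hasFDerivAt.hasLineDerivAt v
    have hline2 := hasDerivAt_snd hline
    have hw : HasDerivAt
        (fun ε : ℝ => (geodesicRotation (c (y + ε • v)) ((y + ε • v).2.1, (y + ε • v).2.2)).1)
        (fderiv ℝ (fun z => geodesicRotation (c z) z.2) y v).1 0 :=
      hasDerivAt_fst (hR.hasFDerivAt.hasLineDerivAt v)
    have := inner_deriv_geodesicRotation hc' (hasDerivAt_fst hline2) (hasDerivAt_snd hline2) (by simpa using hp) (by simpa using hy.2.1)
      (by simpa using hy.2.2) (by simpa using h1) (by simpa using h2) hw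
    simpa using this

theorem IsTwistProfile.contDiffAt_comp_norm (h : IsTwistProfile k f)
    (p : EuclideanSpace ℝ (Fin n)) :
    ContDiffAt ℝ ∞ (fun p : EuclideanSpace ℝ (Fin n) => f ‖p‖) p := by
  obtain ⟨a, ha, hfa⟩ := h.near_zero
  exact BrieskornBook.contDiffAt_comp_norm ha hfa h.smooth.contDiffAt

theorem IsTwistProfile.eventually_eq_zero (h : IsTwistProfile k f) :
    ∀ᶠ p : EuclideanSpace ℝ (Fin n) in 𝓝 0, f ‖p‖ = 0 := by
  obtain ⟨a, ha, hfa⟩ := h.near_zero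
  have : ∀ᶠ q : EuclideanSpace ℝ (Fin n) in 𝓝 0, ‖q‖ < a :=
    continuous_norm.continuousAt.eventually_lt continuousAt_const (by simpa using ha)
  filter_upwards [this] with q hq using hfa _ hq.le

theorem IsTwistProfile.apply_zero (h : IsTwistProfile k f) : f 0 = 0 := by
  obtain ⟨a, ha, hfa⟩ := h.near_zero
  exact hfa 0 ha.le

theorem sin_pi_mul_natCast (k : ℕ) : Real.sin (Real.pi * k) = 0 := by
  rw [mul_comm, Real.sin_nat_mul_pi]

/-- The twist preserves |p|, so the same flow run for the opposite time is its inverse. -/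
theorem IsTwistProfile.isDiffeo_dehnTwist (h : IsTwistProfile k f) :
    IsDiffeo (dehnTwist n k f) (cotangentSphere n) (cotangentSphere n) := by
  have hsm (x : EuclideanSpace ℝ (Fin n) × EuclideanSpace ℝ (Fin n)) :
      ContDiffAt ℝ ∞ (fun x : EuclideanSpace ℝ (Fin n) × EuclideanSpace ℝ (Fin n) =>
        Real.pi * k + f ‖x.2‖) x :=
    contDiffAt_const.add
      (ContDiffAt.comp (g := fun p => f ‖p‖) x (h.contDiffAt_comp_norm x.2) contDiffAt_snd)
  have hev (x : EuclideanSpace ℝ (Fin n) × EuclideanSpace ℝ (Fin n)) (hx : x.2 = 0) :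
      ∀ᶠ z in 𝓝 x, Real.sin (Real.pi * k + f ‖z.2‖) = 0 := by
    have := (continuous_snd.tendsto x).eventually (hx ▸ h.eventually_eq_zero)
    filter_upwards [this] with z hz
    rw [hz, add_zero, sin_pi_mul_natCast]
  have hz (x : EuclideanSpace ℝ (Fin n) × EuclideanSpace ℝ (Fin n)) (hx : x.2 = 0) :
      Real.sin (Real.pi * k + f ‖x.2‖) = 0 := (hev x hx).self_of_nhds
  refine ⟨fun x _ => (contDiffAt_geodesicRotation (hsm x) contDiffAt_id (hev x)).contDiffWithinAt,
    fun x hx => geodesicRotation_mem hx (hz x),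
    fun x => geodesicRotation (-(Real.pi * k + f ‖x.2‖)) x,
    fun x _ => (contDiffAt_geodesicRotation (hsm x).neg contDiffAt_id fun hx => ?_).contDiffWithinAt,
    fun x hx => geodesicRotation_mem hx fun hx0 => by rw [Real.sin_neg, hz x hx0, neg_zero],
    fun x hx => ?_, fun x hx => ?_⟩
  · filter_upwards [hev x hx] with z hz
    rw [Real.sin_neg, hz, neg_zero]
  · simp only [dehnTwist_eq]
    rw [norm_geodesicRotation_snd hx.1 hx.2,
      geodesicRotation_geodesicRotation hx.1 hx.2 (hz x), neg_add_cancel,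
      geodesicRotation_of_sin_eq_zero Real.sin_zero]
    simp
  · simp only [dehnTwist_eq]
    rw [norm_geodesicRotation_snd hx.1 hx.2, geodesicRotation_geodesicRotation hx.1 hx.2
      (fun hx0 => by rw [Real.sin_neg, hz x hx0, neg_zero]), add_neg_cancel,
      geodesicRotation_of_sin_eq_zero Real.sin_zero]
    simp

theorem torusForm_apply (n : ℕ) (f : ℝ → ℝ)
    (y v : ℝ × EuclideanSpace ℝ (Fin n) × EuclideanSpace ℝ (Fin n)) :
    torusForm n f y v = twistPrimitive f ‖y.2.2‖ * v.1 -
      y.1 * ‖y.2.2‖ * fderiv ℝ (fun a : EuclideanSpace ℝ (Fin n) => f ‖a‖) y.2.2 v.2.2 +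
      inner ℝ y.2.2 v.2.1 := rfl

theorem IsTwistProfile.hasFDerivAt_comp_norm (h : IsTwistProfile k f)
    {Y : Type*} [NormedAddCommGroup Y] [NormedSpace ℝ Y] {P : Y → EuclideanSpace ℝ (Fin n)}
    {P' : Y →L[ℝ] EuclideanSpace ℝ (Fin n)} {y : Y} (hP : HasFDerivAt P P' y) :
    HasFDerivAt (fun y => f ‖P y‖)
      ((fderiv ℝ (fun a : EuclideanSpace ℝ (Fin n) => f ‖a‖) (P y)).comp P') y :=
  HasFDerivAt.comp (g := fun a : EuclideanSpace ℝ (Fin n) => f ‖a‖) y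
    ((h.contDiffAt_comp_norm (P y)).differentiableAt (by simp)).hasFDerivAt hP

/-- The twist fixes |p| and turns p·dq into p·dq + |p| df. This compensates the change of -t|p| df
under t ↦ t + 1. -/
theorem IsTwistProfile.descends (h : IsTwistProfile k f) :
    DescendsToMappingTorus (cotangentSphere n) (dehnTwist n k f) (torusForm n f) := by
  intro y hy v hv
  set c : ℝ × EuclideanSpace ℝ (Fin n) × EuclideanSpace ℝ (Fin n) → ℝ :=
    fun a => Real.pi * k + f ‖a.2.2‖ with hc
  set R := fun a : ℝ × EuclideanSpace ℝ (Fin n) × EuclideanSpace ℝ (Fin n) =>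
    geodesicRotation (c a) a.2 with hR
  have hp : HasFDerivAt
      (fun a : ℝ × EuclideanSpace ℝ (Fin n) × EuclideanSpace ℝ (Fin n) => a.2.2)
      ((ContinuousLinearMap.snd ℝ _ _).comp (ContinuousLinearMap.snd ℝ _ _)) y :=
    hasFDerivAt_snd.comp y hasFDerivAt_snd
  have hcs : ContDiffAt ℝ ∞ c y :=
    contDiffAt_const.add (ContDiffAt.comp (g := fun p => f ‖p‖)
      (f := fun a : ℝ × EuclideanSpace ℝ (Fin n) × EuclideanSpace ℝ (Fin n) => a.2.2) y
      (h.contDiffAt_comp_norm y.2.2) (contDiffAt_snd.comp y contDiffAt_snd))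
  have hev : y.2.2 = 0 → ∀ᶠ z in 𝓝 y, Real.sin (c z) = 0 := fun hy0 => by
    have := ((continuous_snd.comp continuous_snd).tendsto y).eventually
      (show ∀ᶠ p in 𝓝 y.2.2, f ‖p‖ = 0 from hy0 ▸ h.eventually_eq_zero)
    filter_upwards [this] with z hz
    change f ‖z.2.2‖ = 0 at hz
    rw [hc]
    simp only
    rw [hz, add_zero, sin_pi_mul_natCast]
  have hcd : fderiv ℝ c y v = fderiv ℝ (fun a : EuclideanSpace ℝ (Fin n) => f ‖a‖) y.2.2 v.2.2 := by
    rw [((h.hasFDerivAt_comp_norm hp).const_add (Real.pi * k)).fderiv]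
    rfl
  have hRd : HasFDerivAt R (fderiv ℝ R y) y :=
    ((contDiffAt_geodesicRotation hcs contDiffAt_snd hev).differentiableAt (by simp)).hasFDerivAt
  have hF : HasFDerivAt
      (fun a : ℝ × EuclideanSpace ℝ (Fin n) × EuclideanSpace ℝ (Fin n) =>
        (a.1 + 1, dehnTwist n k f a.2))
      ((ContinuousLinearMap.fst ℝ _ _).prod (fderiv ℝ R y)) y :=
    (hasFDerivAt_fst.add_const 1).prodMk hRd
  have hinner := inner_fderiv_geodesicRotation hcs hev hy hv
  have hnorm : ∀ a ∈ (univ : Set ℝ) ×ˢ cotangentSphere n, ‖(R a).2‖ = ‖a.2.2‖ := fun a ha =>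
    norm_geodesicRotation_snd ha.2.1 ha.2.2
  -- The norm of p is preserved only on the cotangent bundle of the sphere, so the differentials are
  -- compared on its tangent vectors.
  have hfd := fderiv_eq_of_eqOn
    (h.hasFDerivAt_comp_norm ((hasFDerivAt_snd (𝕜 := ℝ) (p := R y)).comp y hRd))
    (h.hasFDerivAt_comp_norm hp) (fun a ha => by
      change f ‖(R a).2‖ = f ‖a.2.2‖
      rw [hnorm a ha]) hy hv
  rw [fderivWithin_apply_of_mem_tangentAt hF.hasFDerivWithinAt hv, torusForm_apply, torusForm_apply]
  change twistPrimitive f ‖(R y).2‖ * v.1 - (y.1 + 1) * ‖(R y).2‖ *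
    fderiv ℝ (fun a : EuclideanSpace ℝ (Fin n) => f ‖a‖) (R y).2 (fderiv ℝ R y v).2 +
    inner ℝ (R y).2 (fderiv ℝ R y v).1 = _
  change fderiv ℝ (fun a : EuclideanSpace ℝ (Fin n) => f ‖a‖) (R y).2 (fderiv ℝ R y v).2 =
    fderiv ℝ (fun a : EuclideanSpace ℝ (Fin n) => f ‖a‖) y.2.2 v.2.2 at hfd
  change inner ℝ (R y).2 (fderiv ℝ R y v).1 = _ at hinner
  rw [hfd, hinner, hcd, hnorm y hy]
  ring

end DehnTwist

/-! ### Real and imaginary parts of complex vectors, and points of the unit circle. -/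

section RealImaginaryParts

variable {n : ℕ} {X : Type*} [NormedAddCommGroup X] [NormedSpace ℝ X]

/-- The point `exp (i x)` of the unit circle. -/
def cis (x : ℝ) : ℂ := Complex.exp (x * Complex.I)

theorem cis_add (x y : ℝ) : cis (x + y) = cis x * cis y := by
  simp [cis, add_mul, Complex.exp_add]

@[simp] theorem cis_zero : cis 0 = 1 := by simp [cis]

@[simp] theorem norm_cis (x : ℝ) : ‖cis x‖ = 1 := Complex.norm_exp_ofReal_mul_I x

theorem cis_ne_zero (x : ℝ) : cis x ≠ 0 := Complex.exp_ne_zero _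

theorem cis_neg_mul_cis (x : ℝ) : cis (-x) * cis x = 1 := by
  rw [← cis_add, neg_add_cancel, cis_zero]

theorem star_cis (x : ℝ) : star (cis x) = cis (-x) := by
  rw [cis, cis, Complex.star_def, ← Complex.exp_conj]
  simp

theorem cis_pow (x : ℝ) (k : ℕ) : cis x ^ k = cis (k * x) := by
  rw [cis, cis, ← Complex.exp_nat_mul]
  push_cast
  ring_nf

theorem cis_eq_cos {x : ℝ} (h : Real.sin x = 0) : cis x = (Real.cos x : ℂ) := by
  rw [cis, Complex.exp_mul_I, ← Complex.ofReal_sin, h, ← Complex.ofReal_cos]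
  simp

theorem contDiff_cis : ContDiff ℝ ∞ cis :=
  (Complex.ofRealCLM.contDiff.mul contDiff_const).cexp

theorem hasDerivAt_cis {φ : ℝ → ℝ} {φ' ε : ℝ} (h : HasDerivAt φ φ' ε) :
    HasDerivAt (fun s => cis (φ s)) (cis (φ ε) * (φ' * Complex.I)) ε :=
  (h.ofReal_comp.mul_const Complex.I).cexp

/-- The vector with real part `ξ` and imaginary part `η`. -/
def reIm (ξ η : EuclideanSpace ℝ (Fin n)) : Fin n → ℂ := fun j => ξ j + η j * Complex.I

theorem real_inner_eq_sum (ξ η : EuclideanSpace ℝ (Fin n)) : inner ℝ ξ η = ∑ j, ξ j * η j := by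
  simp [PiLp.inner_apply, mul_comm]

theorem reIm_dotProduct (ξ η ξ' η' : EuclideanSpace ℝ (Fin n)) :
    reIm ξ η ⬝ᵥ reIm ξ' η' = (inner ℝ ξ ξ' - inner ℝ η η' : ℝ) +
      (inner ℝ ξ η' + inner ℝ η ξ' : ℝ) * Complex.I := by
  simp only [real_inner_eq_sum, dotProduct, reIm]
  push_cast
  rw [← Finset.sum_sub_distrib, ← Finset.sum_add_distrib, Finset.sum_mul, ← Finset.sum_add_distrib]
  refine Finset.sum_congr rfl fun j _ => ?_
  linear_combination (η j : ℂ) * η' j * Complex.I_mul_I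

theorem star_reIm (ξ η : EuclideanSpace ℝ (Fin n)) : star (reIm ξ η) = reIm ξ (-η) := by
  ext j
  simp [reIm]

theorem star_reIm_dotProduct (ξ η ξ' η' : EuclideanSpace ℝ (Fin n)) :
    star (reIm ξ η) ⬝ᵥ reIm ξ' η' = (inner ℝ ξ ξ' + inner ℝ η η' : ℝ) +
      (inner ℝ ξ η' - inner ℝ η ξ' : ℝ) * Complex.I := by
  rw [star_reIm, reIm_dotProduct, inner_neg_left, inner_neg_left, sub_neg_eq_add, ← sub_eq_add_neg]

/-- The real part of a complex vector. -/
def reVec (u : Fin n → ℂ) : EuclideanSpace ℝ (Fin n) := WithLp.toLp 2 fun j => (u j).re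

/-- The imaginary part of a complex vector. -/
def imVec (u : Fin n → ℂ) : EuclideanSpace ℝ (Fin n) := WithLp.toLp 2 fun j => (u j).im

theorem reIm_reVec_imVec (u : Fin n → ℂ) : reIm (reVec u) (imVec u) = u := by
  ext j
  exact Complex.re_add_im (u j)

theorem reVec_reIm (ξ η : EuclideanSpace ℝ (Fin n)) : reVec (reIm ξ η) = ξ := by
  ext j
  simp [reVec, reIm]

theorem imVec_reIm (ξ η : EuclideanSpace ℝ (Fin n)) : imVec (reIm ξ η) = η := by
  ext j
  simp [imVec, reIm]

theorem contDiffAt_reVec {u : X → Fin n → ℂ} {x : X}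
    (hu : ∀ j, ContDiffAt ℝ ∞ (fun y => u y j) x) : ContDiffAt ℝ ∞ (fun y => reVec (u y)) x :=
  contDiffAt_piLp' _ fun j => Complex.reCLM.contDiff.contDiffAt.comp x (hu j)

theorem contDiffAt_imVec {u : X → Fin n → ℂ} {x : X}
    (hu : ∀ j, ContDiffAt ℝ ∞ (fun y => u y j) x) : ContDiffAt ℝ ∞ (fun y => imVec (u y)) x :=
  contDiffAt_piLp' _ fun j => Complex.imCLM.contDiff.contDiffAt.comp x (hu j)

theorem contDiffAt_reIm {ξ η : X → EuclideanSpace ℝ (Fin n)} {x : X} (hξ : ContDiffAt ℝ ∞ ξ x)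
    (hη : ContDiffAt ℝ ∞ η x) (j : Fin n) : ContDiffAt ℝ ∞ (fun y => reIm (ξ y) (η y) j) x := by
  have h (ζ : X → EuclideanSpace ℝ (Fin n)) (hζ : ContDiffAt ℝ ∞ ζ x) :
      ContDiffAt ℝ ∞ (fun y => (ζ y j : ℂ)) x :=
    Complex.ofRealCLM.contDiff.contDiffAt.comp x
      ((EuclideanSpace.proj (𝕜 := ℝ) j).contDiff.contDiffAt.comp x hζ)
  exact (h ξ hξ).add ((h η hη).mul contDiffAt_const)

theorem hasDerivAt_reIm {ξ η : ℝ → EuclideanSpace ℝ (Fin n)} {ξ' η' : EuclideanSpace ℝ (Fin n)}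
    {ε : ℝ} (hξ : HasDerivAt ξ ξ' ε) (hη : HasDerivAt η η' ε) (j : Fin n) :
    HasDerivAt (fun s => reIm (ξ s) (η s) j) (reIm ξ' η' j) ε := by
  have h {ζ : ℝ → EuclideanSpace ℝ (Fin n)} {ζ' : EuclideanSpace ℝ (Fin n)}
      (hζ : HasDerivAt ζ ζ' ε) : HasDerivAt (fun s => (ζ s j : ℂ)) (ζ' j : ℂ) ε :=
    HasDerivAt.ofReal_comp
      ((EuclideanSpace.proj (𝕜 := ℝ) j).hasFDerivAt.comp_hasDerivAt ε hζ)
  exact (h hξ).add ((h hη).mul_const Complex.I)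

end RealImaginaryParts

/-! ### Polar coordinates on W and the contact form in them. -/

section Assemble

variable {n k : ℕ} {X : Type*} [NormedAddCommGroup X] [NormedSpace ℝ X]

/-- The point of `ℂⁿ⁺¹` with first coordinate `r exp (2 π i t)` and remaining coordinates
`exp (π i k t) (a p + i b q)`. -/
def polarPoint (k : ℕ) (t r a b : ℝ) (x : EuclideanSpace ℝ (Fin n) × EuclideanSpace ℝ (Fin n)) :
    EuclideanSpace ℂ (Fin (n + 1)) :=
  cvec (r * cis (2 * Real.pi * t)) (cis (Real.pi * k * t) • reIm (a • x.2) (b • x.1))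

theorem contDiffAt_polarPoint {t r a b : X → ℝ}
    {x : X → EuclideanSpace ℝ (Fin n) × EuclideanSpace ℝ (Fin n)} {y : X}
    (ht : ContDiffAt ℝ ∞ t y) (hr : ContDiffAt ℝ ∞ r y) (ha : ContDiffAt ℝ ∞ a y)
    (hb : ContDiffAt ℝ ∞ b y) (hx : ContDiffAt ℝ ∞ x y) :
    ContDiffAt ℝ ∞ (fun z => polarPoint k (t z) (r z) (a z) (b z) (x z)) y := by
  have h (c : ℝ) : ContDiffAt ℝ ∞ (fun z => cis (c * t z)) y :=
    contDiff_cis.contDiffAt.comp y (contDiffAt_const.mul ht)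
  refine contDiffAt_cvec ?_ fun j => ?_
  · exact (Complex.ofRealCLM.contDiff.contDiffAt.comp y hr).mul (h _)
  · exact (h (Real.pi * k)).mul (contDiffAt_reIm (ha.smul (contDiffAt_snd.comp y hx))
      (hb.smul (contDiffAt_fst.comp y hx)) j)

/-- The rotation exp(πikt) squares to the phase of z₀^k, so it factors out of the polynomial.
Orthogonality of q and p removes the mixed terms. -/
theorem polarPoint_mem {t r a b : ℝ} {x : EuclideanSpace ℝ (Fin n) × EuclideanSpace ℝ (Fin n)}
    (hx : inner ℝ x.1 x.2 = 0)
    (h1 : r ^ k + (a ^ 2 * ‖x.2‖ ^ 2 - b ^ 2 * ‖x.1‖ ^ 2) = 0)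
    (h2 : r ^ 2 + (a ^ 2 * ‖x.2‖ ^ 2 + b ^ 2 * ‖x.1‖ ^ 2) = 2) :
    polarPoint k t r a b x ∈ brieskorn n k := by
  have hx' : inner ℝ x.2 x.1 = 0 := by rw [real_inner_comm, hx]
  rw [mem_brieskorn, polarPoint, cvec_zero, tail_cvec]
  constructor
  · rw [smul_dotProduct, dotProduct_smul, reIm_dotProduct, mul_pow, cis_pow,
      show (k : ℝ) * (2 * Real.pi * t) = Real.pi * k * t + Real.pi * k * t by ring, cis_add]
    simp only [inner_smul_left, inner_smul_right, hx, hx', real_inner_self_eq_norm_sq,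
      conj_trivial, smul_eq_mul, mul_zero, add_zero, Complex.ofReal_zero, zero_mul]
    have h3 := congrArg (fun s : ℝ => (s : ℂ)) h1
    push_cast at h3 ⊢
    linear_combination cis (Real.pi * k * t) ^ 2 * h3
  · rw [star_smul, smul_dotProduct, dotProduct_smul, star_reIm_dotProduct, star_cis, smul_smul,
      smul_eq_mul, cis_neg_mul_cis, one_mul]
    simp only [inner_smul_left, inner_smul_right, hx, hx', real_inner_self_eq_norm_sq,
      conj_trivial, mul_zero, sub_zero, Complex.ofReal_zero, zero_mul, add_zero,
      Complex.normSq_eq_norm_sq, norm_mul, norm_cis, mul_one, Complex.norm_real,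
      Complex.ofReal_re, Real.norm_eq_abs, sq_abs]
    linarith

/-- The rotation contributes 2πk|z|² dt = 4πk dt. The rest is 2(ξ·dη - η·dξ); the differentials of a
and b drop out since q ⟂ p, and q·dp = -p·dq doubles the remaining term. The differential of r does
not enter either. -/
theorem brieskornForm_polarPoint {t r a b : ℝ → ℝ}
    {x : ℝ → EuclideanSpace ℝ (Fin n) × EuclideanSpace ℝ (Fin n)} {t' r' a' b' ε : ℝ}
    {x' : EuclideanSpace ℝ (Fin n) × EuclideanSpace ℝ (Fin n)}
    (ht : HasDerivAt t t' ε) (hr : HasDerivAt r r' ε) (ha : HasDerivAt a a' ε)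
    (hb : HasDerivAt b b' ε) (hx : HasDerivAt x x' ε) {w : EuclideanSpace ℂ (Fin (n + 1))}
    (hw : HasDerivAt (fun s => polarPoint k (t s) (r s) (a s) (b s) (x s)) w ε)
    (h1 : inner ℝ (x ε).1 (x ε).2 = 0)
    (h2 : inner ℝ (x ε).1 x'.2 + inner ℝ x'.1 (x ε).2 = 0)
    (h3 : r ε ^ 2 + (a ε ^ 2 * ‖(x ε).2‖ ^ 2 + b ε ^ 2 * ‖(x ε).1‖ ^ 2) = 2) :
    brieskornForm n k (polarPoint k (t ε) (r ε) (a ε) (b ε) (x ε)) w =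
      4 * Real.pi * k * t' + 4 * (a ε * b ε) * inner ℝ (x ε).2 x'.1 := by
  have hcoord (i : Fin (n + 1)) : HasDerivAt
      (fun s => polarPoint k (t s) (r s) (a s) (b s) (x s) i) (w i) ε :=
    ((EuclideanSpace.proj i : EuclideanSpace ℂ (Fin (n + 1)) →L[ℂ] ℂ).restrictScalars
      ℝ).hasFDerivAt.comp_hasDerivAt ε hw
  have hw0 : w 0 = r' * cis (2 * Real.pi * t ε) +
      r ε * (cis (2 * Real.pi * t ε) * ((2 * Real.pi * t' : ℝ) * Complex.I)) :=
    (hcoord 0).unique (hr.ofReal_comp.mul (hasDerivAt_cis (ht.const_mul (2 * Real.pi))))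
  set ξ' : EuclideanSpace ℝ (Fin n) := a ε • x'.2 + a' • (x ε).2 with hξ'
  set η' : EuclideanSpace ℝ (Fin n) := b ε • x'.1 + b' • (x ε).1 with hη'
  have hwt : tail w = cis (Real.pi * k * t ε) • (((Real.pi * k * t' : ℝ) * Complex.I) •
      reIm (a ε • (x ε).2) (b ε • (x ε).1) + reIm ξ' η') := by
    ext j
    refine ((hcoord j.succ).unique ((hasDerivAt_cis (ht.const_mul (Real.pi * k))).mul
      (hasDerivAt_reIm (ha.smul (hasDerivAt_snd hx)) (hb.smul (hasDerivAt_fst hx)) j))).trans ?_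
    simp only [Pi.smul_apply, Pi.add_apply, smul_eq_mul, hξ', hη']
    ring
  have hn0 : star (r ε * cis (2 * Real.pi * t ε)) * w 0 =
      (r ε * r' : ℝ) + (r ε ^ 2 * (2 * Real.pi * t') : ℝ) * Complex.I := by
    rw [star_mul', star_cis, Complex.star_def, Complex.conj_ofReal, hw0]
    push_cast
    linear_combination ((r ε : ℂ) * r' + r ε ^ 2 * (2 * Real.pi * t') * Complex.I) *
      cis_neg_mul_cis (2 * Real.pi * t ε)
  have hn1 : star (cis (Real.pi * k * t ε) • reIm (a ε • (x ε).2) (b ε • (x ε).1)) ⬝ᵥ tail w =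
      (Real.pi * k * t' : ℝ) * Complex.I *
        (star (reIm (a ε • (x ε).2) (b ε • (x ε).1)) ⬝ᵥ reIm (a ε • (x ε).2) (b ε • (x ε).1)) +
        star (reIm (a ε • (x ε).2) (b ε • (x ε).1)) ⬝ᵥ reIm ξ' η' := by
    rw [hwt, star_smul, smul_dotProduct, dotProduct_smul, star_cis, smul_smul, smul_eq_mul,
      cis_neg_mul_cis, one_mul, dotProduct_add, dotProduct_smul, smul_eq_mul]
  have h1' : inner ℝ (x ε).2 (x ε).1 = 0 := by rw [real_inner_comm, h1]
  have h2' : inner ℝ (x ε).1 x'.2 = -inner ℝ (x ε).2 x'.1 := by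
    rw [real_inner_comm x'.1 (x ε).2] ; linarith [real_inner_comm x'.1 (x ε).2]
  rw [brieskornForm_apply, polarPoint, cvec_zero, tail_cvec, hn0, hn1, star_reIm_dotProduct,
    star_reIm_dotProduct]
  simp only [hξ', hη', inner_add_right, inner_smul_left, inner_smul_right, h1, h1', h2',
    real_inner_self_eq_norm_sq, conj_trivial, Complex.add_im, Complex.mul_im, Complex.mul_re,
    Complex.ofReal_re, Complex.ofReal_im, Complex.I_re, Complex.I_im, Complex.add_re]
  linear_combination 2 * Real.pi * k * t' * h3

end Assemble

/-! ### The lift of the contactomorphism to ℝ × T^*S^{n-1}. -/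

section TorusMap

variable {n k : ℕ} {f : ℝ → ℝ}

/-- The norm of the imaginary part of `w ∈ ℂⁿ` with `w · w = - rᵏ` and `|w|² = 2 - r²`. -/
def imNorm (k : ℕ) (r : ℝ) : ℝ := √((2 - r ^ 2 + r ^ k) / 2)

theorem imNorm_arg_pos {r : ℝ} (hr : r ∈ Ioc (0 : ℝ) 1) : 0 < (2 - r ^ 2 + r ^ k) / 2 := by
  have h1 := pow_pos hr.1 k
  nlinarith [hr.1, hr.2]

theorem imNorm_pos {r : ℝ} (hr : r ∈ Ioc (0 : ℝ) 1) : 0 < imNorm k r :=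
  Real.sqrt_pos.2 (imNorm_arg_pos hr)

theorem imNorm_sq {r : ℝ} (hr : r ∈ Ioc (0 : ℝ) 1) : imNorm k r ^ 2 = (2 - r ^ 2 + r ^ k) / 2 :=
  Real.sq_sqrt (imNorm_arg_pos hr).le

theorem contDiffAt_imNorm {r : ℝ} (hr : r ∈ Ioc (0 : ℝ) 1) : ContDiffAt ℝ ∞ (imNorm k) r :=
  (((contDiffAt_const.sub (contDiffAt_id.pow 2)).add (contDiffAt_id.pow k)).div_const 2).sqrt
    (imNorm_arg_pos hr).ne'

theorem partsProduct_eq (k : ℕ) {r : ℝ} (hr : r ∈ Ioc (0 : ℝ) 1) :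
    partsProduct k r = imNorm k r ^ 2 * ((2 - r ^ 2 - r ^ k) / 2) := by
  rw [imNorm_sq hr, partsProduct, pow_mul']
  ring

theorem partsProductInv_partsProduct {r : ℝ} (hr : r ∈ Ioc (0 : ℝ) 1) :
    partsProductInv k (partsProduct k r) = r :=
  partsProductInv_leftInvOn ⟨hr.1, hr.2.trans_lt (by norm_num)⟩

/-- The modulus of `z₀` at the points of `W_k` which correspond to covectors of norm `s`. -/
def torusModulus (k : ℕ) (f : ℝ → ℝ) (s : ℝ) : ℝ :=
  partsProductInv k ((Real.pi * k * twistScale f s) ^ 2)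

/-- The argument πkσ(s) lies in [0, 1), so its square is a value of |ξ|²|η|² at some r in (0, 1].
This justifies the use of the inverse function. -/
theorem IsTwistProfile.torusModulus_spec (h : IsTwistProfile k f) (hk : 1 ≤ k) {s : ℝ}
    (hs : 0 ≤ s) : torusModulus k f s ∈ Ioc (0 : ℝ) 1 ∧
      partsProduct k (torusModulus k f s) = (Real.pi * k * twistScale f s) ^ 2 := by
  have h1 : 0 ≤ Real.pi * k * twistScale f s :=
    mul_nonneg (by positivity) (div_nonneg hs (h.potential_pos s).le)
  obtain ⟨r, hr, hrm⟩ := exists_partsProduct_eq hk (sq_nonneg (Real.pi * k * twistScale f s))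
    (by have := h.scale_lt s; nlinarith)
  have h2 : torusModulus k f s = r := by
    rw [torusModulus, ← hrm, partsProductInv_partsProduct hr]
  rw [h2]
  exact ⟨hr, hrm⟩

theorem IsTwistProfile.contDiffAt_potential_norm (h : IsTwistProfile k f)
    (p : EuclideanSpace ℝ (Fin n)) :
    ContDiffAt ℝ ∞ (fun p : EuclideanSpace ℝ (Fin n) => twistPotential f ‖p‖) p := by
  obtain ⟨a, ha, hfa⟩ := h.near_zero
  exact BrieskornBook.contDiffAt_comp_norm ha (fun r hr => potential_eq_one ha hfa hr)
    h.contDiff_potential.contDiffAt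

/-- The square is what makes this smooth on the zero section: it is a constant times |p|²/Φ(|p|)²,
with Φ constant near 0. -/
theorem IsTwistProfile.contDiffAt_torusModulus_norm (h : IsTwistProfile k f) (hk : 1 ≤ k)
    (p : EuclideanSpace ℝ (Fin n)) :
    ContDiffAt ℝ ∞ (fun p : EuclideanSpace ℝ (Fin n) => torusModulus k f ‖p‖) p := by
  obtain ⟨h1, h2⟩ := h.torusModulus_spec hk (norm_nonneg p)
  have h3 : ContDiffAt ℝ ∞
      (fun p : EuclideanSpace ℝ (Fin n) => (Real.pi * k * twistScale f ‖p‖) ^ 2) p := by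
    have h4 : ContDiffAt ℝ ∞ (fun p : EuclideanSpace ℝ (Fin n) =>
        (Real.pi * k) ^ 2 * (‖p‖ ^ 2 * (twistPotential f ‖p‖)⁻¹ ^ 2)) p :=
      contDiffAt_const.mul ((contDiff_norm_sq ℝ).contDiffAt.mul
        (((h.contDiffAt_potential_norm p).inv (h.potential_pos _).ne').pow 2))
    refine h4.congr_of_eventuallyEq (Eventually.of_forall fun q => ?_)
    simp only [twistScale]
    ring
  refine ContDiffAt.comp (g := partsProductInv k) p ?_ h3
  rw [← h2]
  exact contDiffAt_partsProductInv ⟨h1.1, h1.2.trans_lt (by norm_num)⟩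

/-- The coefficient of the real part in `torusMap`. -/
def torusCoeff (k : ℕ) (f : ℝ → ℝ) (s : ℝ) : ℝ :=
  Real.pi * k / (twistPotential f s * imNorm k (torusModulus k f s))

/-- This is the choice of ab that turns 4πk dt + 4ab P·dQ into a multiple of β_k. -/
theorem IsTwistProfile.torusCoeff_mul (h : IsTwistProfile k f) (hk : 1 ≤ k) {s : ℝ} (hs : 0 ≤ s) :
    torusCoeff k f s * imNorm k (torusModulus k f s) = Real.pi * k / twistPotential f s := by
  have h1 := imNorm_pos (k := k) (h.torusModulus_spec hk hs).1
  have h2 := h.potential_pos s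
  rw [torusCoeff]
  field_simp

theorem IsTwistProfile.torusCoeff_sq (h : IsTwistProfile k f) (hk : 1 ≤ k) {s : ℝ} (hs : 0 ≤ s) :
    torusCoeff k f s ^ 2 * s ^ 2 =
      (2 - torusModulus k f s ^ 2 - torusModulus k f s ^ k) / 2 := by
  obtain ⟨h1, h2⟩ := h.torusModulus_spec hk hs
  have h3 := imNorm_pos (k := k) h1
  have h4 := h.potential_pos s
  rw [partsProduct_eq k h1] at h2
  apply mul_left_cancel₀ (pow_pos h3 2).ne'
  rw [h2, twistScale, torusCoeff]
  field_simp

/-- The lift to `ℝ × T^*S^{n-1}` of the contactomorphism from the mapping torus to `W_k \ B`. -/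
def torusMap (k : ℕ) (f : ℝ → ℝ) (y : ℝ × EuclideanSpace ℝ (Fin n) × EuclideanSpace ℝ (Fin n)) :
    EuclideanSpace ℂ (Fin (n + 1)) :=
  polarPoint k y.1 (torusModulus k f ‖y.2.2‖) (torusCoeff k f ‖y.2.2‖)
    (imNorm k (torusModulus k f ‖y.2.2‖)) (geodesicRotation (-(y.1 * f ‖y.2.2‖)) y.2)

theorem IsTwistProfile.sin_eq_zero (h : IsTwistProfile k f) {p : EuclideanSpace ℝ (Fin n)}
    (hp : p = 0) (t : ℝ) : Real.sin (t * f ‖p‖) = 0 := by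
  rw [hp, norm_zero, h.apply_zero, mul_zero, Real.sin_zero]

theorem IsTwistProfile.torusMap_mem (h : IsTwistProfile k f) (hk : 1 ≤ k) (t : ℝ)
    {x : EuclideanSpace ℝ (Fin n) × EuclideanSpace ℝ (Fin n)} (hx : x ∈ cotangentSphere n) :
    torusMap k f (t, x) ∈ brieskorn n k \ binding n k := by
  obtain ⟨h1, -⟩ := h.torusModulus_spec hk (norm_nonneg x.2)
  have h2 := h.torusCoeff_sq hk (norm_nonneg x.2)
  have h3 := imNorm_sq (k := k) h1
  have h4 := norm_geodesicRotation_fst (c := -(t * f ‖x.2‖)) hx.1 hx.2 fun hp => by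
    rw [Real.sin_neg, h.sin_eq_zero hp, neg_zero]
  have h5 := norm_geodesicRotation_snd (c := -(t * f ‖x.2‖)) hx.1 hx.2
  rw [mem_brieskorn_diff_binding]
  refine ⟨polarPoint_mem (inner_geodesicRotation hx.1 hx.2) ?_ ?_, ?_⟩
  · simp only
    rw [h4, h5]
    linear_combination h2 - h3
  · simp only
    rw [h4, h5]
    linear_combination h2 + h3
  · exact mul_ne_zero (Complex.ofReal_ne_zero.2 h1.1.ne') (cis_ne_zero _)

theorem IsTwistProfile.contDiffAt_rotationAngle (h : IsTwistProfile k f)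
    (y : ℝ × EuclideanSpace ℝ (Fin n) × EuclideanSpace ℝ (Fin n)) :
    ContDiffAt ℝ ∞ (fun z : ℝ × EuclideanSpace ℝ (Fin n) × EuclideanSpace ℝ (Fin n) =>
      -(z.1 * f ‖z.2.2‖)) y :=
  (contDiffAt_fst.mul (ContDiffAt.comp (g := fun p => f ‖p‖)
    (f := fun z : ℝ × EuclideanSpace ℝ (Fin n) × EuclideanSpace ℝ (Fin n) => z.2.2) y
    (h.contDiffAt_comp_norm y.2.2) (contDiffAt_snd.comp y contDiffAt_snd))).neg

theorem IsTwistProfile.eventually_sin_rotationAngle (h : IsTwistProfile k f)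
    {y : ℝ × EuclideanSpace ℝ (Fin n) × EuclideanSpace ℝ (Fin n)} (hy : y.2.2 = 0) :
    ∀ᶠ z in 𝓝 y, Real.sin (-(z.1 * f ‖z.2.2‖)) = 0 := by
  have := ((continuous_snd.comp continuous_snd).tendsto y).eventually
    (show ∀ᶠ p in 𝓝 y.2.2, f ‖p‖ = 0 from hy ▸ h.eventually_eq_zero)
  filter_upwards [this] with z hz
  change f ‖z.2.2‖ = 0 at hz
  rw [hz, mul_zero, neg_zero, Real.sin_zero]

theorem contDiffAt_comp_covector {G : Type*} [NormedAddCommGroup G]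
    [NormedSpace ℝ G] {g : EuclideanSpace ℝ (Fin n) → G}
    {y : ℝ × EuclideanSpace ℝ (Fin n) × EuclideanSpace ℝ (Fin n)} (hg : ContDiffAt ℝ ∞ g y.2.2) :
    ContDiffAt ℝ ∞
      (fun z : ℝ × EuclideanSpace ℝ (Fin n) × EuclideanSpace ℝ (Fin n) => g z.2.2) y :=
  ContDiffAt.comp (g := g)
    (f := fun z : ℝ × EuclideanSpace ℝ (Fin n) × EuclideanSpace ℝ (Fin n) => z.2.2) y hg
    (contDiffAt_snd.comp y contDiffAt_snd)

theorem IsTwistProfile.contDiffAt_imNorm_norm (h : IsTwistProfile k f) (hk : 1 ≤ k)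
    (p : EuclideanSpace ℝ (Fin n)) : ContDiffAt ℝ ∞
      (fun p : EuclideanSpace ℝ (Fin n) => imNorm k (torusModulus k f ‖p‖)) p :=
  ContDiffAt.comp (g := imNorm k) p
    (contDiffAt_imNorm (h.torusModulus_spec hk (norm_nonneg p)).1)
    (h.contDiffAt_torusModulus_norm hk p)

theorem IsTwistProfile.contDiffAt_torusCoeff_norm (h : IsTwistProfile k f) (hk : 1 ≤ k)
    (p : EuclideanSpace ℝ (Fin n)) : ContDiffAt ℝ ∞
      (fun p : EuclideanSpace ℝ (Fin n) => torusCoeff k f ‖p‖) p :=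
  contDiffAt_const.mul (((h.contDiffAt_potential_norm p).mul
    (h.contDiffAt_imNorm_norm hk p)).inv (mul_pos (h.potential_pos _)
      (imNorm_pos (h.torusModulus_spec hk (norm_nonneg p)).1)).ne')

theorem IsTwistProfile.contDiffAt_torusMap (h : IsTwistProfile k f) (hk : 1 ≤ k)
    (y : ℝ × EuclideanSpace ℝ (Fin n) × EuclideanSpace ℝ (Fin n)) :
    ContDiffAt ℝ ∞ (torusMap k f) y :=
  contDiffAt_polarPoint contDiffAt_fst
    (contDiffAt_comp_covector (h.contDiffAt_torusModulus_norm hk y.2.2))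
    (contDiffAt_comp_covector (h.contDiffAt_torusCoeff_norm hk y.2.2))
    (contDiffAt_comp_covector (h.contDiffAt_imNorm_norm hk y.2.2))
    (contDiffAt_geodesicRotation (h.contDiffAt_rotationAngle y) contDiffAt_snd
      fun hy => h.eventually_sin_rotationAngle hy)

/-- With ab = πk/Φ and P·dQ = p·dq - |p| d(t f), the coefficient of dt becomes Φ - |p| f = h after
division by 4πk/Φ; the other terms of β_k are already present. -/
theorem IsTwistProfile.brieskornForm_torusMap (h : IsTwistProfile k f) (hk : 1 ≤ k)
    {y v : ℝ × EuclideanSpace ℝ (Fin n) × EuclideanSpace ℝ (Fin n)}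
    (hy : y ∈ (univ : Set ℝ) ×ˢ cotangentSphere n)
    (hv : v ∈ tangentAt ((univ : Set ℝ) ×ˢ cotangentSphere n) y) :
    brieskornForm n k (torusMap k f y)
      (fderivWithin ℝ (torusMap k f) ((univ : Set ℝ) ×ˢ cotangentSphere n) y v) =
      4 * Real.pi * k / twistPotential f ‖y.2.2‖ * torusForm n f y v := by
  have hLd := ((h.contDiffAt_torusMap hk y).differentiableAt (by simp)).hasFDerivAt
  rw [fderivWithin_apply_of_mem_tangentAt hLd.hasFDerivWithinAt hv]
  have hcs := h.contDiffAt_rotationAngle y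
  have hev := fun hy => h.eventually_sin_rotationAngle (n := n) (y := y) hy
  set c : ℝ × EuclideanSpace ℝ (Fin n) × EuclideanSpace ℝ (Fin n) → ℝ :=
    fun a => -(a.1 * f ‖a.2.2‖) with hc
  set R := fun a : ℝ × EuclideanSpace ℝ (Fin n) × EuclideanSpace ℝ (Fin n) =>
    geodesicRotation (c a) a.2 with hR
  have hRd : HasFDerivAt R (fderiv ℝ R y) y :=
    ((contDiffAt_geodesicRotation hcs contDiffAt_snd hev).differentiableAt (by simp)).hasFDerivAt
  have hinner : inner ℝ (R y).2 (fderiv ℝ R y v).1 = _ :=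
    inner_fderiv_geodesicRotation hcs hev hy hv
  have hp : HasFDerivAt
      (fun a : ℝ × EuclideanSpace ℝ (Fin n) × EuclideanSpace ℝ (Fin n) => a.2.2)
      ((ContinuousLinearMap.snd ℝ _ _).comp (ContinuousLinearMap.snd ℝ _ _)) y :=
    hasFDerivAt_snd.comp y hasFDerivAt_snd
  have hcd : fderiv ℝ c y v = -(f ‖y.2.2‖ * v.1 +
      y.1 * fderiv ℝ (fun a : EuclideanSpace ℝ (Fin n) => f ‖a‖) y.2.2 v.2.2) := by
    have hcF : HasFDerivAt c _ y := (hasFDerivAt_fst.mul (h.hasFDerivAt_comp_norm hp)).neg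
    rw [hcF.fderiv, add_comm]
    rfl
  have hsin : ∀ a : ℝ × EuclideanSpace ℝ (Fin n) × EuclideanSpace ℝ (Fin n), a.2.2 = 0 →
      Real.sin (c a) = 0 := fun a ha => by rw [hc, Real.sin_neg, h.sin_eq_zero ha, neg_zero]
  have h2 : inner ℝ (R y).1 (fderiv ℝ R y v).2 + inner ℝ (fderiv ℝ R y v).1 (R y).2 = 0 := by
    have := fderiv_eq_zero_of_const (c := 0)
      (((hasFDerivAt_fst (𝕜 := ℝ) (p := R y)).comp y hRd).inner ℝ
        ((hasFDerivAt_snd (𝕜 := ℝ) (p := R y)).comp y hRd))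
      (fun a ha => inner_geodesicRotation ha.2.1 ha.2.2) hy hv
    simp only [ContinuousLinearMap.comp_apply, ContinuousLinearMap.prod_apply,
      fderivInnerCLM_apply, ContinuousLinearMap.coe_fst', ContinuousLinearMap.coe_snd'] at this
    exact this
  have hline {G : Type} [NormedAddCommGroup G] [NormedSpace ℝ G]
      {g : ℝ × EuclideanSpace ℝ (Fin n) × EuclideanSpace ℝ (Fin n) → G}
      (hg : ContDiffAt ℝ ∞ g y) :
      HasDerivAt (fun ε : ℝ => g (y + ε • v)) (fderiv ℝ g y v) 0 :=
    (hg.differentiableAt (by simp)).hasFDerivAt.hasLineDerivAt v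
  have hy0 : y + (0 : ℝ) • v = y := by simp
  obtain ⟨hr, -⟩ := h.torusModulus_spec hk (norm_nonneg y.2.2)
  have key := brieskornForm_polarPoint (k := k) (w := fderiv ℝ (torusMap k f) y v)
    (hline contDiffAt_fst)
    (hline (contDiffAt_comp_covector (h.contDiffAt_torusModulus_norm hk y.2.2)))
    (hline (contDiffAt_comp_covector (h.contDiffAt_torusCoeff_norm hk y.2.2)))
    (hline (contDiffAt_comp_covector (h.contDiffAt_imNorm_norm hk y.2.2)))
    (hRd.hasLineDerivAt v) (hLd.hasLineDerivAt v)
    (by rw [hy0]; exact inner_geodesicRotation hy.2.1 hy.2.2)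
    (by rw [hy0]; exact h2)
    (by
      rw [hy0, norm_geodesicRotation_fst hy.2.1 hy.2.2 (hsin y),
        norm_geodesicRotation_snd hy.2.1 hy.2.2]
      linear_combination h.torusCoeff_sq hk (norm_nonneg y.2.2) + imNorm_sq (k := k) hr)
  rw [hy0, h.torusCoeff_mul hk (norm_nonneg _)] at key
  change _ = 4 * Real.pi * k * fderiv ℝ (fun a : ℝ × EuclideanSpace ℝ (Fin n) ×
    EuclideanSpace ℝ (Fin n) => a.1) y v + _ * inner ℝ (R y).2 (fderiv ℝ R y v).1 at key
  refine Eq.trans key ?_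
  rw [hinner, hcd, fderiv_fst, torusForm_apply, ContinuousLinearMap.coe_fst']
  have h5 := h.potential_pos ‖y.2.2‖
  have h6 := h.potential_eq ‖y.2.2‖
  field_simp
  linear_combination v.1 * h6

/-- The flow for time -(t + 1)f after the twist by πk + f is the flow for time πk - t f. It gives
the sign (-1)^k, which exp(πik) cancels. -/
theorem IsTwistProfile.torusMap_dehnTwist (h : IsTwistProfile k f) (t : ℝ)
    {x : EuclideanSpace ℝ (Fin n) × EuclideanSpace ℝ (Fin n)} (hx : x ∈ cotangentSphere n) :
    torusMap k f (t + 1, dehnTwist n k f x) = torusMap k f (t, x) := by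
  have hs : ‖(dehnTwist n k f x).2‖ = ‖x.2‖ := norm_geodesicRotation_snd hx.1 hx.2
  have hz (hp : x.2 = 0) (c : ℝ) : Real.sin (c * f ‖x.2‖) = 0 := h.sin_eq_zero hp c
  have hπ := sin_pi_mul_natCast k
  have h1 : geodesicRotation (-((t + 1) * f ‖x.2‖)) (dehnTwist n k f x) =
      Real.cos (Real.pi * k) • geodesicRotation (-(t * f ‖x.2‖)) x := by
    rw [dehnTwist_eq, geodesicRotation_geodesicRotation hx.1 hx.2 (fun hp => by
      have := hz hp 1
      rw [one_mul] at this
      rw [Real.sin_add, hπ, this]; ring), ← geodesicRotation_of_sin_eq_zero hπ,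
      geodesicRotation_geodesicRotation hx.1 hx.2 (fun hp => by
        rw [Real.sin_neg, hz hp, neg_zero])]
    congr 1
    ring
  have h2 : (Real.cos (Real.pi * k) : ℂ) * Real.cos (Real.pi * k) = 1 := by
    have := Real.sin_sq_add_cos_sq (Real.pi * k)
    rw [hπ] at this
    exact_mod_cast (by linarith : Real.cos (Real.pi * k) * Real.cos (Real.pi * k) = 1)
  have h3 : cis (2 * Real.pi * (t + 1)) = cis (2 * Real.pi * t) := by
    rw [mul_add, mul_one, cis_add, cis_eq_cos (x := 2 * Real.pi) (by simp)]
    simp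
  simp only [torusMap, hs, h1, polarPoint, h3]
  refine ext_tail rfl ?_
  rw [tail_cvec, tail_cvec]
  ext j
  simp only [Pi.smul_apply, smul_eq_mul, reIm, Prod.smul_snd, Prod.smul_fst, PiLp.smul_apply,
    mul_add (Real.pi * k), mul_one, cis_add, cis_eq_cos hπ]
  push_cast at h2 ⊢
  linear_combination (cis (Real.pi * k * t) * (torusCoeff k f ‖x.2‖ *
    (geodesicRotation (-(t * f ‖x.2‖)) x).2 j + imNorm k (torusModulus k f ‖x.2‖) *
    (geodesicRotation (-(t * f ‖x.2‖)) x).1 j * Complex.I)) * h2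

end TorusMap

/-! ### The inverse of the lift for a chosen angle t. -/

section TorusInverse

variable {n k : ℕ} {f : ℝ → ℝ}

/-- The coordinates `z₁, …, zₙ` rotated by `exp (- π i k t)`. -/
def untwist (k : ℕ) (t : ℝ) (z : EuclideanSpace ℂ (Fin (n + 1))) : Fin n → ℂ :=
  cis (-(Real.pi * k * t)) • tail z

theorem untwist_spec {t : ℝ} {z : EuclideanSpace ℂ (Fin (n + 1))}
    (hz : z ∈ brieskorn n k \ binding n k) (ht : z 0 = ‖z 0‖ * cis (2 * Real.pi * t)) :
    ‖z 0‖ ∈ Ioc (0 : ℝ) 1 ∧ inner ℝ (imVec (untwist k t z)) (reVec (untwist k t z)) = 0 ∧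
      ‖imVec (untwist k t z)‖ = imNorm k ‖z 0‖ ∧
      (imNorm k ‖z 0‖ * ‖reVec (untwist k t z)‖) ^ 2 = partsProduct k ‖z 0‖ := by
  obtain ⟨hz, hz0⟩ := mem_brieskorn_diff_binding.1 hz
  obtain ⟨h1, h2⟩ := mem_brieskorn.1 hz
  have hr : 0 < ‖z 0‖ := norm_pos_iff.2 hz0
  set r := ‖z 0‖ with hrdef
  have hu : tail z = cis (Real.pi * k * t) • untwist k t z := by
    rw [untwist, smul_smul, mul_comm, cis_neg_mul_cis, one_smul]
  set u := untwist k t z with hudef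
  have hri := reIm_reVec_imVec u
  have h3 : cis (Real.pi * k * t) ^ 2 * ((r : ℂ) ^ k + u ⬝ᵥ u) = 0 := by
    rw [ht, hu, smul_dotProduct, dotProduct_smul, mul_pow, cis_pow,
      show (k : ℝ) * (2 * Real.pi * t) = Real.pi * k * t + Real.pi * k * t by ring, cis_add,
      smul_eq_mul, smul_eq_mul] at h1
    linear_combination h1
  have h4 := (mul_eq_zero.1 h3).resolve_left (pow_ne_zero 2 (cis_ne_zero _))
  rw [← hri, reIm_dotProduct, ← Complex.ofReal_pow] at h4
  have h5 := congrArg Complex.re h4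
  have h6 := congrArg Complex.im h4
  rw [hu, star_smul, smul_dotProduct, dotProduct_smul, star_cis, smul_smul, smul_eq_mul,
    cis_neg_mul_cis, one_mul, ← hri, star_reIm_dotProduct, Complex.normSq_eq_norm_sq] at h2
  rw [← hrdef] at h2
  simp only [Complex.add_re, Complex.add_im, Complex.ofReal_re, Complex.ofReal_im, Complex.mul_re,
    Complex.mul_im, Complex.I_re, Complex.I_im, real_inner_self_eq_norm_sq, Complex.zero_re,
    Complex.zero_im, mul_zero, mul_one, sub_zero, add_zero, zero_add] at h2 h5 h6
  -- The two equations give 2|ξ|² = 2 - r² - r^k, which is negative for r > 1.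
  have h7 : r ≤ 1 := by
    by_contra! h
    have h8 := one_le_pow₀ h.le (n := k)
    nlinarith [sq_nonneg ‖reVec u‖]
  have hr' : r ∈ Ioc (0 : ℝ) 1 := ⟨hr, h7⟩
  have h8 : ‖imVec u‖ ^ 2 = imNorm k r ^ 2 := by
    rw [imNorm_sq hr']; linarith
  refine ⟨hr', ?_, (sq_eq_sq₀ (norm_nonneg _) (imNorm_pos hr').le).1 h8, ?_⟩
  · linarith [real_inner_comm (imVec u) (reVec u)]
  · rw [mul_pow, partsProduct_eq k hr']
    congr 1
    linarith

/-- The real part of `untwist k t z`, normalized such that its norm is `twistScale` of the norm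
of the corresponding covector. -/
def scaledCovector (k : ℕ) (t : ℝ) (z : EuclideanSpace ℂ (Fin (n + 1))) :
    EuclideanSpace ℝ (Fin n) :=
  (imNorm k ‖z 0‖ / (Real.pi * k)) • reVec (untwist k t z)

/-- The image of `z` in `T^*S^{n-1}` before the geodesic rotation. -/
def rotatedCovector (k : ℕ) (f : ℝ → ℝ) (t : ℝ) (z : EuclideanSpace ℂ (Fin (n + 1))) :
    EuclideanSpace ℝ (Fin n) × EuclideanSpace ℝ (Fin n) :=
  ((imNorm k ‖z 0‖)⁻¹ • imVec (untwist k t z),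
    twistPotential f (twistScaleInv f ‖scaledCovector k t z‖) • scaledCovector k t z)

/-- The inverse of `torusMap k f` for fixed `t`. -/
def torusInv (k : ℕ) (f : ℝ → ℝ) (y : ℝ × EuclideanSpace ℂ (Fin (n + 1))) :
    EuclideanSpace ℝ (Fin n) × EuclideanSpace ℝ (Fin n) :=
  geodesicRotation (y.1 * f ‖(rotatedCovector k f y.1 y.2).2‖) (rotatedCovector k f y.1 y.2)

theorem partsProduct_lt_one {r : ℝ} (hr : r ∈ Ioc (0 : ℝ) 1) : partsProduct k r < 1 := by
  have h1 := pow_pos hr.1 (2 * k)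
  have h2 : 0 < r ^ 2 := pow_pos hr.1 2
  have h3 : r ^ 2 ≤ 1 := pow_le_one₀ hr.1.le hr.2
  unfold partsProduct
  nlinarith

theorem pi_mul_pos (hk : 1 ≤ k) : 0 < Real.pi * k :=
  mul_pos Real.pi_pos (by exact_mod_cast hk)

theorem norm_scaledCovector_sq (hk : 1 ≤ k) {t : ℝ} {z : EuclideanSpace ℂ (Fin (n + 1))}
    (hz : z ∈ brieskorn n k \ binding n k) (ht : z 0 = ‖z 0‖ * cis (2 * Real.pi * t)) :
    (Real.pi * k * ‖scaledCovector k t z‖) ^ 2 = partsProduct k ‖z 0‖ := by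
  obtain ⟨h1, -, -, h2⟩ := untwist_spec hz ht
  have h3 := pi_mul_pos hk
  rw [← h2, scaledCovector, norm_smul, Real.norm_of_nonneg (div_nonneg (imNorm_pos h1).le h3.le)]
  congr 1
  field_simp

/-- The scaled covector should be P/Φ(|P|). Its norm is less than 1/(πk), so it equals σ(s) for some
s ≥ 0, and multiplying by Φ(s) gives a covector of norm s. -/
theorem IsTwistProfile.rotatedCovector_spec (h : IsTwistProfile k f) (hk : 1 ≤ k) {t : ℝ}
    {z : EuclideanSpace ℂ (Fin (n + 1))} (hz : z ∈ brieskorn n k \ binding n k)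
    (ht : z 0 = ‖z 0‖ * cis (2 * Real.pi * t)) :
    rotatedCovector k f t z ∈ cotangentSphere n ∧
      twistScale f ‖(rotatedCovector k f t z).2‖ = ‖scaledCovector k t z‖ := by
  obtain ⟨h1, h2, h3, h4⟩ := untwist_spec hz ht
  have h5 := imNorm_pos (k := k) h1
  have h6 : Real.pi * k * ‖scaledCovector k t z‖ < 1 := by
    have := norm_scaledCovector_sq hk hz ht
    have h7 := partsProduct_lt_one (k := k) h1
    rw [← this] at h7
    exact (sq_lt_one_iff₀ (mul_nonneg (pi_mul_pos hk).le (norm_nonneg _))).1 h7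
  obtain ⟨σ, hσ0, hσ⟩ := h.exists_scale_eq (norm_nonneg _) h6
  have h8 := h.potential_pos σ
  have h9 : ‖(rotatedCovector k f t z).2‖ = σ := by
    rw [rotatedCovector, ← hσ, h.scaleInv_scale, norm_smul, Real.norm_of_nonneg h8.le, ← hσ,
      twistScale, mul_div_cancel₀ _ h8.ne']
  refine ⟨⟨?_, ?_⟩, by rw [h9, hσ]⟩
  · simp only [rotatedCovector]
    rw [norm_smul, h3, norm_inv, Real.norm_of_nonneg h5.le, inv_mul_cancel₀ h5.ne']
  · simp only [rotatedCovector, scaledCovector, inner_smul_left, inner_smul_right, h2, mul_zero]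

theorem IsTwistProfile.torusInv_mem (h : IsTwistProfile k f) (hk : 1 ≤ k) {t : ℝ}
    {z : EuclideanSpace ℂ (Fin (n + 1))} (hz : z ∈ brieskorn n k \ binding n k)
    (ht : z 0 = ‖z 0‖ * cis (2 * Real.pi * t)) : torusInv k f (t, z) ∈ cotangentSphere n :=
  geodesicRotation_mem (h.rotatedCovector_spec hk hz ht).1 fun hp => h.sin_eq_zero hp t

theorem IsTwistProfile.torusMap_torusInv (h : IsTwistProfile k f) (hk : 1 ≤ k) {t : ℝ}
    {z : EuclideanSpace ℂ (Fin (n + 1))} (hz : z ∈ brieskorn n k \ binding n k)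
    (ht : z 0 = ‖z 0‖ * cis (2 * Real.pi * t)) : torusMap k f (t, torusInv k f (t, z)) = z := by
  obtain ⟨h1, h2, h3, h4⟩ := untwist_spec hz ht
  obtain ⟨h5, h6⟩ := h.rotatedCovector_spec hk hz ht
  have h7 := imNorm_pos (k := k) h1
  have h8 : ‖(torusInv k f (t, z)).2‖ = ‖(rotatedCovector k f t z).2‖ :=
    norm_geodesicRotation_snd h5.1 h5.2
  have h9 : torusModulus k f ‖(rotatedCovector k f t z).2‖ = ‖z 0‖ := by
    rw [torusModulus, h6, norm_scaledCovector_sq hk hz ht, partsProductInv_partsProduct h1]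
  have h10 : geodesicRotation (-(t * f ‖(rotatedCovector k f t z).2‖)) (torusInv k f (t, z)) =
      rotatedCovector k f t z := by
    rw [torusInv, geodesicRotation_geodesicRotation h5.1 h5.2 (fun hp => h.sin_eq_zero hp t),
      neg_add_cancel, geodesicRotation_of_sin_eq_zero Real.sin_zero, Real.cos_zero, one_smul]
  have h11 : imNorm k ‖z 0‖ • (rotatedCovector k f t z).1 = imVec (untwist k t z) :=
    smul_inv_smul₀ h7.ne' _
  have h12 : torusCoeff k f ‖(rotatedCovector k f t z).2‖ • (rotatedCovector k f t z).2 =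
      reVec (untwist k t z) := by
    have h13 := h.potential_pos ‖(rotatedCovector k f t z).2‖
    have h14 := pi_mul_pos hk
    have h15 : twistScaleInv f ‖scaledCovector k t z‖ = ‖(rotatedCovector k f t z).2‖ := by
      rw [← h6, h.scaleInv_scale]
    have h16 : (rotatedCovector k f t z).2 =
        twistPotential f ‖(rotatedCovector k f t z).2‖ • scaledCovector k t z := by
      rw [← h15]; rfl
    rw [torusCoeff, h9]
    nth_rewrite 2 [h16]
    rw [scaledCovector, smul_smul, smul_smul]
    convert one_smul ℝ _ using 2
    field_simp
  rw [torusMap]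
  simp only
  rw [h8, h9, h10, polarPoint, h11, h12, reIm_reVec_imVec, untwist, smul_smul, mul_comm (cis _),
    cis_neg_mul_cis, one_smul]
  exact ext_tail (by rw [cvec_zero, ← ht]) rfl

theorem IsTwistProfile.torusInv_torusMap (h : IsTwistProfile k f) (hk : 1 ≤ k) (t : ℝ)
    {x : EuclideanSpace ℝ (Fin n) × EuclideanSpace ℝ (Fin n)} (hx : x ∈ cotangentSphere n) :
    torusInv k f (t, torusMap k f (t, x)) = x := by
  obtain ⟨h1, -⟩ := h.torusModulus_spec hk (norm_nonneg x.2)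
  have h2 := imNorm_pos (k := k) h1
  have h3 := h.potential_pos ‖x.2‖
  have h4 := pi_mul_pos hk
  have hsin (hp : x.2 = 0) : Real.sin (-(t * f ‖x.2‖)) = 0 := by
    rw [Real.sin_neg, h.sin_eq_zero hp, neg_zero]
  have h5 := norm_geodesicRotation_snd (c := -(t * f ‖x.2‖)) hx.1 hx.2
  set R := geodesicRotation (-(t * f ‖x.2‖)) x with hR
  have h6 : ‖torusMap k f (t, x) 0‖ = torusModulus k f ‖x.2‖ := by
    change ‖(torusModulus k f ‖x.2‖ : ℂ) * cis (2 * Real.pi * t)‖ = _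
    rw [norm_mul, norm_cis, mul_one, Complex.norm_real, Real.norm_of_nonneg h1.1.le]
  have h7 : untwist k t (torusMap k f (t, x)) =
      reIm (torusCoeff k f ‖x.2‖ • R.2) (imNorm k (torusModulus k f ‖x.2‖) • R.1) := by
    rw [untwist, torusMap, polarPoint, tail_cvec, smul_smul, cis_neg_mul_cis, one_smul]
  have h8 : scaledCovector k t (torusMap k f (t, x)) = (twistPotential f ‖x.2‖)⁻¹ • R.2 := by
    rw [scaledCovector, h6, h7, reVec_reIm, smul_smul, torusCoeff]
    congr 1
    field_simp
  have h9 : ‖scaledCovector k t (torusMap k f (t, x))‖ = twistScale f ‖x.2‖ := by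
    rw [h8, norm_smul, norm_inv, Real.norm_of_nonneg h3.le, h5, twistScale]
    field_simp
  have h10 : rotatedCovector k f t (torusMap k f (t, x)) = R := by
    rw [rotatedCovector, h9, h.scaleInv_scale, h8, h6, h7, imVec_reIm, inv_smul_smul₀ h2.ne',
      smul_inv_smul₀ h3.ne']
  rw [torusInv]
  simp only
  rw [h10, h5, hR, geodesicRotation_geodesicRotation hx.1 hx.2 hsin, add_neg_cancel,
    geodesicRotation_of_sin_eq_zero Real.sin_zero, Real.cos_zero, one_smul]

/-- Below the radius where f starts, Φ = 1 and σ is the identity, so this function of the norm is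
constant near the origin. -/
theorem IsTwistProfile.contDiffAt_potential_scaleInv_norm (h : IsTwistProfile k f) {s : ℝ}
    {p : EuclideanSpace ℝ (Fin n)} (hp : twistScale f s = ‖p‖) :
    ContDiffAt ℝ ∞
      (fun p : EuclideanSpace ℝ (Fin n) => twistPotential f (twistScaleInv f ‖p‖)) p := by
  obtain ⟨a, ha, hfa⟩ := h.near_zero
  refine BrieskornBook.contDiffAt_comp_norm (φ := fun r => twistPotential f (twistScaleInv f r))
    (c := 1) ha (fun r hr => ?_) ?_
  · have h1 : twistScale f r = r := by rw [twistScale, potential_eq_one ha hfa hr, div_one]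
    have h2 : twistScaleInv f r = r := by
      nth_rewrite 1 [← h1]
      exact h.scaleInv_scale r
    rw [h2, potential_eq_one ha hfa hr]
  · refine ContDiffAt.comp (g := twistPotential f) ‖p‖ h.contDiff_potential.contDiffAt ?_
    rw [← hp]
    exact h.contDiffAt_scaleInv s

theorem IsTwistProfile.contDiffAt_torusInv (h : IsTwistProfile k f) (hk : 1 ≤ k) {t : ℝ}
    {z : EuclideanSpace ℂ (Fin (n + 1))} (hz : z ∈ brieskorn n k \ binding n k)
    (ht : z 0 = ‖z 0‖ * cis (2 * Real.pi * t)) : ContDiffAt ℝ ∞ (torusInv (n := n) k f) (t, z) := by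
  obtain ⟨h1, -⟩ := untwist_spec hz ht
  have h2 := (h.rotatedCovector_spec hk hz ht).2
  have hz0 := (mem_brieskorn_diff_binding.1 hz).2
  have hcoord (i : Fin (n + 1)) : ContDiffAt ℝ ∞
      (fun y : ℝ × EuclideanSpace ℂ (Fin (n + 1)) => y.2 i) (t, z) :=
    (contDiff_apply i).contDiffAt.comp (t, z) contDiffAt_snd
  have hu (j : Fin n) : ContDiffAt ℝ ∞
      (fun y : ℝ × EuclideanSpace ℂ (Fin (n + 1)) => untwist k y.1 y.2 j) (t, z) :=
    ContDiffAt.mul (ContDiffAt.comp (g := cis)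
      (f := fun y : ℝ × EuclideanSpace ℂ (Fin (n + 1)) => -(Real.pi * k * y.1)) (t, z)
      contDiff_cis.contDiffAt (contDiffAt_const.mul contDiffAt_fst).neg) (hcoord j.succ)
  have hA : ContDiffAt ℝ ∞
      (fun y : ℝ × EuclideanSpace ℂ (Fin (n + 1)) => imNorm k ‖y.2 0‖) (t, z) :=
    ContDiffAt.comp (g := imNorm k)
      (f := fun y : ℝ × EuclideanSpace ℂ (Fin (n + 1)) => ‖y.2 0‖) (t, z)
      (contDiffAt_imNorm h1) ((hcoord 0).norm ℝ hz0)
  have hv : ContDiffAt ℝ ∞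
      (fun y : ℝ × EuclideanSpace ℂ (Fin (n + 1)) => scaledCovector k y.1 y.2) (t, z) :=
    (hA.div_const _).smul (contDiffAt_reVec hu)
  have hR : ContDiffAt ℝ ∞
      (fun y : ℝ × EuclideanSpace ℂ (Fin (n + 1)) => rotatedCovector k f y.1 y.2) (t, z) :=
    ((hA.inv (imNorm_pos h1).ne').smul (contDiffAt_imVec hu)).prodMk
      ((ContDiffAt.comp (g := fun p => twistPotential f (twistScaleInv f ‖p‖))
        (f := fun y : ℝ × EuclideanSpace ℂ (Fin (n + 1)) => scaledCovector k y.1 y.2) (t, z)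
        (h.contDiffAt_potential_scaleInv_norm h2) hv).smul hv)
  have hP : ContDiffAt ℝ ∞
      (fun y : ℝ × EuclideanSpace ℂ (Fin (n + 1)) => (rotatedCovector k f y.1 y.2).2) (t, z) :=
    contDiffAt_snd.comp (t, z) hR
  refine contDiffAt_geodesicRotation (contDiffAt_fst.mul (ContDiffAt.comp (g := fun p => f ‖p‖)
    (f := fun y : ℝ × EuclideanSpace ℂ (Fin (n + 1)) => (rotatedCovector k f y.1 y.2).2) (t, z)
    (h.contDiffAt_comp_norm _) hP)) hR fun h0 => ?_
  have h0 : (rotatedCovector k f t z).2 = 0 := h0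
  have := hP.continuousAt.eventually
    (show ∀ᶠ p in 𝓝 (rotatedCovector k f t z).2, f ‖p‖ = 0 from h0 ▸ h.eventually_eq_zero)
  filter_upwards [this] with y hy
  rw [hy, mul_zero, Real.sin_zero]

end TorusInverse

/-! ### The map on the mapping torus is a contactomorphism over the circle. -/

section Monodromy

variable {n k : ℕ} {f : ℝ → ℝ}

theorem IsTwistProfile.fibration_torusMap (h : IsTwistProfile k f) (hk : 1 ≤ k)
    (y : ℝ × EuclideanSpace ℝ (Fin n) × EuclideanSpace ℝ (Fin n)) :
    fibration n (torusMap k f y) = cis (2 * Real.pi * y.1) := by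
  have h1 : (0 : ℝ) < torusModulus k f ‖y.2.2‖ := (h.torusModulus_spec hk (norm_nonneg y.2.2)).1.1
  change (torusModulus k f ‖y.2.2‖ : ℂ) * cis (2 * Real.pi * y.1) /
    ((‖(torusModulus k f ‖y.2.2‖ : ℂ) * cis (2 * Real.pi * y.1)‖ : ℝ) : ℂ) = _
  rw [norm_mul, norm_cis, mul_one, Complex.norm_real, Real.norm_of_nonneg h1.le]
  have : (torusModulus k f ‖y.2.2‖ : ℂ) ≠ 0 := Complex.ofReal_ne_zero.2 h1.ne'
  field_simp

theorem eq_norm_mul_cis_arg (w : ℂ) : w = ‖w‖ * cis (2 * Real.pi * (w.arg / (2 * Real.pi))) := by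
  rw [mul_div_cancel₀ _ Real.two_pi_pos.ne', cis, Complex.norm_mul_exp_arg_mul_I]

theorem exists_int_of_cis_eq {s t : ℝ} (h : cis (2 * Real.pi * s) = cis (2 * Real.pi * t)) :
    ∃ m : ℤ, s = t + m := by
  obtain ⟨m, hm⟩ := Complex.exp_eq_exp_iff_exists_int.1 h
  refine ⟨m, ?_⟩
  have h1 : ((2 * Real.pi * s : ℝ) : ℂ) = ((2 * Real.pi * t + m * (2 * Real.pi) : ℝ) : ℂ) := by
    apply mul_right_cancel₀ Complex.I_ne_zero
    rw [hm]
    push_cast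
    ring
  have h2 := Complex.ofReal_injective h1
  apply mul_left_cancel₀ Real.two_pi_pos.ne'
  linarith

theorem MappingTorus.exists_mk_add {F : Type*} {Y : Set F} {τ : F → F} (hτ : MapsTo τ Y Y)
    (t : ℝ) (x : Y) (m : ℕ) :
    ∃ y : Y, (MappingTorus.mk t x : MappingTorus Y τ) = MappingTorus.mk (t + m) y := by
  induction m with
  | zero => exact ⟨x, by simp⟩
  | succ m ih =>
    obtain ⟨y, hy⟩ := ih
    refine ⟨⟨τ y, hτ y.2⟩, hy.trans (Quot.sound ⟨?_, rfl⟩)⟩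
    push_cast
    ring

/-- `torusMap` on the mapping torus. -/
def IsTwistProfile.torusFun (h : IsTwistProfile k f) (hk : 1 ≤ k) :
    MappingTorus (cotangentSphere n) (dehnTwist n k f) → ↥(brieskorn n k \ binding n k) :=
  Quot.lift (fun a => ⟨torusMap k f (a.1, a.2), h.torusMap_mem hk a.1 a.2.2⟩) (by
    rintro ⟨t, x⟩ ⟨t', x'⟩ ⟨h1, h2⟩
    simp only at h1 h2
    ext1
    simp only
    rw [h1, h2, h.torusMap_dehnTwist t x.2])

theorem IsTwistProfile.mk_eq_of_torusMap_eq (h : IsTwistProfile k f) (hk : 1 ≤ k) (t : ℝ)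
    (x y : cotangentSphere n) (m : ℕ)
    (hxy : torusMap k f (t, (x : EuclideanSpace ℝ (Fin n) × EuclideanSpace ℝ (Fin n))) =
      torusMap k f (t + m, (y : EuclideanSpace ℝ (Fin n) × EuclideanSpace ℝ (Fin n)))) :
    (MappingTorus.mk t x : MappingTorus (cotangentSphere n) (dehnTwist n k f)) =
      MappingTorus.mk (t + m) y := by
  obtain ⟨x', hx'⟩ := MappingTorus.exists_mk_add h.isDiffeo_dehnTwist.2.1 t x m
  have h0 : torusMap k f (t, (x : EuclideanSpace ℝ (Fin n) × EuclideanSpace ℝ (Fin n))) =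
      torusMap k f (t + m, (x' : EuclideanSpace ℝ (Fin n) × EuclideanSpace ℝ (Fin n))) :=
    congrArg (fun c => (h.torusFun hk c : EuclideanSpace ℂ (Fin (n + 1)))) hx'
  have h2 := h.torusInv_torusMap hk (t + m) x'.2
  rw [← h0, hxy, h.torusInv_torusMap hk (t + m) y.2] at h2
  rw [hx', Subtype.ext h2]

/-- Equal images have equal angles, so the times differ by an integer. The point with the smaller
time is moved forward by iterating the twist, and at equal times `torusInv` separates points. A
negative difference only exchanges the two points. -/
theorem IsTwistProfile.torusFun_injective (h : IsTwistProfile k f) (hk : 1 ≤ k) :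
    Function.Injective (h.torusFun (n := n) hk) := by
  rintro ⟨t, x⟩ ⟨s, y⟩ hxy
  have h0 : torusMap k f (t, (x : EuclideanSpace ℝ (Fin n) × EuclideanSpace ℝ (Fin n))) =
      torusMap k f (s, (y : EuclideanSpace ℝ (Fin n) × EuclideanSpace ℝ (Fin n))) :=
    congrArg Subtype.val hxy
  have h1 := congrArg (fibration n) h0
  rw [h.fibration_torusMap hk, h.fibration_torusMap hk] at h1
  obtain ⟨m, hm⟩ := exists_int_of_cis_eq h1
  simp only at hm
  obtain ⟨l, rfl | rfl⟩ := m.eq_nat_or_neg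
  · rw [Int.cast_natCast] at hm
    subst hm
    exact (h.mk_eq_of_torusMap_eq hk s y x l h0.symm).symm
  · have hm' : s = t + l := by rw [hm]; push_cast; ring
    subst hm'
    exact h.mk_eq_of_torusMap_eq hk t x y l h0

theorem IsTwistProfile.torusFun_mk_torusInv (h : IsTwistProfile k f) (hk : 1 ≤ k) {t : ℝ}
    (z : ↥(brieskorn n k \ binding n k))
    (ht : (z : EuclideanSpace ℂ (Fin (n + 1))) 0 =
      ‖(z : EuclideanSpace ℂ (Fin (n + 1))) 0‖ * cis (2 * Real.pi * t)) :
    h.torusFun hk (MappingTorus.mk t ⟨torusInv k f (t, z), h.torusInv_mem hk z.2 ht⟩) = z :=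
  Subtype.ext (h.torusMap_torusInv hk z.2 ht)

theorem IsTwistProfile.torusFun_bijective (h : IsTwistProfile k f) (hk : 1 ≤ k) :
    Function.Bijective (h.torusFun (n := n) hk) :=
  ⟨h.torusFun_injective hk, fun z => ⟨_, h.torusFun_mk_torusInv hk z (eq_norm_mul_cis_arg _)⟩⟩

theorem IsTwistProfile.exists_contactomorphism (h : IsTwistProfile k f) (hk : 1 ≤ k) :
    ∃ C : MappingTorus (cotangentSphere n) (dehnTwist n k f) ≃ ↥(brieskorn n k \ binding n k),
      IsMappingTorusContactomorphism C (torusForm n f) (brieskornForm n k) ∧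
      ∀ m, fibration n (C m) = MappingTorus.proj m := by
  refine ⟨Equiv.ofBijective _ (h.torusFun_bijective hk), ⟨⟨torusMap k f,
    fun y => 4 * Real.pi * k / twistPotential f ‖y.2.2‖,
    fun y _ => (h.contDiffAt_torusMap hk y).contDiffWithinAt, fun t x => rfl,
    fun y hy => ⟨?_, fun v hv => h.brieskornForm_torusMap hk hy hv⟩⟩, ?_⟩, ?_⟩
  · have h1 := pi_mul_pos hk
    have h2 := h.potential_pos ‖y.2.2‖
    positivity
  · intro z₀ hz₀
    have hne := (mem_brieskorn_diff_binding.1 hz₀).2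
    -- A branch of the angle centred at z₀: the fixed angle of the base point plus the principal
    -- argument of the quotient, smooth where the quotient avoids the negative axis.
    set arg' : EuclideanSpace ℂ (Fin (n + 1)) → ℝ :=
      fun z => (z₀ 0).arg / (2 * Real.pi) + (z 0 * (z₀ 0)⁻¹).arg / (2 * Real.pi) with harg
    have hcis (z : EuclideanSpace ℂ (Fin (n + 1))) : z 0 = ‖z 0‖ * cis (2 * Real.pi * arg' z) := by
      have h1 := eq_norm_mul_cis_arg (z₀ 0)
      have h2 := eq_norm_mul_cis_arg (z 0 * (z₀ 0)⁻¹)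
      rw [harg, mul_add, cis_add]
      rw [norm_mul, norm_inv] at h2
      push_cast at h2
      have h3 : (‖z₀ 0‖ : ℂ) ≠ 0 := by simpa using hne
      calc z 0 = (z 0 * (z₀ 0)⁻¹) * z₀ 0 := by field_simp
        _ = _ := by
          nth_rewrite 1 [h2]
          nth_rewrite 3 [h1]
          field_simp
    refine ⟨(fun z => z 0 * (z₀ 0)⁻¹) ⁻¹' Complex.slitPlane,
      Complex.isOpen_slitPlane.preimage ((contDiff_apply 0).continuous.mul continuous_const), ?_,
      fun z => (arg' z, torusInv k f (arg' z, z)), ?_, ?_⟩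
    · simp [hne]
    · rintro z ⟨hz, hzU⟩
      have h1 : ContDiffAt ℝ ∞ arg' z :=
        contDiffAt_const.add (ContDiffAt.div_const (ContDiffAt.comp (g := Complex.arg)
          (f := fun z : EuclideanSpace ℂ (Fin (n + 1)) => z 0 * (z₀ 0)⁻¹) z (contDiffAt_arg hzU)
          ((contDiff_apply 0).contDiffAt.mul contDiffAt_const)) _)
      have h2 : ContDiffAt ℝ ∞ (fun z => (arg' z, z)) z := h1.prodMk contDiffAt_id
      have h3 : ContDiffAt ℝ ∞ (torusInv (n := n) k f) (arg' z, z) :=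
        h.contDiffAt_torusInv hk hz (hcis z)
      have h4 : ContDiffAt ℝ ∞ (fun z => torusInv (n := n) k f (arg' z, z)) z :=
        ContDiffAt.comp (g := torusInv (n := n) k f) (f := fun z => (arg' z, z)) z h3 h2
      exact (h1.prodMk h4).contDiffWithinAt
    · intro w _
      exact ⟨⟨_, h.torusInv_mem hk w.2 (hcis w)⟩, rfl,
        (Equiv.symm_apply_eq _).2 (h.torusFun_mk_torusInv hk w (hcis w)).symm⟩
  · rintro ⟨t, x⟩
    refine (h.fibration_torusMap hk (t, x.1)).trans ?_
    change Complex.exp _ = Complex.exp _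
    congr 1
    push_cast
    ring

theorem hasDehnTwistOpenBook (hn : 2 ≤ n) (hk : 1 ≤ k) : HasDehnTwistOpenBook n k where
  open_book := isOpenBook_brieskorn hn hk
  supported := isSupportedBy_brieskorn hk
  binding_contactomorphic := binding_contactomorphic hn hk
  exists_profile := exists_isTwistProfile hk
  monodromy _ h := ⟨h.isDiffeo_dehnTwist, h.descends, h.exists_contactomorphism hk⟩

end Monodromy

end BrieskornBook

end

theorem mainTheorem1 :
    (∀ n k : ℕ, 2 ≤ n → 1 ≤ k → BrieskornBook.HasDehnTwistOpenBook n k) ∧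
    (∀ n k : ℕ, BrieskornBook.IsUstilovskySphere n k →
      BrieskornBook.HasDehnTwistOpenBook n k) := by
  refine ⟨fun n k hn hk => BrieskornBook.hasDehnTwistOpenBook hn hk,
    fun n k ⟨hn, _, hk⟩ => BrieskornBook.hasDehnTwistOpenBook hn ?_⟩
  -- Either residue modulo 8 excludes k = 0.
  simp only [Nat.ModEq] at hk
  omega
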